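/- Let $X_1,\dots,X_n$ be random variables with values in $\{0,1,2,\dots\}$ that are 1-dependent (for $1\le s<t\le n$ with $t-s>1$, the $\sigma$-algebras $\sigma(X_1,\dots,X_s)$ and $\sigma(X_t,\dots,X_n)$ are independent), put $X_k\equiv0$ for $k\le 0$, and let $F$ be the distribution of $S_n=X_1+\dots+X_n$. **Notation.** Let $\nu_j(k)=\mathbf E\,X_k(X_k-1)\cdots(X_k-j+1)$. For random variables $Y_1,Y_2,\dots$ let $\widehat{\mathbf E}(Y_1)=\widehat{\mathbf E}^{+}(Y_1)=\mathbf E Y_1$ and, for $k\ge2$, $$\widehat{\mathbf E}(Y_1,\dots,Y_k)=\mathbf E Y_1\cdots Y_k-\sum_{j=1}^{k-1}\widehat{\mathbf E}(Y_1,\dots,Y_j)\,\mathbf E Y_{j+1}\cdots Y_k,$$ $$\widehat{\mathbf E}^{+}(Y_1,\dots,Y_k)=\mathbf E Y_1\cdots Y_k+\sum_{j=1}^{k-1}\widehat{\mathbf E}^{+}(Y_1,\dots,Y_j)\,\mathbf E Y_{j+1}\cdots Y_k,$$ and let $\widehat{\mathbf E}^{+}_2(X_{k-1},X_k)=\widehat{\mathbf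 E}^{+}(X_{k-1}(X_{k-1}-1),X_k)+\widehat{\mathbf E}^{+}(X_{k-1},X_k(X_k-1))$. Put $$\Gamma_1=\sum_{k=1}^n\nu_1(k),\qquad \Gamma_2=\tfrac12\sum_{k=1}^n\big(\nu_2(k)-\nu_1^2(k)\big)+\sum_{k=2}^n\widehat{\mathbf E}(X_{k-1},X_k),$$ $$\lambda=\sum_{k=1}^n\nu_1(k)-1.52\sum_{k=1}^n\nu_2(k)-12\sum_{k=2}^n\mathbf E X_{k-1}X_k,$$ $$R_0=\sum_{k=1}^n\big\{\nu_2(k)+\nu_1^2(k)+\mathbf E X_{k-1}X_k\big\},$$ $$R_1=\sum_{k=1}^n\big\{\nu_1^3(k)+\nu_1(k)\nu_2(k)+\nu_3(k)+[\nu_1(k-2)+\nu_1(k-1)+\nu_1(k)]\,\mathbf E X_{k-1}X_k+\widehat{\mathbf E}^{+}_2(X_{k-1},X_k)+\widehat{\mathbf E}^{+}(X_{k-2},X_{k-1},X_k)\big\}.$$ Let $I_a$ be the unit mass at $a$. With products and powers of measures in the convolution sense, $\exp\{M\}=\sum_{m\ge0}M^m/m!$; let $$\mathrm{Pois}(\Gamma_1)=\exp\{\Gamma_1(I_1-I_0)\},\qquad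 G=\exp\{\Gamma_1(I_1-I_0)+\Gamma_2(I_1-I_0)^2\}.$$ For $M$ on $\mathbb Z$ let $\|M\|=\sum_{k\in\mathbb Z}|M\{k\}|$ and $\|M\|_\infty=\sup_{k\in\mathbb Z}|M\{k\}|$. With $Z_j=e^{\mathrm itX_j}-1$ define $\varphi_1(t)=\mathbf E e^{\mathrm itX_1}$ and, for $k=2,\dots,n$, $$\varphi_k(t)=1+\mathbf E Z_k+\sum_{j=1}^{k-1}\frac{\widehat{\mathbf E}(Z_j,Z_{j+1},\dots,Z_k)}{\varphi_j(t)\varphi_{j+1}(t)\cdots\varphi_{k-1}(t)},$$ and, for $j=1,\dots,n$, $$\psi_j(t)=\exp\{\nu_1(j)(e^{\mathrm it}-1)\},\qquad g_j(t)=\exp\Big\{\nu_1(j)(e^{\mathrm it}-1)+\Big(\frac{\nu_2(j)-\nu_1^2(j)}2+\widehat{\mathbf E}(X_{j-1},X_j)\Big)(e^{\mathrm it}-1)^2\Big\}.$$ For $l\ge1$ the Bergström terms $B_l(\mathrm{Pois})$ and $B_l(G)$ are given by $$B_l(\cdot)\{k\}=\frac1{2\pi}\int_{-\pi}^{\pi}e^{-\mathrm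 itk}\sum_{m_1+\dots+m_n=l,\ m_i\in\{0,1\}}\ \prod_{j=1}^n a_j(t)^{1-m_j}\big(\varphi_j(t)-a_j(t)\big)^{m_j}\,dt,$$ with $a_j=\psi_j$ for $B_l(\mathrm{Pois})$ and $a_j=g_j$ for $B_l(G)$. **Theorem.** For every $s\in\{0,1,2,\dots\}$ there is a constant $C(s)>0$, depending only on $s$, such that for all $n\ge s$ and all $X_1,\dots,X_n$ as above that satisfy $$\nu_1(k)\le\tfrac1{100},\quad \nu_2(k)\le\nu_1(k),\quad \nu_4(k)<\infty\quad(k=1,\dots,n)\qquad\text{and}\qquad\lambda>0,$$ the following four estimates hold: $$\Big\|F-\mathrm{Pois}(\Gamma_1)-\sum_{l=1}^sB_l(\mathrm{Pois})\Big\|\le C(s)\{1+\Gamma_1\min(1,\lambda^{-1})\}R_0^{s+1}\min(1,\lambda^{-s-1}),$$ $$\Big\|F-\mathrm{Pois}(\Gamma_1)-\sum_{l=1}^sB_l(\mathrm{Pois})\Big\|_\infty\le C(s)\{1+\Gamma_1\min(1,\lambda^{-1})\}R_0^{s+1}\min(1,\lambda^{-s-3/2}),$$ $$\Big\|F-G-\sum_{l=1}^sB_l(G)\Big\|\le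 C(s)\{1+\Gamma_1\min(1,\lambda^{-1})\}R_1^{s+1}\min(1,\lambda^{-(3s+3)/2}),$$ $$\Big\|F-G-\sum_{l=1}^sB_l(G)\Big\|_\infty\le C(s)\{1+\Gamma_1\min(1,\lambda^{-1})\}R_1^{s+1}\min(1,\lambda^{-(3s+4)/2}).$$ -/

import Mathlib

open MeasureTheory ProbabilityTheory
open scoped ENNReal

noncomputable section

namespace Bergstrom

variable {Ω : Type*} [MeasurableSpace Ω]

/-! ### Heinrich's mixed "centred" moments -/

/-- `Ê(Y₁, …, Y_k) = E Y₁⋯Y_k - ∑_{j=1}^{k-1} Ê(Y₁, …, Y_j) E Y_{j+1}⋯Y_k`, for a list of real or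
complex random variables; `Ê(Y₁) = E Y₁`. -/
def wE {𝕜 : Type*} [RCLike 𝕜] (P : Measure Ω) (L : List (Ω → 𝕜)) : 𝕜 :=
  (∫ ω, L.prod ω ∂P) -
    ∑ j : Fin (L.length - 1), wE P (L.take (j + 1)) * ∫ ω, (L.drop (j + 1)).prod ω ∂P
termination_by L.length
decreasing_by
  have := j.2
  simp only [List.length_take]
  omega

/-- `Ê⁺(Y₁, …, Y_k) = E Y₁⋯Y_k + ∑_{j=1}^{k-1} Ê⁺(Y₁, …, Y_j) E Y_{j+1}⋯Y_k`, for a list of real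
random variables; `Ê⁺(Y₁) = E Y₁`. -/
def wEPlus (P : Measure Ω) (L : List (Ω → ℝ)) : ℝ :=
  (∫ ω, L.prod ω ∂P) +
    ∑ j : Fin (L.length - 1), wEPlus P (L.take (j + 1)) * ∫ ω, (L.drop (j + 1)).prod ω ∂P
termination_by L.length
decreasing_by
  have := j.2
  simp only [List.length_take]
  omega

/-! ### Dependence and moments

The summands are `X 1, …, X n`, with values in `ℕ`. The main theorem assumes `X 0 = 0`; since
`0 - 1 = 1 - 2 = 0` in `ℕ`, this is exactly the convention that `X_k` vanishes for `k ≤ 0`. -/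

/-- `X 1, …, X n` are 1-dependent. -/
def OneDependent (P : Measure Ω) (X : ℕ → Ω → ℕ) (n : ℕ) : Prop :=
  ∀ s t : ℕ, 1 ≤ s → s + 1 < t → t ≤ n →
    Indep (⨆ i ∈ Set.Icc 1 s, MeasurableSpace.comap (X i) ⊤)
      (⨆ i ∈ Set.Icc t n, MeasurableSpace.comap (X i) ⊤) P

/-- `X_k` as a real random variable. -/
def rv (X : ℕ → Ω → ℕ) (k : ℕ) : Ω → ℝ := fun ω => (X k ω : ℝ)

/-- The factorial power `X_k (X_k - 1) ⋯ (X_k - j + 1)` as a real random variable. -/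
def fac (X : ℕ → Ω → ℕ) (j k : ℕ) : Ω → ℝ := fun ω => ((X k ω).descFactorial j : ℝ)

/-- The factorial moment `ν_j(k)`. -/
def nu (P : Measure Ω) (X : ℕ → Ω → ℕ) (j k : ℕ) : ℝ := ∫ ω, fac X j k ω ∂P

/-- `E X_{k-1} X_k`. -/
def mom2 (P : Measure Ω) (X : ℕ → Ω → ℕ) (k : ℕ) : ℝ := ∫ ω, rv X (k - 1) ω * rv X k ω ∂P

def Gamma1 (P : Measure Ω) (X : ℕ → Ω → ℕ) (n : ℕ) : ℝ := ∑ k ∈ Finset.Icc 1 n, nu P X 1 k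

def Gamma2 (P : Measure Ω) (X : ℕ → Ω → ℕ) (n : ℕ) : ℝ :=
  1 / 2 * ∑ k ∈ Finset.Icc 1 n, (nu P X 2 k - nu P X 1 k ^ 2) +
    ∑ k ∈ Finset.Icc 2 n, wE P [rv X (k - 1), rv X k]

def lam (P : Measure Ω) (X : ℕ → Ω → ℕ) (n : ℕ) : ℝ :=
  ∑ k ∈ Finset.Icc 1 n, nu P X 1 k - 1.52 * ∑ k ∈ Finset.Icc 1 n, nu P X 2 k -
    12 * ∑ k ∈ Finset.Icc 2 n, mom2 P X k

def R0 (P : Measure Ω) (X : ℕ → Ω → ℕ) (n : ℕ) : ℝ :=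
  ∑ k ∈ Finset.Icc 1 n, (nu P X 2 k + nu P X 1 k ^ 2 + mom2 P X k)

/-- `Ê⁺₂(X_{k-1}, X_k) = Ê⁺(X_{k-1}(X_{k-1} - 1), X_k) + Ê⁺(X_{k-1}, X_k(X_k - 1))`. -/
def wEPlus2 (P : Measure Ω) (X : ℕ → Ω → ℕ) (k : ℕ) : ℝ :=
  wEPlus P [fac X 2 (k - 1), rv X k] + wEPlus P [rv X (k - 1), fac X 2 k]

def R1 (P : Measure Ω) (X : ℕ → Ω → ℕ) (n : ℕ) : ℝ :=
  ∑ k ∈ Finset.Icc 1 n,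
    (nu P X 1 k ^ 3 + nu P X 1 k * nu P X 2 k + nu P X 3 k +
      (nu P X 1 (k - 2) + nu P X 1 (k - 1) + nu P X 1 k) * mom2 P X k +
      wEPlus2 P X k + wEPlus P [rv X (k - 2), rv X (k - 1), rv X k])

/-! ### Measures on `ℤ`, given by their point masses -/

/-- The total variation norm `∑_k |M{k}|`. -/
def tvNorm (M : ℤ → ℂ) : ℝ≥0∞ := ∑' k, ‖M k‖ₑ

/-- The local norm `sup_k |M{k}|`. -/
def localNorm (M : ℤ → ℂ) : ℝ≥0∞ := ⨆ k, ‖M k‖ₑ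

/-- The distribution of `S_n = X_1 + ⋯ + X_n`. -/
def lawF (P : Measure Ω) (X : ℕ → Ω → ℕ) (n : ℕ) (k : ℤ) : ℝ :=
  P.real {ω | ((∑ i ∈ Finset.Icc 1 n, X i ω : ℕ) : ℤ) = k}

/-- `U = I_1 - I`, the difference of the unit masses at `1` and at `0`, in the algebra of finitely
supported signed measures on `ℤ` (the product is convolution). -/
def U : AddMonoidAlgebra ℝ ℤ := AddMonoidAlgebra.single 1 1 - AddMonoidAlgebra.single 0 1

/-- The measure `exp{M} = ∑_m M^m / m!`, powers in the convolution sense. -/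
def convExp (M : AddMonoidAlgebra ℝ ℤ) (k : ℤ) : ℝ :=
  ∑' m : ℕ, (M ^ m).coeff k / (m.factorial : ℝ)

theorem coeff_mul_sum (M N : AddMonoidAlgebra ℝ ℤ) (k : ℤ) :
    (M * N).coeff k = N.coeff.sum fun b c => M.coeff (k - b) * c := by
  induction N using AddMonoidAlgebra.induction_linear with
  | zero => simp
  | add x y hx hy =>
    rw [mul_add, AddMonoidAlgebra.coeff_add, Finsupp.add_apply, hx, hy, AddMonoidAlgebra.coeff_add, Finsupp.sum_add_index'] <;> intros <;> ring
  | single a r =>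
    rw [AddMonoidAlgebra.coeff_single, Finsupp.sum_single_index (by simp)]
    exact AddMonoidAlgebra.coeff_mul_single_eq_coeff_mul _ fun m' _ => (eq_sub_iff_add_eq (a := m')).symm

theorem abs_coeff_pow_le (M : AddMonoidAlgebra ℝ ℤ) (m : ℕ) (k : ℤ) :
    |(M ^ m).coeff k| ≤ (M.coeff.sum fun _ c => |c|) ^ m := by
  induction m generalizing k with
  | zero =>
    simp only [pow_zero, AddMonoidAlgebra.one_def, AddMonoidAlgebra.coeff_single, Finsupp.single_apply]; split_ifs <;> simp
  | succ m ih =>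
    rw [pow_succ, coeff_mul_sum, pow_succ]
    refine (Finset.abs_sum_le_sum_abs _ _).trans ?_
    rw [Finsupp.sum, Finset.mul_sum]
    refine Finset.sum_le_sum fun b _ => ?_
    rw [abs_mul]
    exact mul_le_mul_of_nonneg_right (ih _) (abs_nonneg _)

/-- The series defining `convExp M` always converges (absolutely). -/
theorem summable_convExp (M : AddMonoidAlgebra ℝ ℤ) (k : ℤ) :
    Summable fun m : ℕ => (M ^ m).coeff k / (m.factorial : ℝ) := by
  refine Summable.of_norm_bounded (Real.summable_pow_div_factorial (M.coeff.sum fun _ c => |c|)) fun m => ?_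
  rw [norm_div, Real.norm_eq_abs, Real.norm_natCast]
  gcongr
  exact abs_coeff_pow_le M m k

/-- `Pois(Γ₁) = exp{Γ₁ U}`. -/
def pois (P : Measure Ω) (X : ℕ → Ω → ℕ) (n : ℕ) : ℤ → ℝ := convExp (Gamma1 P X n • U)

/-- `G = exp{Γ₁ U + Γ₂ U²}`. -/
def lawG (P : Measure Ω) (X : ℕ → Ω → ℕ) (n : ℕ) : ℤ → ℝ :=
  convExp (Gamma1 P X n • U + Gamma2 P X n • U ^ 2)

/-! ### Heinrich's factorization and the Bergström terms -/

/-- `Z_j = e^{itX_j} - 1`. -/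
def Z (X : ℕ → Ω → ℕ) (t : ℝ) (j : ℕ) : Ω → ℂ :=
  fun ω => Complex.exp (Complex.I * t * (X j ω : ℂ)) - 1

/-- `φ_k = 1 + E Z_k + ∑_{j=1}^{k-1} Ê(Z_j, …, Z_k) / (φ_j ⋯ φ_{k-1})`; in particular
`φ_1(t) = E e^{itX_1}`. -/
def phi (P : Measure Ω) (X : ℕ → Ω → ℕ) (t : ℝ) (k : ℕ) : ℂ :=
  1 + (∫ ω, Z X t k ω ∂P) +
    ∑ j ∈ Finset.Ico 1 k, wE P ((List.Ico j (k + 1)).map (Z X t)) /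
      ∏ i ∈ (Finset.Ico j k).attach, phi P X t i.1
termination_by k
decreasing_by exact (Finset.mem_Ico.1 i.2).2

theorem phi_eq (P : Measure Ω) (X : ℕ → Ω → ℕ) (t : ℝ) (k : ℕ) :
    phi P X t k = 1 + (∫ ω, Z X t k ω ∂P) +
      ∑ j ∈ Finset.Ico 1 k, wE P ((List.Ico j (k + 1)).map (Z X t)) /
        ∏ i ∈ Finset.Ico j k, phi P X t i := by
  rw [phi]
  congr 1
  refine Finset.sum_congr rfl fun j _ => ?_
  rw [Finset.prod_attach (Finset.Ico j k) (fun i => phi P X t i)]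

/-- `ψ_j(t) = exp{ν_1(j)(e^{it} - 1)}`. -/
def psi (P : Measure Ω) (X : ℕ → Ω → ℕ) (t : ℝ) (j : ℕ) : ℂ :=
  Complex.exp ((nu P X 1 j : ℂ) * (Complex.exp (Complex.I * t) - 1))

/-- `g_j(t)`, the `j`-th factor of the Fourier transform of `G`. -/
def g (P : Measure Ω) (X : ℕ → Ω → ℕ) (t : ℝ) (j : ℕ) : ℂ :=
  Complex.exp ((nu P X 1 j : ℂ) * (Complex.exp (Complex.I * t) - 1) +
    (((nu P X 2 j - nu P X 1 j ^ 2) / 2 + wE P [rv X (j - 1), rv X j] : ℝ) : ℂ) *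
      (Complex.exp (Complex.I * t) - 1) ^ 2)

/-- `∑ ∏_{j=1}^n a_j^{1-m_j} (f_j - a_j)^{m_j}`, the sum being over all `m ∈ {0,1}^n` with
`m_1 + ⋯ + m_n = l`; `m` is encoded as the set `A` of those `j` with `m_j = 1`. -/
def brgSum (n l : ℕ) (f a : ℕ → ℂ) : ℂ :=
  ∑ A ∈ (Finset.Icc 1 n).powersetCard l,
    (∏ j ∈ Finset.Icc 1 n \ A, a j) * ∏ j ∈ A, (f j - a j)

/-- Point masses of the measure with Fourier transform `h`. -/
def invFourier (h : ℝ → ℂ) (k : ℤ) : ℂ :=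
  1 / (2 * (Real.pi : ℂ)) *
    ∫ t in (-Real.pi)..Real.pi, Complex.exp (-(Complex.I * t * (k : ℂ))) * h t

/-- The Bergström term `B_l(Pois)`. -/
def brgPois (P : Measure Ω) (X : ℕ → Ω → ℕ) (n l : ℕ) : ℤ → ℂ :=
  invFourier fun t => brgSum n l (phi P X t) (psi P X t)

/-- The Bergström term `B_l(G)`. -/
def brgG (P : Measure Ω) (X : ℕ → Ω → ℕ) (n l : ℕ) : ℤ → ℂ :=
  invFourier fun t => brgSum n l (phi P X t) (g P X t)

/-- `F - Pois(Γ₁) - ∑_{l=1}^s B_l(Pois)`. -/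
def errPois (P : Measure Ω) (X : ℕ → Ω → ℕ) (n s : ℕ) (k : ℤ) : ℂ :=
  (lawF P X n k : ℂ) - (pois P X n k : ℂ) - ∑ l ∈ Finset.Icc 1 s, brgPois P X n l k

/-- `F - G - ∑_{l=1}^s B_l(G)`. -/
def errG (P : Measure Ω) (X : ℕ → Ω → ℕ) (n s : ℕ) (k : ℤ) : ℂ :=
  (lawF P X n k : ℂ) - (lawG P X n k : ℂ) - ∑ l ∈ Finset.Icc 1 s, brgG P X n l k

end Bergstrom

end

set_option linter.unusedSectionVars false

noncomputable section

namespace Bergstrom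

section

/-! ### Norms of measures through their Fourier transforms -/

/-! Write `y = |e^{it} - 1|`, let `F_k` be the characteristic function of `X_1 + ⋯ + X_k`, and
recall Heinrich's factorization `F_n = φ_1 ⋯ φ_n` with `φ_k = F_k / F_{k-1}` (`Regular.phi_eq_div`).
The error in question is the inverse Fourier transform of the Bergström remainder `∏ φ_j - ∑_{l ≤ s}
brgSum n l φ a`, where `a_j` is `ψ_j` or `g_j` (`Regular.err_eq`). So the proof needs three things.

Decay: both `φ_j` and `a_j` are at most `exp(-0.43 λ_j y²)` in modulus (`Regular.norm_ratio_le`,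
`norm_psi_le`, `Regular.norm_g_le`). The `λ_j` may have either sign; only their sum `λ` has to be
positive.

Closeness: `φ_j - ψ_j = O(y²)` with coefficients summing to `O(R0)`, and `φ_j - g_j = O(y³)` with
coefficients summing to `O(R1)` (`Regular.jn_ratio_sub_psi_le`, `Regular.jn_ratio_sub_g_le`). A
Pascal-type recursion for the remainder then bounds it by `exp(-0.43 λ y²) (C R y^m)^{s+1}`
(`norm_brgRem_le`).

Inversion: for the local norm, integrate this bound. For the total variation norm, use
Cauchy-Schwarz with the weight `1 + ((k - Γ₁)/b)²`, `b = max(1, √λ)`, and Parseval. This requires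
the derivative as well, after removal of the rotation `iΓ₁` (`exists_brgRem_deriv`,
`exists_norm_invFourier_bounds`). The term `Γ₁ min(1, 1/λ)` in the statement is the cost of centring
at `Γ₁` while the Gaussian majorant has width governed by `λ`.

Functions and derivatives are estimated together through `jn f = |f| + (y/1000)|f'|`. It is
submultiplicative, and differentiating `Z_j` costs a factor of order `1/y`, which the weight `y`
repays; the factor `1/1000` keeps the derivative from spoiling numerical constants.

The probabilistic input is the expansion `F_k = F_{k-1} + ∑_j F_{j-2} E Z_j ⋯ Z_k`
(`Regular.cF_succ`). Mixed moments `E|Z_j| ⋯ |Z_k|` decay geometrically in the length of the block: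
replacing a factor by the bound 2 leaves a gap, and across a gap 1-dependence factorizes the
expectation (`Regular.blk_drop`). An induction (`Regular.cF_jet`) shows that no `F_k` vanishes and
that `φ_k` stays within `1/10` of `1`. After that, `φ_k - 1` is the mean of `Z_k`, a pair term, and
a small sum of longer blocks. The one complication is that a differentiated factor `∂Z_i`, of size
`X_i`, is unbounded and can never be dropped; this is why blocks carry a marked index. -/

theorem norm_exp_neg_I_mul (t : ℝ) (k : ℤ) : ‖Complex.exp (-(Complex.I * t * (k : ℂ)))‖ = 1 := by
  rw [Complex.norm_exp]; simp

theorem norm_invFourier_le {h : ℝ → ℂ} {W : ℝ → ℝ} (hW : Continuous W)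
    (hh : ∀ t ∈ Set.Icc (-Real.pi) Real.pi, ‖h t‖ ≤ W t) (k : ℤ) :
    ‖invFourier h k‖ ≤ 1 / (2 * Real.pi) * ∫ t in (-Real.pi)..Real.pi, W t := by
  have hpi := Real.pi_pos
  have h2 : ‖(1 / (2 * (Real.pi : ℂ)))‖ = 1 / (2 * Real.pi) := by
    simp [abs_of_pos hpi]
  rw [invFourier, norm_mul, h2]
  refine mul_le_mul_of_nonneg_left ?_ (by positivity)
  refine intervalIntegral.norm_integral_le_of_norm_le (by linarith) ?_ (hW.intervalIntegrable _ _)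
  refine Filter.Eventually.of_forall fun t ht => ?_
  rw [norm_mul, norm_exp_neg_I_mul, one_mul]
  exact hh t ⟨ht.1.le, ht.2⟩

theorem invFourier_eq_fourierCoeffOn (h : ℝ → ℂ) (k : ℤ) :
    invFourier h k =
      fourierCoeffOn (show -Real.pi < Real.pi by linarith [Real.pi_pos]) h k := by
  rw [fourierCoeffOn_eq_integral, invFourier, Complex.real_smul]
  congr 1
  · push_cast; congr 1; ring
  · refine intervalIntegral.integral_congr fun t _ => ?_
    have hpi : (Real.pi : ℂ) ≠ 0 := by exact_mod_cast Real.pi_ne_zero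
    simp only [smul_eq_mul]
    rw [fourier_coe_apply]
    congr 2
    push_cast
    field_simp
    ring

theorem sum_sq_invFourier_le {h : ℝ → ℂ} (hm : AEStronglyMeasurable h) {W : ℝ → ℝ}
    (hW : Continuous W) (hh : ∀ᵐ t : ℝ, t ∈ Set.Ioc (-Real.pi) Real.pi → ‖h t‖ ≤ W t)
    (S : Finset ℤ) :
    ∑ k ∈ S, ‖invFourier h k‖ ^ 2 ≤
      1 / (2 * Real.pi) * ∫ t in (-Real.pi)..Real.pi, W t ^ 2 := by
  have hpi := Real.pi_pos
  have hlt : -Real.pi < Real.pi := by linarith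
  have hae : ∀ᵐ t ∂(volume.restrict (Set.Ioc (-Real.pi) Real.pi)), ‖h t‖ ≤ W t :=
    (ae_restrict_iff' measurableSet_Ioc).2 hh
  obtain ⟨B, hB⟩ := (isCompact_Icc (a := -Real.pi) (b := Real.pi)).exists_bound_of_continuousOn
    hW.continuousOn
  have hL2 : MemLp h 2 (volume.restrict (Set.Ioc (-Real.pi) Real.pi)) := by
    refine MemLp.of_bound hm.restrict B ?_
    filter_upwards [hae, ae_restrict_mem measurableSet_Ioc] with t ht hmem
    exact ht.trans ((le_abs_self _).trans (hB t ⟨hmem.1.le, hmem.2⟩))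
  have hs := hasSum_sq_fourierCoeffOn hlt hL2
  have h1 : ∑ k ∈ S, ‖invFourier h k‖ ^ 2 ≤
      (Real.pi - -Real.pi)⁻¹ • ∫ x in (-Real.pi)..Real.pi, ‖h x‖ ^ 2 := by
    simp_rw [invFourier_eq_fourierCoeffOn]
    exact sum_le_hasSum S (fun _ _ => by positivity) hs
  refine h1.trans ?_
  rw [smul_eq_mul, show (Real.pi - -Real.pi)⁻¹ = 1 / (2 * Real.pi) by rw [one_div]; congr 1; ring]
  refine mul_le_mul_of_nonneg_left ?_ (by positivity)
  rw [intervalIntegral.integral_of_le hlt.le, intervalIntegral.integral_of_le hlt.le]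
  refine integral_mono_of_nonneg (Filter.Eventually.of_forall fun t => by positivity) ?_ ?_
  · exact (hW.pow 2).integrableOn_Icc.mono_set Set.Ioc_subset_Icc_self
  · filter_upwards [hae] with t ht
    exact pow_le_pow_left₀ (norm_nonneg _) ht 2

/-- Integration by parts, with boundary terms cancelling by periodicity. Subtracting `iah` centres
the factor `k` at `a`. -/
theorem invFourier_deriv_sub {h h' : ℝ → ℂ} (hd : ∀ t, HasDerivAt h (h' t) t)
    (hi : IntervalIntegrable h' volume (-Real.pi) Real.pi) (hper : h (-Real.pi) = h Real.pi)
    (a : ℝ) (k : ℤ) :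
    invFourier (fun t => h' t - Complex.I * a * h t) k =
      Complex.I * ((k : ℂ) - a) * invFourier h k := by
  have hcont : Continuous h := continuous_iff_continuousAt.2 fun t => (hd t).continuousAt
  have hexp : ∀ t : ℝ, HasDerivAt (fun t : ℝ => Complex.exp (-(Complex.I * t * (k : ℂ))))
      (Complex.exp (-(Complex.I * t * (k : ℂ))) * (-(Complex.I * (k : ℂ)))) t := by
    intro t
    have h0 : HasDerivAt (fun t : ℝ => (t : ℂ)) 1 t := Complex.ofRealCLM.hasDerivAt
    have := (((h0.const_mul Complex.I).mul_const (k : ℂ)).neg).cexp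
    simpa using this
  have hec : Continuous fun t : ℝ => Complex.exp (-(Complex.I * t * (k : ℂ))) := by fun_prop
  have hprod : ∀ t : ℝ, HasDerivAt (fun t : ℝ => Complex.exp (-(Complex.I * t * (k : ℂ))) * h t)
      (Complex.exp (-(Complex.I * t * (k : ℂ))) * h' t -
        Complex.I * k * (Complex.exp (-(Complex.I * t * (k : ℂ))) * h t)) t := by
    intro t
    exact ((hexp t).mul (hd t)).congr_deriv (by ring)
  have hi1 : IntervalIntegrable (fun t : ℝ => Complex.exp (-(Complex.I * t * (k : ℂ))) * h' t)
      volume (-Real.pi) Real.pi := hi.continuousOn_mul hec.continuousOn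
  have hi2 : IntervalIntegrable (fun t : ℝ => Complex.exp (-(Complex.I * t * (k : ℂ))) * h t)
      volume (-Real.pi) Real.pi := (hec.mul hcont).intervalIntegrable _ _
  have key := intervalIntegral.integral_eq_sub_of_hasDerivAt (fun t _ => hprod t)
    (hi1.sub (hi2.const_mul _))
  have hend : Complex.exp (-(Complex.I * ((-Real.pi : ℝ) : ℂ) * (k : ℂ))) =
      Complex.exp (-(Complex.I * (Real.pi : ℂ) * (k : ℂ))) := by
    rw [Complex.exp_eq_exp_iff_exists_int]
    exact ⟨k, by push_cast; ring⟩
  rw [hper, hend, sub_self, intervalIntegral.integral_sub hi1 (hi2.const_mul _),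
    intervalIntegral.integral_const_mul] at key
  have hsplit : ∫ t in (-Real.pi)..Real.pi, Complex.exp (-(Complex.I * t * (k : ℂ))) *
      (h' t - Complex.I * a * h t) =
      (∫ t in (-Real.pi)..Real.pi, Complex.exp (-(Complex.I * t * (k : ℂ))) * h' t) -
      Complex.I * a * ∫ t in (-Real.pi)..Real.pi, Complex.exp (-(Complex.I * t * (k : ℂ))) * h t := by
    rw [← intervalIntegral.integral_const_mul, ← intervalIntegral.integral_sub hi1 (hi2.const_mul _)]
    refine intervalIntegral.integral_congr fun t _ => ?_
    ring
  simp only [invFourier]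
  rw [hsplit]
  linear_combination (1 / (2 * (Real.pi : ℂ))) * key

/-- Comparison with `∫ w = πb`: since `b ≥ 1`, the weight changes by a factor of at most 3 on each
interval `[k, k+1)`. -/
theorem sum_weight_le (a : ℝ) {b : ℝ} (hb : 1 ≤ b) (S : Finset ℤ) :
    ∑ k ∈ S, (1 + (((k : ℝ) - a) / b) ^ 2)⁻¹ ≤ 3 * Real.pi * b := by
  have hb0 : 0 < b := by linarith
  set w : ℝ → ℝ := fun x => (1 + ((x - a) / b) ^ 2)⁻¹ with hw
  have hint : Integrable w := by
    have h1 := (integrable_inv_one_add_sq).comp_div hb0.ne'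
    exact h1.comp_sub_right a
  have htot : ∫ x, w x = Real.pi * b := by
    have h1 : ∫ x, w x = ∫ x, (1 + (x / b) ^ 2)⁻¹ :=
      integral_sub_right_eq_self (fun x : ℝ => (1 + (x / b) ^ 2)⁻¹) a
    rw [h1, Measure.integral_comp_div (fun x : ℝ => (1 + x ^ 2)⁻¹) b, integral_univ_inv_one_add_sq,
      abs_of_pos hb0, smul_eq_mul, mul_comm]
  have hstep : ∀ k : ℤ, w k ≤ 3 * ∫ x in Set.Ico (k : ℝ) (k + 1), w x := by
    intro k
    have hle : ∀ x ∈ Set.Ico (k : ℝ) (k + 1), w k / 3 ≤ w x := by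
      intro x hx
      simp only [hw]
      rw [← one_div, ← one_div, div_div]
      refine one_div_le_one_div_of_le (by positivity) ?_
      set p := ((k : ℝ) - a) / b
      set q := (x - a) / b
      have hqp : q - p = (x - k) / b := by simp only [p, q]; ring
      have h0 : 0 ≤ q - p := by rw [hqp]; exact div_nonneg (by linarith [hx.1]) hb0.le
      have h1 : q - p ≤ 1 := by
        rw [hqp, div_le_one hb0]; linarith [hx.2]
      -- With `d = q - p ∈ [0, 1]`, `q² = (p + d)² ≤ 2p² + 2`, hence `1 + q² ≤ 3(1 + p²)`.
      nlinarith [sq_nonneg (p - (q - p))]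
    have h2 : ∫ _ in Set.Ico (k : ℝ) (k + 1), w k / 3 ≤ ∫ x in Set.Ico (k : ℝ) (k + 1), w x :=
      setIntegral_mono_on (by simp) hint.integrableOn measurableSet_Ico hle
    rw [setIntegral_const] at h2
    simp at h2
    linarith
  calc ∑ k ∈ S, w k ≤ ∑ k ∈ S, 3 * ∫ x in Set.Ico (k : ℝ) (k + 1), w x :=
        Finset.sum_le_sum fun k _ => hstep k
    _ = 3 * ∫ x in ⋃ k ∈ S, Set.Ico (k : ℝ) (k + 1), w x := by
        rw [← Finset.mul_sum, integral_biUnion_finset S (fun _ _ => measurableSet_Ico)]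
        · intro i _ j _ hij
          exact Set.pairwise_disjoint_Ico_intCast ℝ hij
        · exact fun _ _ => hint.integrableOn
    _ ≤ 3 * ∫ x, w x := by
        refine mul_le_mul_of_nonneg_left (setIntegral_le_integral hint ?_) (by norm_num)
        exact Filter.Eventually.of_forall fun x => by simp only [hw, Pi.zero_apply]; positivity
    _ = 3 * Real.pi * b := by rw [htot]; ring

/-- Cauchy-Schwarz with the weight `1 + ((k - a)/b)²`, then Bessel's inequality for `h` and for `h'
- iah`. The constant is `3πb · 1/(2π)`. -/
theorem sq_sum_norm_invFourier_le {h : ℝ → ℂ} (hd : Differentiable ℝ h)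
    (hper : h (-Real.pi) = h Real.pi) (a : ℝ) {b : ℝ} (hb : 1 ≤ b) {U W : ℝ → ℝ}
    (hUc : Continuous U) (hWc : Continuous W)
    (hU : ∀ t ∈ Set.Icc (-Real.pi) Real.pi, ‖h t‖ ≤ U t)
    (hW : ∀ t ∈ Set.Icc (-Real.pi) Real.pi, t ≠ 0 → ‖deriv h t - Complex.I * a * h t‖ ≤ W t)
    (S : Finset ℤ) :
    (∑ k ∈ S, ‖invFourier h k‖) ^ 2 ≤
      3 / 2 * b * ((∫ t in (-Real.pi)..Real.pi, U t ^ 2) +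
        (b ^ 2)⁻¹ * ∫ t in (-Real.pi)..Real.pi, W t ^ 2) := by
  have hpi := Real.pi_pos
  have hb0 : 0 < b := by linarith
  -- The bound `W` is required only away from the null set `{0}`, because derivatives are later
  -- controlled through a division by `y`.
  have hne : ∀ᵐ t : ℝ, t ≠ 0 := by
    simp [ae_iff]
  have hWae : ∀ᵐ t : ℝ, t ∈ Set.Ioc (-Real.pi) Real.pi →
      ‖deriv h t - Complex.I * a * h t‖ ≤ W t := by
    filter_upwards [hne] with t ht hmem
    exact hW t ⟨hmem.1.le, hmem.2⟩ ht
  have hmd : AEStronglyMeasurable (deriv h) := (measurable_deriv h).aestronglyMeasurable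
  have hc : Continuous h := hd.continuous
  have hi : IntervalIntegrable (deriv h) volume (-Real.pi) Real.pi := by
    rw [intervalIntegrable_iff, Set.uIoc_of_le (by linarith)]
    refine Integrable.mono' (g := fun t => W t + ‖Complex.I * a * h t‖) ?_ hmd.restrict ?_
    · have : Continuous fun t => W t + ‖Complex.I * a * h t‖ := by fun_prop
      exact this.integrableOn_Icc.mono_set Set.Ioc_subset_Icc_self
    · rw [ae_restrict_iff' measurableSet_Ioc]
      filter_upwards [hWae] with t ht hmem
      have := ht hmem
      have h3 := norm_sub_norm_le (deriv h t) (Complex.I * a * h t)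
      linarith
  have hder := invFourier_deriv_sub (fun t => (hd t).hasDerivAt) hi hper a
  have hB1 := sum_sq_invFourier_le (hc.aestronglyMeasurable (μ := volume)) hUc
    (Filter.Eventually.of_forall fun t ht => hU t ⟨ht.1.le, ht.2⟩) S
  have hB2 := sum_sq_invFourier_le (h := fun t => deriv h t - Complex.I * a * h t)
    (hmd.sub (hc.const_smul (Complex.I * a)).aestronglyMeasurable) hWc hWae S
  have hw := sum_weight_le a hb S
  set A := ∫ t in (-Real.pi)..Real.pi, U t ^ 2
  set D := ∫ t in (-Real.pi)..Real.pi, W t ^ 2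
  have hcs := Finset.sum_mul_sq_le_sq_mul_sq S
    (fun k : ℤ => Real.sqrt ((1 + (((k : ℝ) - a) / b) ^ 2)⁻¹))
    (fun k => Real.sqrt (1 + (((k : ℝ) - a) / b) ^ 2) * ‖invFourier h k‖)
  have e1 : ∀ k : ℤ, Real.sqrt ((1 + (((k : ℝ) - a) / b) ^ 2)⁻¹) *
      (Real.sqrt (1 + (((k : ℝ) - a) / b) ^ 2) * ‖invFourier h k‖) = ‖invFourier h k‖ := by
    intro k
    rw [← mul_assoc, Real.sqrt_inv, inv_mul_cancel₀ (Real.sqrt_pos.2 (by positivity)).ne', one_mul]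
  have e2 : ∀ k : ℤ, Real.sqrt ((1 + (((k : ℝ) - a) / b) ^ 2)⁻¹) ^ 2 =
      (1 + (((k : ℝ) - a) / b) ^ 2)⁻¹ := fun k => Real.sq_sqrt (by positivity)
  have e3 : ∀ k : ℤ, (Real.sqrt (1 + (((k : ℝ) - a) / b) ^ 2) * ‖invFourier h k‖) ^ 2 =
      ‖invFourier h k‖ ^ 2 +
        (b ^ 2)⁻¹ * ‖invFourier (fun t => deriv h t - Complex.I * a * h t) k‖ ^ 2 := by
    intro k
    rw [hder, mul_pow, Real.sq_sqrt (by positivity), norm_mul, norm_mul, Complex.norm_I, one_mul,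
      show ((k : ℂ) - a) = (((k : ℝ) - a : ℝ) : ℂ) by push_cast; ring, Complex.norm_real,
      Real.norm_eq_abs, mul_pow, sq_abs, div_pow]
    ring
  simp only [e1, e2, e3, Finset.sum_add_distrib, ← Finset.mul_sum] at hcs
  refine hcs.trans ?_
  calc _ ≤ (3 * Real.pi * b) * (1 / (2 * Real.pi) * A + (b ^ 2)⁻¹ * (1 / (2 * Real.pi) * D)) := by
        gcongr
    _ = _ := by field_simp

/-- Substitute `u = bt` and enlarge the domain to the whole line; each power of `|t|` is worth
`1/b`. -/
theorem exists_integral_gaussian_le (q : ℕ) {c : ℝ} (hc : 0 < c) :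
    ∃ K : ℝ, 0 ≤ K ∧ ∀ b : ℝ, 0 < b →
      ∫ t in (-Real.pi)..Real.pi, |t| ^ q * Real.exp (-c * (b * t) ^ 2) ≤ K * (b ^ (q + 1))⁻¹ := by
  have hpi := Real.pi_pos
  set gq : ℝ → ℝ := fun u => |u| ^ q * Real.exp (-c * u ^ 2) with hg
  have hint : Integrable gq := by
    have h := (integrable_rpow_mul_exp_neg_mul_sq hc (s := q) (by
      have : (0 : ℝ) ≤ q := Nat.cast_nonneg q
      linarith)).norm
    refine h.congr (Filter.Eventually.of_forall fun u => ?_)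
    simp [hg, Real.rpow_natCast, abs_of_pos (Real.exp_pos _)]
  have hnn : ∀ u, 0 ≤ gq u := fun u => by positivity
  refine ⟨∫ u, gq u, integral_nonneg hnn, fun b hb => ?_⟩
  have hb' : b ≠ 0 := hb.ne'
  have hsc : ∀ t : ℝ, |t| ^ q * Real.exp (-c * (b * t) ^ 2) = (b ^ q)⁻¹ * gq (b * t) := by
    intro t
    simp only [hg]
    rw [abs_mul, abs_of_pos hb, mul_pow b |t|, mul_assoc, inv_mul_cancel_left₀ (pow_ne_zero q hb')]
  simp_rw [hsc]
  rw [intervalIntegral.integral_const_mul]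
  have hint2 : Integrable fun t => gq (b * t) := hint.comp_mul_left' hb'
  have h1 : ∫ t in (-Real.pi)..Real.pi, gq (b * t) ≤ ∫ t, gq (b * t) := by
    rw [intervalIntegral.integral_of_le (by linarith)]
    exact setIntegral_le_integral hint2 (Filter.Eventually.of_forall fun t => hnn _)
  rw [Measure.integral_comp_mul_left, abs_of_pos (inv_pos.2 hb), smul_eq_mul] at h1
  calc (b ^ q)⁻¹ * ∫ t in (-Real.pi)..Real.pi, gq (b * t)
      ≤ (b ^ q)⁻¹ * (b⁻¹ * ∫ u, gq u) := by gcongr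
    _ = _ := by rw [pow_succ, mul_inv]; ring

end

section

/-! ### Inversion formulas -/

theorem integral_exp_I_mul_int (m : ℤ) :
    ∫ t in (-Real.pi)..Real.pi, Complex.exp (Complex.I * t * (m : ℂ)) =
      if m = 0 then 2 * (Real.pi : ℂ) else 0 := by
  split_ifs with h
  · subst h
    simp
    ring
  · have hm : Complex.I * (m : ℂ) ≠ 0 := mul_ne_zero Complex.I_ne_zero (by exact_mod_cast h)
    have h1 : ∀ t : ℝ, Complex.exp (Complex.I * t * (m : ℂ)) =
        Complex.exp (Complex.I * (m : ℂ) * t) := fun t => by congr 1; ring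
    simp_rw [h1]
    rw [integral_exp_mul_complex hm]
    have : Complex.exp (Complex.I * (m : ℂ) * (Real.pi : ℂ)) =
        Complex.exp (Complex.I * (m : ℂ) * ((-Real.pi : ℝ) : ℂ)) := by
      rw [Complex.exp_eq_exp_iff_exists_int]
      exact ⟨m, by push_cast; ring⟩
    rw [this, sub_self, zero_div]

/-- The Fourier transform of a finitely supported measure on `ℤ`, as an algebra homomorphism. -/
def hat (t : ℝ) : AddMonoidAlgebra ℝ ℤ →ₐ[ℝ] ℂ :=
  AddMonoidAlgebra.lift ℝ ℂ ℤ
    { toFun := fun k => Complex.exp (Complex.I * t * ((Multiplicative.toAdd k : ℤ) : ℂ))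
      map_one' := by simp
      map_mul' := fun a b => by rw [← Complex.exp_add]; congr 1; simp; ring }

theorem hat_single (t : ℝ) (k : ℤ) (c : ℝ) :
    hat t (AddMonoidAlgebra.single k c) = (c : ℂ) * Complex.exp (Complex.I * t * (k : ℂ)) := by
  rw [hat, AddMonoidAlgebra.lift_single]
  simp

theorem hat_U (t : ℝ) : hat t U = Complex.exp (Complex.I * t) - 1 := by
  rw [U, map_sub, hat_single, hat_single]; simp

theorem exists_hat_bound (M : AddMonoidAlgebra ℝ ℤ) :
    Continuous (fun t => hat t M) ∧ ∃ B : ℝ, ∀ t, ‖hat t M‖ ≤ B := by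
  induction M using AddMonoidAlgebra.induction_linear with
  | zero => exact ⟨by simpa using continuous_const, 0, by simp⟩
  | add x y hx hy =>
    obtain ⟨hx, B, hB⟩ := hx
    obtain ⟨hy, B', hB'⟩ := hy
    refine ⟨by simp only [map_add]; exact hx.add hy, B + B', fun t => ?_⟩
    rw [map_add]
    exact (norm_add_le _ _).trans (add_le_add (hB t) (hB' t))
  | single a r =>
    simp only [hat_single]
    refine ⟨by fun_prop, |r|, fun t => ?_⟩
    rw [norm_mul, Complex.norm_exp]; simp

theorem invFourier_hat (M : AddMonoidAlgebra ℝ ℤ) (k : ℤ) :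
    invFourier (fun t => hat t M) k = (M.coeff k : ℂ) := by
  induction M using AddMonoidAlgebra.induction_linear with
  | zero => simp [invFourier]
  | add x y hx hy =>
    rw [AddMonoidAlgebra.coeff_add, Finsupp.add_apply]
    push_cast
    rw [← hx, ← hy]
    simp only [invFourier, map_add, mul_add]
    rw [intervalIntegral.integral_add]
    · ring
    · have := (exists_hat_bound x).1
      exact Continuous.intervalIntegrable (by fun_prop) _ _
    · have := (exists_hat_bound y).1
      exact Continuous.intervalIntegrable (by fun_prop) _ _
  | single a r =>
    have hpi : (Real.pi : ℂ) ≠ 0 := by exact_mod_cast Real.pi_ne_zero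
    have h1 : ∀ t : ℝ, Complex.exp (-(Complex.I * t * (k : ℂ))) * hat t (AddMonoidAlgebra.single a r)
        = (r : ℂ) * Complex.exp (Complex.I * t * ((a - k : ℤ) : ℂ)) := by
      intro t
      rw [hat_single, mul_left_comm, ← Complex.exp_add]
      congr 2; push_cast; ring
    simp only [invFourier]
    simp_rw [h1]
    rw [intervalIntegral.integral_const_mul, integral_exp_I_mul_int,
      AddMonoidAlgebra.coeff_single, Finsupp.single_apply]
    by_cases h : a = k
    · simp [h]; field_simp
    · simp [h, sub_eq_zero]

/-- The exponential series is integrated term by term, dominated by `∑ B^m / m!`; each term is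
`invFourier_hat` for the convolution power, since `hat t` is multiplicative. -/
theorem convExp_eq_invFourier (M : AddMonoidAlgebra ℝ ℤ) (k : ℤ) :
    (convExp M k : ℂ) = invFourier (fun t => Complex.exp (hat t M)) k := by
  obtain ⟨hc, B, hB⟩ := exists_hat_bound M
  have hsum : HasSum (fun m : ℕ => ∫ t in (-Real.pi)..Real.pi,
      Complex.exp (-(Complex.I * t * (k : ℂ))) * ((hat t M) ^ m / (m.factorial : ℂ)))
      (∫ t in (-Real.pi)..Real.pi, Complex.exp (-(Complex.I * t * (k : ℂ))) *
        Complex.exp (hat t M)) := by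
    refine intervalIntegral.hasSum_integral_of_dominated_convergence
      (fun m _ => B ^ m / (m.factorial : ℝ)) ?_ ?_ ?_ ?_ ?_
    · intro m
      exact Continuous.aestronglyMeasurable (by fun_prop)
    · intro m
      refine Filter.Eventually.of_forall fun t _ => ?_
      rw [norm_mul, norm_exp_neg_I_mul, one_mul, norm_div, norm_pow, Complex.norm_natCast]
      have := hB t
      gcongr
    · exact Filter.Eventually.of_forall fun t _ => Real.summable_pow_div_factorial B
    · exact intervalIntegrable_const
    · refine Filter.Eventually.of_forall fun t _ => ?_
      refine HasSum.mul_left _ ?_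
      rw [Complex.exp_eq_exp_ℂ]
      exact NormedSpace.expSeries_div_hasSum_exp (hat t M)
  have h2 := hsum.mul_left (1 / (2 * (Real.pi : ℂ)))
  have h3 : ∀ m : ℕ, 1 / (2 * (Real.pi : ℂ)) * ∫ t in (-Real.pi)..Real.pi,
      Complex.exp (-(Complex.I * t * (k : ℂ))) * ((hat t M) ^ m / (m.factorial : ℂ)) =
      (((M ^ m).coeff k / (m.factorial : ℝ) : ℝ) : ℂ) := by
    intro m
    rw [Complex.ofReal_div, ← invFourier_hat, Complex.ofReal_natCast, invFourier, mul_div_assoc]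
    congr 1
    rw [← intervalIntegral.integral_div]
    refine intervalIntegral.integral_congr fun t _ => ?_
    simp only [map_pow]
    ring
  simp_rw [h3] at h2
  rw [invFourier, ← h2.tsum_eq, convExp, Complex.ofReal_tsum]

variable {Ω : Type*} [MeasurableSpace Ω] {P : Measure Ω} [IsProbabilityMeasure P]

theorem measureReal_eq_invFourier {S : Ω → ℕ} (hS : Measurable S) (k : ℤ) :
    (P.real {ω | (S ω : ℤ) = k} : ℂ) =
      invFourier (fun t => ∫ ω, Complex.exp (Complex.I * t * (S ω : ℂ)) ∂P) k := by
  have hpi := Real.pi_pos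
  have hpc : (Real.pi : ℂ) ≠ 0 := by exact_mod_cast Real.pi_ne_zero
  have hle : -Real.pi ≤ Real.pi := by linarith
  have hmeas : Measurable fun p : ℝ × Ω =>
      Complex.exp (Complex.I * (p.1 : ℂ) * (((S p.2 : ℤ) - k : ℤ) : ℂ)) := by
    have h1 : Measurable fun p : ℝ × Ω => (((S p.2 : ℤ) - k : ℤ) : ℂ) :=
      (measurable_from_top (f := fun m : ℕ => (((m : ℤ) - k : ℤ) : ℂ))).comp (hS.comp measurable_snd)
    have h2 : Measurable fun p : ℝ × Ω => (p.1 : ℂ) := Complex.measurable_ofReal.comp measurable_fst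
    exact Complex.measurable_exp.comp ((measurable_const.mul h2).mul h1)
  have hint : Integrable (Function.uncurry fun (t : ℝ) (ω : Ω) =>
      Complex.exp (Complex.I * (t : ℂ) * (((S ω : ℤ) - k : ℤ) : ℂ)))
      ((volume.restrict (Set.Ioc (-Real.pi) Real.pi)).prod P) := by
    refine Integrable.of_bound hmeas.aestronglyMeasurable 1 (Filter.Eventually.of_forall fun p => ?_)
    simp only [Function.uncurry]
    rw [Complex.norm_exp]
    simp
  have hswap := integral_integral_swap hint
  have h1 : ∀ t : ℝ, Complex.exp (-(Complex.I * t * (k : ℂ))) *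
      ∫ ω, Complex.exp (Complex.I * t * (S ω : ℂ)) ∂P =
      ∫ ω, Complex.exp (Complex.I * (t : ℂ) * (((S ω : ℤ) - k : ℤ) : ℂ)) ∂P := by
    intro t
    rw [← integral_const_mul]
    refine integral_congr_ae (Filter.Eventually.of_forall fun ω => ?_)
    simp only
    rw [← Complex.exp_add]
    congr 1; push_cast; ring
  have hset : MeasurableSet {ω | (S ω : ℤ) = k} := hS (MeasurableSet.of_discrete (s := {m : ℕ | (m : ℤ) = k}))
  rw [invFourier]
  simp_rw [h1]
  rw [intervalIntegral.integral_of_le hle, hswap]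
  simp_rw [← intervalIntegral.integral_of_le hle, integral_exp_I_mul_int]
  have h2 : ∀ ω, (if (S ω : ℤ) - k = 0 then 2 * (Real.pi : ℂ) else 0) =
      Set.indicator {ω | (S ω : ℤ) = k} (fun _ => 2 * (Real.pi : ℂ)) ω := by
    intro ω
    simp [Set.indicator_apply, sub_eq_zero]
  simp_rw [h2]
  rw [integral_indicator hset, setIntegral_const, Complex.real_smul]
  field_simp

/-! ### The Bergström identity -/

theorem brgSum_zero (n : ℕ) (f a : ℕ → ℂ) : brgSum n 0 f a = ∏ j ∈ Finset.Icc 1 n, a j := by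
  simp [brgSum]

theorem brgSum_zero_left_succ (l : ℕ) (f a : ℕ → ℂ) : brgSum 0 (l + 1) f a = 0 := by
  rw [brgSum, Finset.powersetCard_eq_empty.2 (by simp), Finset.sum_empty]

theorem brgSum_succ_succ (n l : ℕ) (f a : ℕ → ℂ) :
    brgSum (n + 1) (l + 1) f a =
      a (n + 1) * brgSum n (l + 1) f a + (f (n + 1) - a (n + 1)) * brgSum n l f a := by
  have hIcc : Finset.Icc 1 (n + 1) = insert (n + 1) (Finset.Icc 1 n) := by
    ext i; simp only [Finset.mem_Icc, Finset.mem_insert]; omega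
  have hnot : n + 1 ∉ Finset.Icc 1 n := by simp
  simp only [brgSum]
  rw [hIcc, Finset.powersetCard_succ_insert hnot, Finset.sum_union]
  · congr 1
    · rw [Finset.mul_sum]
      refine Finset.sum_congr rfl fun A hA => ?_
      have hA' := (Finset.mem_powersetCard.1 hA).1
      have hnA : n + 1 ∉ A := fun h => hnot (hA' h)
      rw [Finset.insert_sdiff_of_notMem _ hnA, Finset.prod_insert (fun h => hnot (Finset.sdiff_subset h))]
      ring
    · rw [Finset.sum_image, Finset.mul_sum]
      · refine Finset.sum_congr rfl fun A hA => ?_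
        have hA' := (Finset.mem_powersetCard.1 hA).1
        have hnA : n + 1 ∉ A := fun h => hnot (hA' h)
        rw [Finset.prod_insert hnA, Finset.insert_sdiff_insert,
          Finset.sdiff_insert_of_notMem hnot]
        ring
      · intro A hA B hB h
        have hA' : n + 1 ∉ A := fun h => hnot ((Finset.mem_powersetCard.1 hA).1 h)
        have hB' : n + 1 ∉ B := fun h => hnot ((Finset.mem_powersetCard.1 hB).1 h)
        rw [← Finset.erase_insert hA', ← Finset.erase_insert hB', h]
  · rw [Finset.disjoint_left]
    intro A hA hA2
    obtain ⟨B, _, rfl⟩ := Finset.mem_image.1 hA2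
    exact hnot ((Finset.mem_powersetCard.1 hA).1 (Finset.mem_insert_self _ _))

/-- The remainder `∏ f_j - ∑_{l < r} brgSum n l f a` of the Bergström expansion. -/
def brgRem (r n : ℕ) (f a : ℕ → ℂ) : ℂ :=
  ∏ j ∈ Finset.Icc 1 n, f j - ∑ l ∈ Finset.range r, brgSum n l f a

theorem brgRem_zero (n : ℕ) (f a : ℕ → ℂ) : brgRem 0 n f a = ∏ j ∈ Finset.Icc 1 n, f j := by
  simp [brgRem]

theorem brgRem_succ_zero (r : ℕ) (f a : ℕ → ℂ) : brgRem (r + 1) 0 f a = 0 := by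
  rw [brgRem, Finset.sum_range_succ']
  simp [brgSum_zero_left_succ, brgSum_zero]

/-- Split `f_{n+1} = a_{n+1} + (f_{n+1} - a_{n+1})`: the second part uses up one unit of the order
of the expansion. Iterating this makes visible that the remainder of order `r` carries `r` factors
`f_j - a_j`. -/
theorem brgRem_succ_succ (r n : ℕ) (f a : ℕ → ℂ) :
    brgRem (r + 1) (n + 1) f a =
      a (n + 1) * brgRem (r + 1) n f a + (f (n + 1) - a (n + 1)) * brgRem r n f a := by
  simp only [brgRem]
  rw [Finset.sum_range_succ', Finset.sum_range_succ' _ r, brgSum_zero, brgSum_zero,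
    Finset.prod_Icc_succ_top (by omega), Finset.prod_Icc_succ_top (by omega)]
  simp_rw [brgSum_succ_succ]
  rw [Finset.sum_add_distrib, ← Finset.mul_sum, ← Finset.mul_sum]
  ring

theorem brgRem_zero_succ (n : ℕ) (f a : ℕ → ℂ) :
    brgRem 0 (n + 1) f a = brgRem 0 n f a * f (n + 1) := by
  rw [brgRem_zero, brgRem_zero, Finset.prod_Icc_succ_top (by omega)]

theorem pow_mul_add_le {u v : ℝ} (hu : 0 ≤ u) (hv : 0 ≤ v) (r : ℕ) :
    u ^ (r + 1) + v * u ^ r ≤ (u + v) ^ (r + 1) := by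
  calc u ^ (r + 1) + v * u ^ r = u ^ r * (u + v) := by ring
    _ ≤ (u + v) ^ r * (u + v) := by gcongr; linarith
    _ = _ := by ring

/-- Bound for the Bergström remainder. -/
theorem norm_brgRem_le {N : ℕ} {f a : ℕ → ℂ} {e δ : ℕ → ℝ} {K : ℝ} (hK : 0 ≤ K)
    (he : ∀ j ∈ Finset.Icc 1 N, 0 ≤ e j ∧ 1 ≤ K * e j) (hδ : ∀ j ∈ Finset.Icc 1 N, 0 ≤ δ j)
    (hf : ∀ j ∈ Finset.Icc 1 N, ‖f j‖ ≤ e j) (ha : ∀ j ∈ Finset.Icc 1 N, ‖a j‖ ≤ e j)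
    (hd : ∀ j ∈ Finset.Icc 1 N, ‖f j - a j‖ ≤ δ j) (r n : ℕ) (hn : n ≤ N) :
    ‖brgRem r n f a‖ ≤
      (∏ j ∈ Finset.Icc 1 n, e j) * (K * ∑ j ∈ Finset.Icc 1 n, δ j) ^ r := by
  induction n generalizing r with
  | zero =>
    cases r with
    | zero => simp [brgRem_zero]
    | succ r => rw [brgRem_succ_zero]; simp
  | succ n ih =>
    have hmem : n + 1 ∈ Finset.Icc 1 N := Finset.mem_Icc.2 ⟨by omega, hn⟩
    have hsub : ∀ j ∈ Finset.Icc 1 n, j ∈ Finset.Icc 1 N := fun j hj => by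
      simp only [Finset.mem_Icc] at hj ⊢; omega
    have hE : 0 ≤ ∏ j ∈ Finset.Icc 1 n, e j := Finset.prod_nonneg fun j hj => (he j (hsub j hj)).1
    have hρ : 0 ≤ ∑ j ∈ Finset.Icc 1 n, δ j := Finset.sum_nonneg fun j hj => hδ j (hsub j hj)
    obtain ⟨he0, he1⟩ := he _ hmem
    have hδ0 := hδ _ hmem
    have ih := fun r => ih r (by omega)
    rw [Finset.prod_Icc_succ_top (by omega), Finset.sum_Icc_succ_top (by omega)]
    set E := ∏ j ∈ Finset.Icc 1 n, e j
    set ρ := ∑ j ∈ Finset.Icc 1 n, δ j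
    cases r with
    | zero =>
      rw [brgRem_zero_succ, norm_mul]
      have := ih 0
      simp only [pow_zero, mul_one] at this ⊢
      exact mul_le_mul this (hf _ hmem) (norm_nonneg _) hE
    | succ r =>
      rw [brgRem_succ_succ]
      calc _ ≤ ‖a (n + 1)‖ * ‖brgRem (r + 1) n f a‖ +
            ‖f (n + 1) - a (n + 1)‖ * ‖brgRem r n f a‖ := by
            rw [← norm_mul, ← norm_mul]; exact norm_add_le _ _
        _ ≤ e (n + 1) * (E * (K * ρ) ^ (r + 1)) + δ (n + 1) * (E * (K * ρ) ^ r) := by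
            gcongr
            · exact ha _ hmem
            · exact ih _
            · exact hd _ hmem
            · exact ih _
        -- A factor `f_j - a_j` replaces a decaying factor `e_j`; since `1 ≤ K e_j`, that factor is
        -- restored at the price of `K`, so the full product of the `e_j` survives.
        _ ≤ e (n + 1) * (E * (K * ρ) ^ (r + 1)) +
            (K * e (n + 1)) * (δ (n + 1) * (E * (K * ρ) ^ r)) := by
            exact add_le_add le_rfl (le_mul_of_one_le_left (by positivity) he1)
        _ = E * e (n + 1) * ((K * ρ) ^ (r + 1) + (K * δ (n + 1)) * (K * ρ) ^ r) := by ring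
        _ ≤ E * e (n + 1) * (K * (ρ + δ (n + 1))) ^ (r + 1) := by
            rw [mul_add K]
            gcongr
            exact pow_mul_add_le (by positivity) (by positivity) r

/-- The derivative of `brgRem` along `f_j' = iν_j f_j + f¹_j`, `a_j' = iν_j a_j + a¹_j`, after removal of
the rotation `i(ν_1 + ⋯ + ν_n)`. -/
theorem exists_brgRem_deriv {N : ℕ} {f a : ℕ → ℝ → ℂ} {f1 a1 : ℕ → ℂ} {ν : ℕ → ℝ} {t : ℝ}
    {e δ γ : ℕ → ℝ} {K w : ℝ} (hK : 0 ≤ K) (hw : 0 ≤ w)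
    (he : ∀ j ∈ Finset.Icc 1 N, 0 ≤ e j ∧ 1 ≤ K * e j) (hδ : ∀ j ∈ Finset.Icc 1 N, 0 ≤ δ j)
    (hf : ∀ j ∈ Finset.Icc 1 N, ‖f j t‖ ≤ e j) (ha : ∀ j ∈ Finset.Icc 1 N, ‖a j t‖ ≤ e j)
    (hd : ∀ j ∈ Finset.Icc 1 N, ‖f j t - a j t‖ ≤ δ j)
    (hf' : ∀ j ∈ Finset.Icc 1 N, HasDerivAt (f j) (Complex.I * ν j * f j t + f1 j) t)
    (ha' : ∀ j ∈ Finset.Icc 1 N, HasDerivAt (a j) (Complex.I * ν j * a j t + a1 j) t)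
    (hf1 : ∀ j ∈ Finset.Icc 1 N, ‖f1 j‖ ≤ γ j) (ha1 : ∀ j ∈ Finset.Icc 1 N, ‖a1 j‖ ≤ γ j)
    (hd1 : ∀ j ∈ Finset.Icc 1 N, ‖f1 j - a1 j‖ ≤ w * δ j) (r n : ℕ) (hn : n ≤ N) :
    ∃ D : ℂ, HasDerivAt (fun t => brgRem r n (fun j => f j t) (fun j => a j t))
        (Complex.I * (∑ j ∈ Finset.Icc 1 n, ν j : ℝ) *
          brgRem r n (fun j => f j t) (fun j => a j t) + D) t ∧
      ‖D‖ ≤ (∏ j ∈ Finset.Icc 1 n, e j) * (K * ∑ j ∈ Finset.Icc 1 n, δ j) ^ r *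
        (K * ∑ j ∈ Finset.Icc 1 n, γ j + r * w) := by
  induction n generalizing r with
  | zero =>
    refine ⟨0, ?_, by simp; positivity⟩
    cases r with
    | zero => simpa [brgRem_zero] using hasDerivAt_const t (1 : ℂ)
    | succ r => simpa [brgRem_succ_zero] using hasDerivAt_const t (0 : ℂ)
  | succ n ih =>
    have hmem : n + 1 ∈ Finset.Icc 1 N := Finset.mem_Icc.2 ⟨by omega, hn⟩
    have hsub : ∀ j ∈ Finset.Icc 1 n, j ∈ Finset.Icc 1 N := fun j hj => by
      simp only [Finset.mem_Icc] at hj ⊢; omega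
    have hE : 0 ≤ ∏ j ∈ Finset.Icc 1 n, e j := Finset.prod_nonneg fun j hj => (he j (hsub j hj)).1
    have hρ : 0 ≤ ∑ j ∈ Finset.Icc 1 n, δ j := Finset.sum_nonneg fun j hj => hδ j (hsub j hj)
    have hγ : 0 ≤ ∑ j ∈ Finset.Icc 1 n, γ j :=
      Finset.sum_nonneg fun j hj => (norm_nonneg _).trans (hf1 j (hsub j hj))
    have hB := fun r => norm_brgRem_le hK he hδ hf ha hd r n (by omega)
    obtain ⟨he0, he1⟩ := he _ hmem
    have hδ0 := hδ _ hmem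
    have hγ0 : 0 ≤ γ (n + 1) := (norm_nonneg _).trans (hf1 _ hmem)
    have ih := fun r => ih r (by omega)
    rw [Finset.prod_Icc_succ_top (by omega), Finset.sum_Icc_succ_top (by omega),
      Finset.sum_Icc_succ_top (by omega), Finset.sum_Icc_succ_top (by omega)]
    set E := ∏ j ∈ Finset.Icc 1 n, e j
    set ρ := ∑ j ∈ Finset.Icc 1 n, δ j
    set Γ := ∑ j ∈ Finset.Icc 1 n, γ j
    cases r with
    | zero =>
      obtain ⟨D, hD, hDb⟩ := ih 0
      have hB0 := hB 0
      simp only [brgRem_zero_succ]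
      refine ⟨D * f (n + 1) t + brgRem 0 n (fun j => f j t) (fun j => a j t) * f1 (n + 1), ?_, ?_⟩
      · refine (hD.mul (hf' _ hmem)).congr_deriv ?_
        push_cast; ring
      · simp only [pow_zero, mul_one, Nat.cast_zero, zero_mul, add_zero] at hDb hB0 ⊢
        calc _ ≤ ‖D‖ * ‖f (n + 1) t‖ +
              ‖brgRem 0 n (fun j => f j t) (fun j => a j t)‖ * ‖f1 (n + 1)‖ := by
              rw [← norm_mul, ← norm_mul]; exact norm_add_le _ _
          _ ≤ (E * (K * Γ)) * e (n + 1) + E * γ (n + 1) := by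
              gcongr
              · exact hf _ hmem
              · exact hf1 _ hmem
          _ ≤ (E * (K * Γ)) * e (n + 1) + (K * e (n + 1)) * (E * γ (n + 1)) := by
              exact add_le_add le_rfl (le_mul_of_one_le_left (by positivity) he1)
          _ = _ := by ring
    | succ r =>
      obtain ⟨D, hD, hDb⟩ := ih (r + 1)
      obtain ⟨D', hD', hDb'⟩ := ih r
      have hB1 := hB (r + 1)
      have hB0 := hB r
      simp only [brgRem_succ_succ]
      set R1 := brgRem (r + 1) n (fun j => f j t) (fun j => a j t)
      set R := brgRem r n (fun j => f j t) (fun j => a j t)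
      -- Leibniz rule for the recursion. Both `a_{n+1}` and `f_{n+1} - a_{n+1}` rotate at speed
      -- `ν_{n+1}`, which is added to the total rotation, and only the twisted parts remain in `D`.
      refine ⟨(a1 (n + 1) * R1 + a (n + 1) t * D) +
        ((f1 (n + 1) - a1 (n + 1)) * R + (f (n + 1) t - a (n + 1) t) * D'), ?_, ?_⟩
      · refine (((ha' _ hmem).mul hD).add
          (((hf' _ hmem).sub (ha' _ hmem)).mul hD')).congr_deriv ?_
        simp only [Pi.sub_apply]
        push_cast; ring
      · have hpow := pow_mul_add_le (u := K * ρ) (v := K * δ (n + 1)) (by positivity)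
          (by positivity) r
        calc _ ≤ (‖a1 (n + 1)‖ * ‖R1‖ + ‖a (n + 1) t‖ * ‖D‖) +
              (‖f1 (n + 1) - a1 (n + 1)‖ * ‖R‖ + ‖f (n + 1) t - a (n + 1) t‖ * ‖D'‖) := by
              simp only [← norm_mul]
              exact (norm_add_le _ _).trans (add_le_add (norm_add_le _ _) (norm_add_le _ _))
          _ ≤ (γ (n + 1) * (E * (K * ρ) ^ (r + 1)) +
                e (n + 1) * (E * (K * ρ) ^ (r + 1) * (K * Γ + ((r + 1 : ℕ) : ℝ) * w))) +
              (w * δ (n + 1) * (E * (K * ρ) ^ r) +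
                δ (n + 1) * (E * (K * ρ) ^ r * (K * Γ + r * w))) := by
              have h1 := ha1 _ hmem
              have h2 := ha _ hmem
              have h3 := hd1 _ hmem
              have h4 := hd _ hmem
              gcongr
          _ ≤ ((K * e (n + 1)) * (γ (n + 1) * (E * (K * ρ) ^ (r + 1))) +
                e (n + 1) * (E * (K * ρ) ^ (r + 1) * (K * Γ + ((r + 1 : ℕ) : ℝ) * w))) +
              (K * e (n + 1)) * (w * δ (n + 1) * (E * (K * ρ) ^ r) +
                δ (n + 1) * (E * (K * ρ) ^ r * (K * Γ + r * w))) := by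
              exact add_le_add (add_le_add (le_mul_of_one_le_left (by positivity) he1) le_rfl)
                (le_mul_of_one_le_left (by positivity) he1)
          _ ≤ E * e (n + 1) * (((K * ρ) ^ (r + 1) + K * δ (n + 1) * (K * ρ) ^ r) *
                (K * (Γ + γ (n + 1)) + ((r + 1 : ℕ) : ℝ) * w)) := by
              push_cast
              have : 0 ≤ E * e (n + 1) * (K * δ (n + 1) * (K * ρ) ^ r) * (K * γ (n + 1)) := by
                positivity
              nlinarith [this]
          _ ≤ E * e (n + 1) * ((K * (ρ + δ (n + 1))) ^ (r + 1) *
                (K * (Γ + γ (n + 1)) + ((r + 1 : ℕ) : ℝ) * w)) := by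
              rw [mul_add K ρ]
              gcongr
          _ = _ := by ring

end

section

variable {Ω : Type*} [MeasurableSpace Ω] {P : Measure Ω} [IsProbabilityMeasure P]
  {X : ℕ → Ω → ℕ} {n : ℕ}

/-! ### Moments -/

/-- The hypotheses of the main theorem on `X 0 = 0, X 1, …, X n`. -/
structure Regular (P : Measure Ω) (X : ℕ → Ω → ℕ) (n : ℕ) : Prop where
  meas : ∀ k ≤ n, Measurable (X k)
  zero : ∀ ω, X 0 ω = 0
  dep : OneDependent P X n
  int4 : ∀ k ≤ n, Integrable (fac X 4 k) P
  nu1 : ∀ k ≤ n, nu P X 1 k ≤ 1 / 100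
  nu2 : ∀ k ≤ n, nu P X 2 k ≤ nu P X 1 k

theorem Regular.measurable_comp (H : Regular P X n) {k : ℕ} (hk : k ≤ n) {β : Type*}
    [MeasurableSpace β] (u : ℕ → β) : Measurable fun ω => u (X k ω) :=
  (measurable_from_top (f := u)).comp (H.meas k hk)

/-- Turns finiteness of the fourth factorial moment into finiteness of the fourth moment. The
constant `81 = 3⁴` covers `m < 4`; for `m = p + 4` the difference of the two sides has positive
coefficients in `p`. -/
theorem pow_four_le_descFactorial (m : ℕ) : (m : ℝ) ^ 4 ≤ 81 + 16 * (m.descFactorial 4 : ℝ) := by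
  rcases lt_or_ge m 4 with h | h
  · interval_cases m <;> norm_num [Nat.descFactorial]
  · obtain ⟨p, rfl⟩ := Nat.exists_eq_add_of_le' h
    have : (p + 4).descFactorial 4 = (p + 1) * (p + 2) * (p + 3) * (p + 4) := by
      simp [Nat.descFactorial_succ]
      ring
    rw [this]
    push_cast
    have hp : (0 : ℝ) ≤ p := Nat.cast_nonneg p
    have e : 81 + 16 * (((p : ℝ) + 1) * (p + 2) * (p + 3) * (p + 4)) - ((p : ℝ) + 4) ^ 4 =
      15 * (p : ℝ) ^ 4 + 144 * (p : ℝ) ^ 3 + 464 * (p : ℝ) ^ 2 + 544 * p + 209 := by ring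
    have : 0 ≤ 15 * (p : ℝ) ^ 4 + 144 * (p : ℝ) ^ 3 + 464 * (p : ℝ) ^ 2 + 544 * p + 209 := by
      positivity
    linarith

theorem Regular.integrable_pow_four (H : Regular P X n) {k : ℕ} (hk : k ≤ n) :
    Integrable (fun ω => (X k ω : ℝ) ^ 4) P := by
  have h1 : Integrable (fun ω => 81 + 16 * fac X 4 k ω) P :=
    (integrable_const _).add ((H.int4 k hk).const_mul 16)
  refine h1.mono' (H.measurable_comp hk fun m => (m : ℝ) ^ 4).aestronglyMeasurable ?_
  refine Filter.Eventually.of_forall fun ω => ?_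
  rw [Real.norm_of_nonneg (by positivity)]
  exact pow_four_le_descFactorial _

theorem mul_mul_le_pow_four {a b c : ℝ} (ha : 0 ≤ a) (hb : 0 ≤ b) (hc : 0 ≤ c) :
    a * b * c ≤ 1 + (a ^ 4 + b ^ 4 + c ^ 4) := by
  have h4 : ∀ x : ℝ, 0 ≤ x → x ^ 3 ≤ 1 + x ^ 4 := fun x hx => by
    rcases le_total x 1 with h | h
    · have : x ^ 3 ≤ 1 := pow_le_one₀ hx h
      have : 0 ≤ x ^ 4 := by positivity
      linarith
    · have : x ^ 3 ≤ x ^ 4 := pow_le_pow_right₀ h (by norm_num)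
      linarith
  have key : ∀ x : ℝ, 0 ≤ x → a ≤ x → b ≤ x → c ≤ x → a * b * c ≤ 1 + x ^ 4 := by
    intro x hx h1 h2 h3
    refine le_trans ?_ (h4 x hx)
    calc a * b * c ≤ x * x * x := by gcongr
      _ = x ^ 3 := by ring
  have ha4 : 0 ≤ a ^ 4 := by positivity
  have hb4 : 0 ≤ b ^ 4 := by positivity
  have hc4 : 0 ≤ c ^ 4 := by positivity
  rcases le_total a b with h | h
  · rcases le_total b c with h' | h'
    · linarith [key c hc (h.trans h') h' le_rfl]
    · linarith [key b hb h le_rfl h']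
  · rcases le_total a c with h' | h'
    · linarith [key c hc h' (h.trans h') le_rfl]
    · linarith [key a ha le_rfl h h']

/-- Anything bounded by a product of three of `1 + X_i` is integrable. -/
theorem Regular.integrable_of_le (H : Regular P X n) {E : Type*} [NormedAddCommGroup E]
    {i j k : ℕ} (hi : i ≤ n) (hj : j ≤ n) (hk : k ≤ n) {f : Ω → E} (hf : AEStronglyMeasurable f P)
    {C : ℝ} (hC : 0 ≤ C)
    (h : ∀ ω, ‖f ω‖ ≤ C * ((1 + X i ω : ℝ) * (1 + X j ω) * (1 + X k ω))) : Integrable f P := by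
  have h1 : ∀ x : ℝ, 0 ≤ x → (1 + x) ^ 4 ≤ 8 * (1 + x ^ 4) := fun x hx => by
    nlinarith [sq_nonneg (x - 1), sq_nonneg (x ^ 2 - 1), sq_nonneg (x ^ 2 - x), mul_nonneg hx hx,
      mul_nonneg hx (sq_nonneg (x - 1)), mul_nonneg (mul_nonneg hx hx) (sq_nonneg (x - 1))]
  have h2 : Integrable (fun ω => C * (1 + (8 * (1 + (X i ω : ℝ) ^ 4) + 8 * (1 + (X j ω : ℝ) ^ 4) +
      8 * (1 + (X k ω : ℝ) ^ 4)))) P := by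
    have a1 := H.integrable_pow_four hi
    have a2 := H.integrable_pow_four hj
    have a3 := H.integrable_pow_four hk
    exact ((integrable_const _).add (((((integrable_const _).add a1).const_mul 8).add
      (((integrable_const _).add a2).const_mul 8)).add
      (((integrable_const _).add a3).const_mul 8))).const_mul C
  refine h2.mono' hf (Filter.Eventually.of_forall fun ω => (h ω).trans ?_)
  refine mul_le_mul_of_nonneg_left ?_ hC
  refine (mul_mul_le_pow_four (by positivity) (by positivity) (by positivity)).trans ?_
  linarith [h1 (X i ω) (by positivity), h1 (X j ω) (by positivity), h1 (X k ω) (by positivity)]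

/-- `E X_{k-2} X_{k-1} X_k`. -/
def mom3 (P : Measure Ω) (X : ℕ → Ω → ℕ) (k : ℕ) : ℝ :=
  ∫ ω, rv X (k - 2) ω * rv X (k - 1) ω * rv X k ω ∂P

theorem rv_nonneg (k : ℕ) (ω : Ω) : 0 ≤ rv X k ω := Nat.cast_nonneg _

theorem fac_nonneg (j k : ℕ) (ω : Ω) : 0 ≤ fac X j k ω := Nat.cast_nonneg _

theorem nu_nonneg (j k : ℕ) : 0 ≤ nu P X j k := integral_nonneg fun ω => fac_nonneg j k ω

theorem mom2_nonneg (k : ℕ) : 0 ≤ mom2 P X k :=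
  integral_nonneg fun ω => mul_nonneg (rv_nonneg _ ω) (rv_nonneg _ ω)

theorem mom3_nonneg (k : ℕ) : 0 ≤ mom3 P X k :=
  integral_nonneg fun ω => mul_nonneg (mul_nonneg (rv_nonneg _ ω) (rv_nonneg _ ω)) (rv_nonneg _ ω)

theorem fac_one (k : ℕ) : fac X 1 k = rv X k := by
  funext ω; simp [fac, rv]

theorem nu_one (k : ℕ) : nu P X 1 k = ∫ ω, rv X k ω ∂P := by rw [nu, fac_one]

theorem fac_two (k : ℕ) (ω : Ω) : fac X 2 k ω = rv X k ω * (rv X k ω - 1) := by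
  simp only [fac, rv]
  rcases X k ω with _ | m
  · simp
  · simp [Nat.descFactorial_succ]
    ring

theorem fac_three (k : ℕ) (ω : Ω) :
    fac X 3 k ω = rv X k ω * (rv X k ω - 1) * (rv X k ω - 2) := by
  simp only [fac, rv]
  rcases X k ω with _ | _ | m
  · simp
  · simp
  · simp [Nat.descFactorial_succ]; ring

theorem descFactorial_le_one_add_pow (m j : ℕ) : (m.descFactorial j : ℝ) ≤ (1 + m : ℝ) ^ j := by
  calc (m.descFactorial j : ℝ) ≤ (m : ℝ) ^ j := by exact_mod_cast Nat.descFactorial_le_pow m j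
    _ ≤ _ := by gcongr; linarith

theorem Regular.aesm_rv (H : Regular P X n) {k : ℕ} (hk : k ≤ n) : AEStronglyMeasurable (rv X k) P :=
  (H.measurable_comp hk fun m => (m : ℝ)).aestronglyMeasurable

theorem Regular.aesm_fac (H : Regular P X n) (j : ℕ) {k : ℕ} (hk : k ≤ n) :
    AEStronglyMeasurable (fac X j k) P :=
  (H.measurable_comp hk fun m => (m.descFactorial j : ℝ)).aestronglyMeasurable

theorem one_le_one_add_cast (m : ℕ) : (1 : ℝ) ≤ 1 + m := by linarith [Nat.cast_nonneg (α := ℝ) m]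

theorem Regular.integrable_rv (H : Regular P X n) {k : ℕ} (hk : k ≤ n) : Integrable (rv X k) P := by
  refine H.integrable_of_le hk hk hk (H.aesm_rv hk) zero_le_one fun ω => ?_
  rw [Real.norm_of_nonneg (rv_nonneg _ ω), rv]
  have := Nat.cast_nonneg (α := ℝ) (X k ω)
  nlinarith [mul_nonneg this this, mul_nonneg this (mul_nonneg this this)]

theorem Regular.integrable_rv_mul (H : Regular P X n) {i k : ℕ} (hi : i ≤ n) (hk : k ≤ n) :
    Integrable (fun ω => rv X i ω * rv X k ω) P := by
  refine H.integrable_of_le hi hk hk ((H.aesm_rv hi).mul (H.aesm_rv hk)) zero_le_one fun ω => ?_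
  rw [Real.norm_of_nonneg (mul_nonneg (rv_nonneg _ ω) (rv_nonneg _ ω)), rv, rv, one_mul]
  have h1 := one_le_one_add_cast (X k ω)
  have h0 := Nat.cast_nonneg (α := ℝ) (X i ω)
  calc (X i ω : ℝ) * X k ω ≤ (1 + X i ω) * (1 + X k ω) := by gcongr <;> linarith
    _ ≤ _ := le_mul_of_one_le_right (by positivity) h1

theorem Regular.integrable_rv_mul_mul (H : Regular P X n) {i j k : ℕ} (hi : i ≤ n) (hj : j ≤ n)
    (hk : k ≤ n) : Integrable (fun ω => rv X i ω * rv X j ω * rv X k ω) P := by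
  refine H.integrable_of_le hi hj hk (((H.aesm_rv hi).mul (H.aesm_rv hj)).mul (H.aesm_rv hk))
    zero_le_one fun ω => ?_
  rw [Real.norm_of_nonneg (mul_nonneg (mul_nonneg (rv_nonneg _ ω) (rv_nonneg _ ω)) (rv_nonneg _ ω)),
    rv, rv, rv, one_mul]
  gcongr <;> linarith

theorem Regular.integrable_fac (H : Regular P X n) {j k : ℕ} (hj : j ≤ 3) (hk : k ≤ n) :
    Integrable (fac X j k) P := by
  refine H.integrable_of_le hk hk hk (H.aesm_fac j hk) zero_le_one fun ω => ?_
  rw [Real.norm_of_nonneg (fac_nonneg _ _ ω), fac, one_mul]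
  calc _ ≤ (1 + X k ω : ℝ) ^ j := descFactorial_le_one_add_pow _ _
    _ ≤ (1 + X k ω : ℝ) ^ 3 := pow_le_pow_right₀ (one_le_one_add_cast _) hj
    _ = _ := by ring

theorem Regular.integrable_fac_two_mul_rv (H : Regular P X n) {i k : ℕ} (hi : i ≤ n) (hk : k ≤ n) :
    Integrable (fun ω => fac X 2 i ω * rv X k ω) P := by
  refine H.integrable_of_le hi hi hk ((H.aesm_fac 2 hi).mul (H.aesm_rv hk)) zero_le_one fun ω => ?_
  rw [Real.norm_of_nonneg (mul_nonneg (fac_nonneg _ _ ω) (rv_nonneg _ ω)), fac, rv, one_mul]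
  have := descFactorial_le_one_add_pow (X i ω) 2
  calc _ ≤ (1 + X i ω : ℝ) ^ 2 * (1 + X k ω) := by gcongr; linarith
    _ = _ := by ring

theorem Regular.rv_zero (H : Regular P X n) (ω : Ω) : rv X 0 ω = 0 := by simp [rv, H.zero ω]

theorem Regular.nu_zero (H : Regular P X n) {j : ℕ} (hj : 1 ≤ j) : nu P X j 0 = 0 := by
  obtain ⟨j, rfl⟩ := Nat.exists_eq_add_of_le' hj
  simp [nu, fac, H.zero]

theorem Regular.mom2_zero (H : Regular P X n) : mom2 P X 0 = 0 := by simp [mom2, H.rv_zero]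

theorem Regular.mom2_one (H : Regular P X n) : mom2 P X 1 = 0 := by simp [mom2, H.rv_zero]

theorem Regular.mom3_zero (H : Regular P X n) : mom3 P X 0 = 0 := by simp [mom3, H.rv_zero]

/-- From `xy ≤ (x² + y²)/2`, `x² = x(x-1) + x` and `ν_2 ≤ ν_1`. -/
theorem Regular.mom2_le (H : Regular P X n) {k : ℕ} (hk : k ≤ n) :
    mom2 P X k ≤ nu P X 1 (k - 1) + nu P X 1 k := by
  have hk1 : k - 1 ≤ n := by omega
  have i1 := H.integrable_fac (j := 2) (by norm_num) hk
  have i1' := H.integrable_fac (j := 2) (by norm_num) hk1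
  have i2 := H.integrable_rv hk
  have i2' := H.integrable_rv hk1
  have i3 : Integrable (fun ω => (fac X 2 (k - 1) ω + rv X (k - 1) ω) / 2) P :=
    (i1'.add i2').div_const 2
  have i4 : Integrable (fun ω => (fac X 2 k ω + rv X k ω) / 2) P := (i1.add i2).div_const 2
  have h1 : mom2 P X k ≤ ∫ ω, ((fac X 2 (k - 1) ω + rv X (k - 1) ω) / 2 +
      (fac X 2 k ω + rv X k ω) / 2) ∂P := by
    refine integral_mono (H.integrable_rv_mul hk1 hk) (i3.add i4) fun ω => ?_
    simp only [fac_two]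
    nlinarith [sq_nonneg (rv X (k - 1) ω - rv X k ω)]
  rw [integral_add i3 i4, integral_div, integral_div, integral_add i1' i2', integral_add i1 i2, ← nu_one, ← nu_one] at h1
  have a1 := H.nu2 k hk
  have a2 := H.nu2 (k - 1) hk1
  simp only [nu] at a1 a2 h1 ⊢
  linarith

/-- From `y(x-1)² ≥ 0`. Unlike `Regular.mom2_le`, this trades the pair moment for one mean with the
same index and a third order moment that occurs in `R1`. -/
theorem Regular.mom2_le' (H : Regular P X n) {k : ℕ} (hk : k ≤ n) :
    mom2 P X k ≤ nu P X 1 k + ∫ ω, fac X 2 (k - 1) ω * rv X k ω ∂P := by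
  have hk1 : k - 1 ≤ n := by omega
  rw [nu_one, ← integral_add (H.integrable_rv hk) (H.integrable_fac_two_mul_rv hk1 hk)]
  refine integral_mono (H.integrable_rv_mul hk1 hk)
    ((H.integrable_rv hk).add (H.integrable_fac_two_mul_rv hk1 hk)) fun ω => ?_
  simp only [fac_two]
  nlinarith [rv_nonneg (X := X) k ω, mul_nonneg (rv_nonneg (X := X) k ω)
    (sq_nonneg (rv X (k - 1) ω - 1))]

/-! ### Consequences of 1-dependence -/

theorem Regular.integral_prod_split (H : Regular P X n) {𝕜 : Type*} [RCLike 𝕜] (u v : ℕ → ℕ → 𝕜)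
    {I J : Finset ℕ} {s t : ℕ} (hI : ∀ i ∈ I, 1 ≤ i ∧ i ≤ s) (hJ : ∀ j ∈ J, t ≤ j ∧ j ≤ n)
    (hst : s + 1 < t) :
    ∫ ω, (∏ i ∈ I, u i (X i ω)) * (∏ j ∈ J, v j (X j ω)) ∂P =
      (∫ ω, ∏ i ∈ I, u i (X i ω) ∂P) * ∫ ω, ∏ j ∈ J, v j (X j ω) ∂P := by
  rcases I.eq_empty_or_nonempty with rfl | ⟨i0, hi0⟩
  · simp
  rcases J.eq_empty_or_nonempty with rfl | ⟨j0, hj0⟩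
  · simp
  have hs : 1 ≤ s := (hI i0 hi0).1.trans (hI i0 hi0).2
  have ht : t ≤ n := (hJ j0 hj0).1.trans (hJ j0 hj0).2
  have hind := H.dep s t hs hst ht
  have hmeas : ∀ (S : Set ℕ) (K : Finset ℕ) (w : ℕ → ℕ → 𝕜), (∀ i ∈ K, i ∈ S) →
      Measurable[⨆ i ∈ S, MeasurableSpace.comap (X i) ⊤] fun ω => ∏ i ∈ K, w i (X i ω) := by
    intro S K w hK
    refine Finset.measurable_fun_prod K fun i hi => ?_
    have h1 : Measurable[MeasurableSpace.comap (X i) ⊤] (X i) := comap_measurable (X i)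
    have h2 : Measurable[MeasurableSpace.comap (X i) ⊤] fun ω => w i (X i ω) :=
      (measurable_from_top (f := w i)).comp h1
    exact h2.mono (le_iSup₂_of_le i (hK i hi) le_rfl) le_rfl
  have hI' := hmeas (Set.Icc 1 s) I u fun i hi => hI i hi
  have hJ' := hmeas (Set.Icc t n) J v fun i hi => hJ i hi
  have hif : IndepFun (fun ω => ∏ i ∈ I, u i (X i ω)) (fun ω => ∏ j ∈ J, v j (X j ω)) P := by
    rw [IndepFun_iff_Indep]
    exact indep_of_indep_of_le_left (indep_of_indep_of_le_right hind hJ'.comap_le) hI'.comap_le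
  refine hif.integral_fun_mul_eq_mul_integral ?_ ?_
  · exact (Finset.measurable_fun_prod I fun i hi =>
      H.measurable_comp ((hI i hi).2.trans (by omega)) (u i)).aestronglyMeasurable
  · exact (Finset.measurable_fun_prod J fun i hi =>
      H.measurable_comp (hJ i hi).2 (v i)).aestronglyMeasurable

/-- Nonnegative functions of which all but the `i`-th are bounded by `2`. -/
def Adm (i : ℕ) (u : ℕ → ℕ → ℝ) : Prop :=
  ∀ l m, 0 ≤ u l m ∧ u l m ≤ 2 + m ∧ (l ≠ i → u l m ≤ 2)

/-- The mean of the block `u_j(X_j) ⋯ u_k(X_k)`. -/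
def blk (P : Measure Ω) (X : ℕ → Ω → ℕ) (u : ℕ → ℕ → ℝ) (j k : ℕ) : ℝ :=
  ∫ ω, ∏ l ∈ Finset.Icc j k, u l (X l ω) ∂P

theorem Adm.prod_nonneg {i : ℕ} {u : ℕ → ℕ → ℝ} (hu : Adm i u) (I : Finset ℕ) (ω : Ω) :
    0 ≤ ∏ l ∈ I, u l (X l ω) := Finset.prod_nonneg fun l _ => (hu l _).1

theorem blk_nonneg {i : ℕ} {u : ℕ → ℕ → ℝ} (hu : Adm i u) (j k : ℕ) : 0 ≤ blk P X u j k :=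
  integral_nonneg fun ω => hu.prod_nonneg _ ω

theorem blk_empty (u : ℕ → ℕ → ℝ) {j k : ℕ} (h : k < j) : blk P X u j k = 1 := by
  simp [blk, Finset.Icc_eq_empty_of_lt h]

theorem Regular.integrable_prod (H : Regular P X n) {i : ℕ} {u : ℕ → ℕ → ℝ} (hu : Adm i u)
    {I : Finset ℕ} (hI : ∀ l ∈ I, l ≤ n) : Integrable (fun ω => ∏ l ∈ I, u l (X l ω)) P := by
  have hm : AEStronglyMeasurable (fun ω => ∏ l ∈ I, u l (X l ω)) P :=
    (Finset.measurable_fun_prod I fun l hl => H.measurable_comp (hI l hl) (u l)).aestronglyMeasurable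
  by_cases hi : i ∈ I
  · have h1 : Integrable (fun ω => (2 + rv X i ω) * 2 ^ (I.erase i).card) P :=
      ((integrable_const _).add (H.integrable_rv (hI i hi))).mul_const _
    refine h1.mono' hm (Filter.Eventually.of_forall fun ω => ?_)
    rw [Real.norm_of_nonneg (hu.prod_nonneg I ω), ← Finset.mul_prod_erase I _ hi]
    have h2 : ∏ l ∈ I.erase i, u l (X l ω) ≤ 2 ^ (I.erase i).card :=
      (Finset.prod_le_prod (fun l _ => (hu l _).1) fun l hl =>
        (hu l _).2.2 (Finset.ne_of_mem_erase hl)).trans_eq (Finset.prod_const 2)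
    have h3 := (hu i (X i ω)).2.1
    have h4 := hu.prod_nonneg (X := X) (I.erase i) ω
    have h5 := rv_nonneg (X := X) i ω
    simp only [rv] at h5 ⊢
    gcongr
  · refine (integrable_const ((2 : ℝ) ^ I.card)).mono' hm (Filter.Eventually.of_forall fun ω => ?_)
    rw [Real.norm_of_nonneg (hu.prod_nonneg I ω)]
    exact (Finset.prod_le_prod (fun l _ => (hu l _).1) fun l hl =>
      (hu l _).2.2 fun h => hi (h ▸ hl)).trans_eq (Finset.prod_const 2)

/-- The `l`-th factor is at most 2; once it is gone the two remaining pieces are separated by a gap,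
hence independent. All decay of long blocks comes from this. -/
theorem Regular.blk_drop (H : Regular P X n) {i : ℕ} {u : ℕ → ℕ → ℝ} (hu : Adm i u) {j l k : ℕ}
    (hj : 1 ≤ j) (hjl : j ≤ l) (hlk : l ≤ k) (hk : k ≤ n) (hli : l ≠ i) :
    blk P X u j k ≤ 2 * blk P X u j (l - 1) * blk P X u (l + 1) k := by
  have hset : Finset.Icc j k = insert l (Finset.Icc j (l - 1) ∪ Finset.Icc (l + 1) k) := by
    ext a; simp only [Finset.mem_insert, Finset.mem_union, Finset.mem_Icc]; omega
  have hnot : l ∉ Finset.Icc j (l - 1) ∪ Finset.Icc (l + 1) k := by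
    simp only [Finset.mem_union, Finset.mem_Icc]; omega
  have hdisj : Disjoint (Finset.Icc j (l - 1)) (Finset.Icc (l + 1) k) := by
    rw [Finset.disjoint_left]; intro a; simp only [Finset.mem_Icc]; omega
  have hsplit := H.integral_prod_split (I := Finset.Icc j (l - 1)) (J := Finset.Icc (l + 1) k)
    (s := l - 1) (t := l + 1) u u
    (fun a ha => by simp only [Finset.mem_Icc] at ha; omega)
    (fun a ha => by simp only [Finset.mem_Icc] at ha; omega) (by omega)
  rw [mul_assoc]
  unfold blk
  rw [← hsplit, ← integral_const_mul]
  refine integral_mono (H.integrable_prod hu fun a ha => by simp only [Finset.mem_Icc] at ha; omega)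
    (Integrable.const_mul ?_ 2) fun ω => ?_
  · simp_rw [← Finset.prod_union hdisj]
    refine H.integrable_prod hu fun a ha => ?_
    simp only [Finset.mem_union, Finset.mem_Icc] at ha; omega
  · simp only
    rw [hset, Finset.prod_insert hnot, Finset.prod_union hdisj]
    exact mul_le_mul_of_nonneg_right ((hu l _).2.2 hli)
      (mul_nonneg (hu.prod_nonneg _ ω) (hu.prod_nonneg _ ω))

/-! ### The characteristic functions of the partial sums -/

/-- `M_{j,k}(t) = E Z_j ⋯ Z_k`. -/
def MZ (P : Measure Ω) (X : ℕ → Ω → ℕ) (j k : ℕ) (t : ℝ) : ℂ :=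
  ∫ ω, ∏ l ∈ Finset.Icc j k, Z X t l ω ∂P

/-- The characteristic function of `X_1 + ⋯ + X_k`. -/
def cF (P : Measure Ω) (X : ℕ → Ω → ℕ) (k : ℕ) (t : ℝ) : ℂ :=
  ∫ ω, ∏ l ∈ Finset.Icc 1 k, (1 + Z X t l ω) ∂P

theorem cF_zero (t : ℝ) : cF P X 0 t = 1 := by simp [cF]

theorem cF_eq (k : ℕ) (t : ℝ) : cF P X k t =
    ∫ ω, Complex.exp (Complex.I * t * ((∑ i ∈ Finset.Icc 1 k, X i ω : ℕ) : ℂ)) ∂P := by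
  unfold cF
  refine integral_congr_ae (Filter.Eventually.of_forall fun ω => ?_)
  simp only [Z, add_sub_cancel]
  rw [← Complex.exp_sum]
  push_cast
  rw [Finset.mul_sum]

theorem norm_Z_le_two (t : ℝ) (l : ℕ) (ω : Ω) : ‖Z X t l ω‖ ≤ 2 := by
  have h : ‖Complex.exp (Complex.I * t * (X l ω : ℂ))‖ = 1 := by rw [Complex.norm_exp]; simp
  calc ‖Z X t l ω‖ ≤ ‖Complex.exp (Complex.I * t * (X l ω : ℂ))‖ + ‖(1 : ℂ)‖ := norm_sub_le _ _
    _ = 2 := by rw [h]; norm_num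

theorem Regular.measurable_Z (H : Regular P X n) (t : ℝ) {l : ℕ} (hl : l ≤ n) :
    Measurable (Z X t l) :=
  H.measurable_comp hl fun m : ℕ => Complex.exp (Complex.I * t * (m : ℂ)) - 1

theorem Regular.integrable_prod_Z (H : Regular P X n) (t : ℝ) {I J : Finset ℕ}
    (hI : ∀ i ∈ I, i ≤ n) (hJ : ∀ j ∈ J, j ≤ n) :
    Integrable (fun ω => (∏ l ∈ I, (1 + Z X t l ω)) * ∏ l ∈ J, Z X t l ω) P := by
  refine Integrable.of_bound ((Finset.measurable_fun_prod I fun l hl =>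
    measurable_const.add (H.measurable_Z t (hI l hl))).mul (Finset.measurable_fun_prod J fun l hl =>
      H.measurable_Z t (hJ l hl))).aestronglyMeasurable (3 ^ I.card * 2 ^ J.card)
      (Filter.Eventually.of_forall fun ω => ?_)
  rw [norm_mul, norm_prod, norm_prod]
  refine mul_le_mul ?_ ?_ (Finset.prod_nonneg fun _ _ => norm_nonneg _) (by positivity)
  · refine (Finset.prod_le_prod (fun _ _ => norm_nonneg _) fun l _ => ?_).trans_eq
      (Finset.prod_const (3 : ℝ))
    calc ‖1 + Z X t l ω‖ ≤ ‖(1 : ℂ)‖ + ‖Z X t l ω‖ := norm_add_le _ _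
      _ ≤ 3 := by rw [norm_one]; linarith [norm_Z_le_two (X := X) t l ω]
  · exact (Finset.prod_le_prod (fun _ _ => norm_nonneg _) fun l _ =>
      norm_Z_le_two t l ω).trans_eq (Finset.prod_const (2 : ℝ))

/-- Expand the last prefix factor `1 + Z`: the `1` opens a gap between prefix and block, so the
expectation splits as `F_{i-2} M_{i,k}`, while `Z` lengthens the block. For `i = 1` the truncated `i
- 2 = 0` gives `F_0 = 1`, as it should. -/
theorem Regular.integral_prefix_mul_block (H : Regular P X n) (t : ℝ) {j k : ℕ} (hk : k ≤ n)
    (hjk : j + 1 ≤ k) :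
    ∫ ω, (∏ l ∈ Finset.Icc 1 j, (1 + Z X t l ω)) * ∏ l ∈ Finset.Icc (j + 1) k, Z X t l ω ∂P =
      ∑ i ∈ Finset.Icc 1 (j + 1), cF P X (i - 2) t * MZ P X i k t := by
  induction j with
  | zero => simp [MZ, cF]
  | succ j ih =>
    rw [Finset.sum_Icc_succ_top (by omega), ← ih (by omega)]
    have hsplit := H.integral_prod_split (I := Finset.Icc 1 j) (J := Finset.Icc (j + 1 + 1) k)
      (s := j) (t := j + 2)
      (fun _ m => 1 + (Complex.exp (Complex.I * t * (m : ℂ)) - 1))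
      (fun _ m => Complex.exp (Complex.I * t * (m : ℂ)) - 1)
      (fun a ha => by simp only [Finset.mem_Icc] at ha; omega)
      (fun a ha => by simp only [Finset.mem_Icc] at ha; omega) (by omega)
    have e : j + 1 + 1 - 2 = j := by omega
    rw [e]
    unfold cF MZ
    simp only [Z] at hsplit ⊢
    rw [← hsplit, ← integral_add]
    · refine integral_congr_ae (Filter.Eventually.of_forall fun ω => ?_)
      simp only
      have hIcc : Finset.Icc (j + 1) k = insert (j + 1) (Finset.Icc (j + 1 + 1) k) := by
        ext a; simp only [Finset.mem_insert, Finset.mem_Icc]; omega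
      rw [Finset.prod_Icc_succ_top (by omega), hIcc, Finset.prod_insert (by simp)]
      ring
    · exact H.integrable_prod_Z t (fun a ha => by simp only [Finset.mem_Icc] at ha; omega)
        (fun a ha => by simp only [Finset.mem_Icc] at ha; omega)
    · exact H.integrable_prod_Z t (fun a ha => by simp only [Finset.mem_Icc] at ha; omega)
        (fun a ha => by simp only [Finset.mem_Icc] at ha; omega)

theorem Regular.cF_succ (H : Regular P X n) (t : ℝ) {k : ℕ} (hk : k + 1 ≤ n) :
    cF P X (k + 1) t =
      cF P X k t + ∑ j ∈ Finset.Icc 1 (k + 1), cF P X (j - 2) t * MZ P X j (k + 1) t := by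
  rw [← H.integral_prefix_mul_block t hk le_rfl]
  unfold cF
  rw [← integral_add]
  · refine integral_congr_ae (Filter.Eventually.of_forall fun ω => ?_)
    simp only
    rw [Finset.prod_Icc_succ_top (by omega), Finset.Icc_self, Finset.prod_singleton]
    ring
  · simpa using H.integrable_prod_Z t (I := Finset.Icc 1 k) (J := ∅)
      (fun a ha => by simp only [Finset.mem_Icc] at ha; omega) (by simp)
  · exact H.integrable_prod_Z t (fun a ha => by simp only [Finset.mem_Icc] at ha; omega)
      (fun a ha => by simp only [Finset.mem_Icc] at ha; omega)

/-! ### Heinrich's factorization -/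

theorem wE_Ico (t : ℝ) (j k : ℕ) :
    wE P ((List.Ico j (k + 1)).map (Z X t)) =
      MZ P X j k t - ∑ i ∈ Finset.Ico j k,
        wE P ((List.Ico j (i + 1)).map (Z X t)) * MZ P X (i + 1) k t := by
  have hM : ∀ a : ℕ, ∫ ω, ((List.Ico a (k + 1)).map (Z X t)).prod ω ∂P = MZ P X a k t := by
    intro a
    unfold MZ
    refine integral_congr_ae (Filter.Eventually.of_forall fun ω => ?_)
    simp only
    have : Finset.Icc a k = (List.Ico a (k + 1)).toFinset := by
      ext x; simp
    rw [this, List.prod_toFinset _ (List.Ico.nodup a (k + 1)), Pi.list_prod_apply, List.map_map]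
    rfl
  have hlen : ((List.Ico j (k + 1)).map (Z X t)).length - 1 = k - j := by
    simp only [List.length_map, List.Ico.length]; omega
  rw [wE, hM, Fin.sum_univ_eq_sum_range (fun i =>
    wE P (((List.Ico j (k + 1)).map (Z X t)).take (i + 1)) *
      ∫ ω, (((List.Ico j (k + 1)).map (Z X t)).drop (i + 1)).prod ω ∂P), hlen,
    Finset.sum_Ico_eq_sum_range]
  congr 1
  refine Finset.sum_congr rfl fun i hi => ?_
  rw [Finset.mem_range] at hi
  have h1 : (List.Ico j (k + 1)).take (i + 1) = List.Ico j (j + i + 1) := by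
    rw [← List.Ico.append_consecutive (l := k + 1) (m := j + i + 1) (by omega) (by omega),
      List.take_append_of_le_length (by simp; omega), List.take_of_length_le (by simp; omega)]
  have h2 : (List.Ico j (k + 1)).drop (i + 1) = List.Ico (j + i + 1) (k + 1) := by
    rw [← List.Ico.append_consecutive (l := k + 1) (m := j + i + 1) (by omega) (by omega),
      List.drop_append_of_le_length (by simp; omega), List.drop_of_length_le (by simp; omega),
      List.nil_append]
  rw [← List.map_take, ← List.map_drop, h1, h2, hM]

/-- The recursion `Regular.cF_succ` rewritten with Heinrich's `Ê` in place of plain moments and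
`F_{j-1}` in place of `F_{j-2}`: the terms subtracted in `Ê` telescope. -/
theorem Regular.cF_sub (H : Regular P X n) (t : ℝ) {k : ℕ} (hk : k + 1 ≤ n) :
    cF P X (k + 1) t - cF P X k t =
      ∑ j ∈ Finset.Icc 1 (k + 1),
        wE P ((List.Ico j (k + 1 + 1)).map (Z X t)) * cF P X (j - 1) t := by
  induction k using Nat.strong_induction_on with
  | _ k ih =>
    simp_rw [wE_Ico t _ (k + 1), sub_mul, Finset.sum_sub_distrib, Finset.sum_mul]
    -- After interchanging the sums, the inner sum over `j` is the induction hypothesis for the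
    -- increment `F_i - F_{i-1}`.
    have hswap : ∑ j ∈ Finset.Icc 1 (k + 1), ∑ i ∈ Finset.Ico j (k + 1),
        wE P ((List.Ico j (i + 1)).map (Z X t)) * MZ P X (i + 1) (k + 1) t * cF P X (j - 1) t =
        ∑ i ∈ Finset.Icc 1 k, MZ P X (i + 1) (k + 1) t *
          (cF P X i t - cF P X (i - 1) t) := by
      rw [Finset.sum_sigma', Finset.sum_congr rfl (g := fun i => ∑ j ∈ Finset.Icc 1 i,
        wE P ((List.Ico j (i + 1)).map (Z X t)) * MZ P X (i + 1) (k + 1) t * cF P X (j - 1) t)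
        (s₁ := Finset.Icc 1 k), Finset.sum_sigma']
      · refine Finset.sum_bij' (fun p _ => ⟨p.2, p.1⟩) (fun p _ => ⟨p.2, p.1⟩) ?_ ?_ ?_ ?_ ?_ <;>
          simp only [Finset.mem_sigma, Finset.mem_Icc, Finset.mem_Ico] <;>
          first | (intros; omega) | (intros; trivial)
      · intro i hi
        simp only [Finset.mem_Icc] at hi
        obtain ⟨p, rfl⟩ := Nat.exists_eq_add_of_le' hi.1
        rw [Nat.add_sub_cancel, ih p (by omega) (by omega), Finset.mul_sum]
        refine Finset.sum_congr rfl fun j _ => ?_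
        ring
    rw [hswap, H.cF_succ t hk, add_sub_cancel_left]
    have hA : ∀ g : ℕ → ℂ, ∑ j ∈ Finset.Icc 1 (k + 1), g j =
        g 1 + ∑ i ∈ Finset.Icc 1 k, g (i + 1) := by
      intro g
      rw [← Finset.sum_Ioc_add_eq_sum_Icc (by omega : 1 ≤ k + 1), add_comm]
      congr 1
      refine (Finset.sum_bij' (fun i _ => i + 1) (fun i _ => i - 1) ?_ ?_ ?_ ?_ ?_).symm <;>
        simp only [Finset.mem_Icc, Finset.mem_Ioc] <;>
        first | (intros; omega) | (intros; trivial)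
    rw [hA, hA, add_sub_assoc, ← Finset.sum_sub_distrib]
    congr 1
    · ring
    · refine Finset.sum_congr rfl fun i _ => ?_
      rw [Nat.add_sub_cancel, show i + 1 - 2 = i - 1 by omega]
      ring

/-- Divide `Regular.cF_sub` by `F_k`: the ratio `F_{j-1}/F_k` is the reciprocal of the telescoping
product `φ_j ⋯ φ_k`, which turns the identity into the defining recursion of `φ_{k+1}`. -/
theorem Regular.phi_eq_div (H : Regular P X n) (t : ℝ) (h0 : ∀ k ≤ n, cF P X k t ≠ 0) {k : ℕ}
    (hk : k + 1 ≤ n) : phi P X t (k + 1) = cF P X (k + 1) t / cF P X k t := by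
  induction k using Nat.strong_induction_on with
  | _ k ih =>
    have hprod : ∀ j ∈ Finset.Icc 1 (k + 1), ∏ i ∈ Finset.Ico j (k + 1), phi P X t i =
        cF P X k t / cF P X (j - 1) t := by
      intro j hj
      simp only [Finset.mem_Icc] at hj
      have h1 : ∏ i ∈ Finset.Ico j (k + 1), phi P X t i =
          ∏ i ∈ Finset.Ico (j - 1) k, cF P X (i + 1) t / cF P X i t := by
        refine (Finset.prod_bij' (fun i _ => i + 1) (fun i _ => i - 1) ?_ ?_ ?_ ?_ ?_).symm <;>
          simp only [Finset.mem_Ico]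
        · intros; omega
        · intros; omega
        · intros; omega
        · intros; omega
        · intro i hi
          exact (ih i (by omega) (by omega)).symm
      rw [h1, eq_div_iff (h0 _ (by omega))]
      have : ∀ m, j - 1 ≤ m → m ≤ n →
          (∏ i ∈ Finset.Ico (j - 1) m, cF P X (i + 1) t / cF P X i t) * cF P X (j - 1) t =
            cF P X m t := by
        intro m hm
        induction m, hm using Nat.le_induction with
        | base => simp
        | succ m hm ihm =>
          intro hmn
          rw [Finset.prod_Ico_succ_top hm, mul_right_comm, ihm (by omega)]
          rw [mul_div_cancel₀ _ (h0 m (by omega))]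
      exact this k (by omega) (by omega)
    have h2 := H.cF_sub t hk
    rw [phi_eq, eq_div_iff (h0 k (by omega)), add_mul, Finset.sum_mul]
    have h3 : ∑ j ∈ Finset.Ico 1 (k + 1), wE P ((List.Ico j (k + 1 + 1)).map (Z X t)) /
        (∏ i ∈ Finset.Ico j (k + 1), phi P X t i) * cF P X k t =
        ∑ j ∈ Finset.Icc 1 k, wE P ((List.Ico j (k + 1 + 1)).map (Z X t)) * cF P X (j - 1) t := by
      refine Finset.sum_congr (by ext; simp) fun j hj => ?_
      simp only [Finset.mem_Icc] at hj
      rw [hprod j (by simp only [Finset.mem_Icc]; omega)]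
      have a1 := h0 k (by omega)
      have a2 := h0 (j - 1) (by omega)
      field_simp
    have h4 : wE P ((List.Ico (k + 1) (k + 1 + 1)).map (Z X t)) = ∫ ω, Z X t (k + 1) ω ∂P := by
      rw [wE_Ico]; simp [MZ]
    rw [Finset.sum_Icc_succ_top (by omega), h4, Nat.add_sub_cancel] at h2
    rw [h3]
    linear_combination -h2

end

section

variable {Ω : Type*} [MeasurableSpace Ω] {P : Measure Ω} [IsProbabilityMeasure P]
  {X : ℕ → Ω → ℕ} {n : ℕ}

/-! ### The norm of first order jets -/

/-- `|e^{it} - 1|`. -/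
def yt (t : ℝ) : ℝ := ‖Complex.exp (Complex.I * t) - 1‖

/-- A submultiplicative norm of the first order jet of `f` at `t`. -/
def jn (f : ℝ → ℂ) (t : ℝ) : ℝ := ‖f t‖ + yt t / 1000 * ‖deriv f t‖

theorem yt_nonneg (t : ℝ) : 0 ≤ yt t := norm_nonneg _

theorem norm_exp_I_mul (t : ℝ) : ‖Complex.exp (Complex.I * t)‖ = 1 := by
  rw [Complex.norm_exp]; simp

theorem yt_le_two (t : ℝ) : yt t ≤ 2 := by
  calc yt t ≤ ‖Complex.exp (Complex.I * t)‖ + ‖(1 : ℂ)‖ := norm_sub_le _ _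
    _ = 2 := by rw [norm_exp_I_mul]; norm_num

theorem yt_eq (t : ℝ) : yt t = 2 * |Real.sin (t / 2)| := by
  rw [yt, Complex.norm_exp_I_mul_ofReal_sub_one, norm_mul, Real.norm_eq_abs, Real.norm_eq_abs]
  norm_num

theorem yt_le_abs (t : ℝ) : yt t ≤ |t| := by
  rw [yt_eq]
  have := Real.abs_sin_le_abs (x := t / 2)
  rw [abs_div, abs_two] at this
  linarith

theorem le_yt {t : ℝ} (ht : t ∈ Set.Icc (-Real.pi) Real.pi) : 2 / Real.pi * |t| ≤ yt t := by
  have h : |t / 2| ≤ Real.pi / 2 := by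
    rw [abs_div, abs_two]
    linarith [abs_le.2 ht]
  have := Real.mul_abs_le_abs_sin h
  rw [abs_div, abs_two] at this
  rw [yt_eq]
  linarith

theorem jn_nonneg (f : ℝ → ℂ) (t : ℝ) : 0 ≤ jn f t := by
  have := yt_nonneg t
  unfold jn; positivity

theorem norm_le_jn (f : ℝ → ℂ) (t : ℝ) : ‖f t‖ ≤ jn f t := by
  have := yt_nonneg t
  have : 0 ≤ yt t / 1000 * ‖deriv f t‖ := by positivity
  unfold jn; linarith

theorem jn_of_hasDerivAt {f : ℝ → ℂ} {f' : ℂ} {t : ℝ} (h : HasDerivAt f f' t) :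
    jn f t = ‖f t‖ + yt t / 1000 * ‖f'‖ := by rw [jn, h.deriv]

theorem jn_const (c : ℂ) (t : ℝ) : jn (fun _ => c) t = ‖c‖ := by simp [jn]

theorem jn_add_le {f g : ℝ → ℂ} {t : ℝ} (hf : DifferentiableAt ℝ f t)
    (hg : DifferentiableAt ℝ g t) : jn (fun t => f t + g t) t ≤ jn f t + jn g t := by
  have hy := yt_nonneg t
  rw [jn_of_hasDerivAt (f := fun t => f t + g t) (hf.hasDerivAt.add hg.hasDerivAt), jn, jn]
  have h1 := norm_add_le (f t) (g t)
  have h2 := mul_le_mul_of_nonneg_left (norm_add_le (deriv f t) (deriv g t))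
    (by positivity : 0 ≤ yt t / 1000)
  linarith

theorem jn_sub_le {f g : ℝ → ℂ} {t : ℝ} (hf : DifferentiableAt ℝ f t)
    (hg : DifferentiableAt ℝ g t) : jn (fun t => f t - g t) t ≤ jn f t + jn g t := by
  have hy := yt_nonneg t
  rw [jn_of_hasDerivAt (f := fun t => f t - g t) (hf.hasDerivAt.sub hg.hasDerivAt), jn, jn]
  have h1 := norm_sub_le (f t) (g t)
  have h2 := mul_le_mul_of_nonneg_left (norm_sub_le (deriv f t) (deriv g t))
    (by positivity : 0 ≤ yt t / 1000)
  linarith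

/-- The product of the two norms contains the Leibniz terms and an additional nonnegative product of
derivatives. -/
theorem jn_mul_le {f g : ℝ → ℂ} {t : ℝ} (hf : DifferentiableAt ℝ f t)
    (hg : DifferentiableAt ℝ g t) : jn (fun t => f t * g t) t ≤ jn f t * jn g t := by
  have hy := yt_nonneg t
  rw [jn_of_hasDerivAt (f := fun t => f t * g t) (hf.hasDerivAt.mul hg.hasDerivAt), jn, jn]
  have h2 := mul_le_mul_of_nonneg_left (norm_add_le (deriv f t * g t) (f t * deriv g t))
    (by positivity : 0 ≤ yt t / 1000)
  simp only [norm_mul] at h2 ⊢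
  have h3 : 0 ≤ yt t / 1000 * ‖deriv f t‖ * (yt t / 1000 * ‖deriv g t‖) := by positivity
  nlinarith [h2, h3]

theorem jn_sum_le {ι : Type*} (S : Finset ι) {f : ι → ℝ → ℂ} {t : ℝ}
    (hf : ∀ i ∈ S, DifferentiableAt ℝ (f i) t) :
    jn (fun t => ∑ i ∈ S, f i t) t ≤ ∑ i ∈ S, jn (f i) t := by
  have hy := yt_nonneg t
  have hd : HasDerivAt (fun t => ∑ i ∈ S, f i t) (∑ i ∈ S, deriv (f i) t) t :=
    HasDerivAt.fun_sum fun i hi => (hf i hi).hasDerivAt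
  rw [jn_of_hasDerivAt hd]
  simp only [jn]
  rw [Finset.sum_add_distrib, ← Finset.mul_sum]
  gcongr
  · exact norm_sum_le _ _
  · exact norm_sum_le _ _

/-- Apply the norm to `1/f = 1 - (1/f)(f - 1)` and solve for the norm of `1/f`. -/
theorem jn_inv_le {f : ℝ → ℂ} (hf : Differentiable ℝ f) (h0 : ∀ t, f t ≠ 0) {t η : ℝ}
    (hη : η < 1) (h : jn (fun t => f t - 1) t ≤ η) : jn (fun t => (f t)⁻¹) t ≤ (1 - η)⁻¹ := by
  have hi : DifferentiableAt ℝ (fun t => (f t)⁻¹) t := (hf t).inv (h0 t)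
  have h1 : DifferentiableAt ℝ (fun t => f t - 1) t := (hf t).sub_const 1
  have e : (fun t => (f t)⁻¹) = fun t => 1 - (f t)⁻¹ * (f t - 1) := by
    funext t
    have := h0 t
    field_simp
    ring
  have h2 : jn (fun t => (f t)⁻¹) t ≤ 1 + jn (fun t => (f t)⁻¹) t * η := by
    calc jn (fun t => (f t)⁻¹) t = jn (fun t => 1 - (f t)⁻¹ * (f t - 1)) t := by rw [← e]
      _ ≤ jn (fun _ => 1) t + jn (fun t => (f t)⁻¹ * (f t - 1)) t :=
          jn_sub_le (differentiableAt_const _) (hi.mul h1)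
      _ ≤ 1 + jn (fun t => (f t)⁻¹) t * jn (fun t => f t - 1) t := by
          rw [jn_const, norm_one]
          gcongr
          exact jn_mul_le hi h1
      _ ≤ _ := by
          have := jn_nonneg (fun t => (f t)⁻¹) t
          gcongr
  rw [← one_div, le_div_iff₀ (by linarith)]
  linarith

/-- Differentiation under the expectation. -/
theorem differentiable_integral {h h' : Ω → ℝ → ℂ} {B : Ω → ℝ}
    (hi : ∀ t, Integrable (fun ω => h ω t) P)
    (hm' : ∀ t, AEStronglyMeasurable (fun ω => h' ω t) P)
    (hd : ∀ ω t, HasDerivAt (h ω) (h' ω t) t) (hB : ∀ ω t, ‖h' ω t‖ ≤ B ω)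
    (hBi : Integrable B P) :
    Differentiable ℝ (fun t => ∫ ω, h ω t ∂P) ∧
      ∀ (t : ℝ) (g : Ω → ℝ), Integrable g P →
        (∀ ω, ‖h ω t‖ + yt t / 1000 * ‖h' ω t‖ ≤ g ω) →
        jn (fun t => ∫ ω, h ω t ∂P) t ≤ ∫ ω, g ω ∂P := by
  have key : ∀ t, Integrable (fun ω => h' ω t) P ∧
      HasDerivAt (fun t => ∫ ω, h ω t ∂P) (∫ ω, h' ω t ∂P) t := by
    intro t
    exact hasDerivAt_integral_of_dominated_loc_of_deriv_le (F := fun t ω => h ω t)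
      (F' := fun t ω => h' ω t) (s := Set.univ) Filter.univ_mem
      (Filter.Eventually.of_forall fun s => (hi s).aestronglyMeasurable) (hi t) (hm' t)
      (Filter.Eventually.of_forall fun ω s _ => hB ω s) hBi
      (Filter.Eventually.of_forall fun ω s _ => hd ω s)
  refine ⟨fun t => (key t).2.differentiableAt, fun t g hg hle => ?_⟩
  have hy := yt_nonneg t
  rw [jn_of_hasDerivAt (key t).2]
  calc _ ≤ (∫ ω, ‖h ω t‖ ∂P) + yt t / 1000 * ∫ ω, ‖h' ω t‖ ∂P := by
        gcongr
        · exact norm_integral_le_integral_norm _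
        · exact norm_integral_le_integral_norm _
    _ = ∫ ω, (‖h ω t‖ + yt t / 1000 * ‖h' ω t‖) ∂P := by
        rw [integral_add (hi t).norm ((key t).1.norm.const_mul _), integral_const_mul]
    _ ≤ _ := integral_mono ((hi t).norm.add ((key t).1.norm.const_mul _)) hg hle

/-! ### Powers of points of the unit circle -/

theorem norm_pow_sub_one_le {w : ℂ} (hw : ‖w‖ = 1) (m : ℕ) : ‖w ^ m - 1‖ ≤ m * ‖w - 1‖ := by
  induction m with
  | zero => simp
  | succ m ih =>
    have e : w ^ (m + 1) - 1 = (w ^ m - 1) + w ^ m * (w - 1) := by ring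
    rw [e]
    refine (norm_add_le _ _).trans ?_
    rw [norm_mul, norm_pow, hw, one_pow]
    push_cast
    linarith

/-- Passing from `m` to `m + 1` adds `w - 1` times the remainder of one order less, so the constants
are binomial coefficients and integrate to factorial moments. -/
theorem norm_pow_sub_linear_le {w : ℂ} (hw : ‖w‖ = 1) (m : ℕ) :
    ‖w ^ m - 1 - m * (w - 1)‖ ≤ (m * (m - 1) / 2 : ℝ) * ‖w - 1‖ ^ 2 := by
  induction m with
  | zero => simp
  | succ m ih =>
    have e : w ^ (m + 1) - 1 - ((m + 1 : ℕ) : ℂ) * (w - 1) =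
        (w ^ m - 1 - m * (w - 1)) + (w - 1) * (w ^ m - 1) := by push_cast; ring
    rw [e]
    refine (norm_add_le _ _).trans ?_
    rw [norm_mul]
    have := mul_le_mul_of_nonneg_left (norm_pow_sub_one_le hw m) (norm_nonneg (w - 1))
    push_cast
    linarith

theorem norm_pow_sub_quadratic_le {w : ℂ} (hw : ‖w‖ = 1) (m : ℕ) :
    ‖w ^ m - 1 - m * (w - 1) - m * (m - 1) / 2 * (w - 1) ^ 2‖ ≤
      (m * (m - 1) * (m - 2) / 6 : ℝ) * ‖w - 1‖ ^ 3 := by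
  induction m with
  | zero => simp
  | succ m ih =>
    have e : w ^ (m + 1) - 1 - ((m + 1 : ℕ) : ℂ) * (w - 1) -
        ((m + 1 : ℕ) : ℂ) * (((m + 1 : ℕ) : ℂ) - 1) / 2 * (w - 1) ^ 2 =
        (w ^ m - 1 - m * (w - 1) - m * (m - 1) / 2 * (w - 1) ^ 2) +
          (w - 1) * (w ^ m - 1 - m * (w - 1)) := by push_cast; ring
    rw [e]
    refine (norm_add_le _ _).trans ?_
    rw [norm_mul]
    have := mul_le_mul_of_nonneg_left (norm_pow_sub_linear_le hw m) (norm_nonneg (w - 1))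
    push_cast
    linarith

theorem exp_I_mul_nat (t : ℝ) (m : ℕ) :
    Complex.exp (Complex.I * t * (m : ℂ)) = Complex.exp (Complex.I * t) ^ m := by
  rw [← Complex.exp_nat_mul]; congr 1; ring

theorem norm_exp_sub_one_le (t : ℝ) (m : ℕ) :
    ‖Complex.exp (Complex.I * t * (m : ℂ)) - 1‖ ≤ yt t * m := by
  rw [exp_I_mul_nat, mul_comm (yt t)]
  exact norm_pow_sub_one_le (norm_exp_I_mul t) m

theorem hasDerivAt_Z (l : ℕ) (ω : Ω) (t : ℝ) :
    HasDerivAt (fun t => Z X t l ω)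
      (Complex.I * (X l ω : ℂ) * Complex.exp (Complex.I * t * (X l ω : ℂ))) t := by
  have h0 : HasDerivAt (fun t : ℝ => (t : ℂ)) 1 t := Complex.ofRealCLM.hasDerivAt
  have := (((h0.const_mul Complex.I).mul_const (X l ω : ℂ)).cexp).sub_const 1
  exact this.congr_deriv (by ring)

theorem norm_deriv_Z (l : ℕ) (ω : Ω) (t : ℝ) :
    ‖Complex.I * (X l ω : ℂ) * Complex.exp (Complex.I * t * (X l ω : ℂ))‖ = X l ω := by
  rw [norm_mul, norm_mul, Complex.norm_I, exp_I_mul_nat, norm_pow, norm_exp_I_mul]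
  simp

/-! ### Bounds for the blocks -/

/-- `|Z_l|` for `l ≠ i`, and the scaled derivative of `Z_i` for `l = i`. -/
def mixb (t : ℝ) (i l m : ℕ) : ℝ :=
  if l = i then yt t / 1000 * m else ‖Complex.exp (Complex.I * t * (m : ℂ)) - 1‖

theorem mixb_nonneg (t : ℝ) (i l m : ℕ) : 0 ≤ mixb t i l m := by
  have := yt_nonneg t
  unfold mixb; split_ifs <;> positivity

theorem mixb_le (t : ℝ) (i l m : ℕ) : mixb t i l m ≤ yt t * m := by
  have := yt_nonneg t
  unfold mixb; split_ifs
  · have : 0 ≤ yt t * m := by positivity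
    linarith
  · exact norm_exp_sub_one_le t m

theorem mixb_ne_le_two (t : ℝ) {i l : ℕ} (h : l ≠ i) (m : ℕ) : mixb t i l m ≤ 2 := by
  rw [mixb, if_neg h]
  calc _ ≤ ‖Complex.exp (Complex.I * t * (m : ℂ))‖ + ‖(1 : ℂ)‖ := norm_sub_le _ _
    _ = 2 := by rw [exp_I_mul_nat, norm_pow, norm_exp_I_mul]; norm_num

theorem adm_mixb (t : ℝ) (i : ℕ) : Adm i (mixb t i) := by
  intro l m
  refine ⟨mixb_nonneg t i l m, ?_, fun h => mixb_ne_le_two t h m⟩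
  have hm : (0 : ℝ) ≤ m := Nat.cast_nonneg m
  by_cases h : l = i
  · rw [mixb, if_pos h]
    have := yt_le_two t
    nlinarith [yt_nonneg t]
  · linarith [mixb_ne_le_two t h m]

/-- The Leibniz rule under the expectation gives one block per differentiated factor `i`. As `j ≥
1`, the marked index `0` lies outside the block, so `mixb t 0` encodes the undifferentiated product.
-/
theorem Regular.MZ_jet (H : Regular P X n) {j k : ℕ} (hj : 1 ≤ j) (hk : k ≤ n) :
    Differentiable ℝ (MZ P X j k) ∧ ∀ t, jn (MZ P X j k) t ≤
      blk P X (mixb t 0) j k + ∑ i ∈ Finset.Icc j k, blk P X (mixb t i) j k := by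
  have hle : ∀ l ∈ Finset.Icc j k, l ≤ n := fun l hl => by
    simp only [Finset.mem_Icc] at hl; omega
  set h' : Ω → ℝ → ℂ := fun ω t => ∑ i ∈ Finset.Icc j k,
    (∏ l ∈ (Finset.Icc j k).erase i, Z X t l ω) •
      (Complex.I * (X i ω : ℂ) * Complex.exp (Complex.I * t * (X i ω : ℂ))) with hh'
  have hbase := differentiable_integral (P := P) (h := fun ω t => ∏ l ∈ Finset.Icc j k, Z X t l ω)
    (h' := h') (B := fun ω => ∑ i ∈ Finset.Icc j k, 2 ^ (Finset.Icc j k).card * rv X i ω)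
    ?_ ?_ ?_ ?_ ?_
  · refine ⟨hbase.1, fun t => ?_⟩
    have hy := yt_nonneg t
    have hint : ∀ i, Integrable (fun ω => ∏ l ∈ Finset.Icc j k, mixb t i l (X l ω)) P :=
      fun i => H.integrable_prod (adm_mixb t i) hle
    refine (hbase.2 t (fun ω => (∏ l ∈ Finset.Icc j k, mixb t 0 l (X l ω)) +
      ∑ i ∈ Finset.Icc j k, ∏ l ∈ Finset.Icc j k, mixb t i l (X l ω))
      ((hint 0).add (integrable_finsetSum _ fun i _ => hint i)) fun ω => ?_).trans_eq ?_
    · refine add_le_add (le_of_eq ?_) ?_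
      · rw [norm_prod]
        refine Finset.prod_congr rfl fun l hl => ?_
        simp only [Finset.mem_Icc] at hl
        rw [mixb, if_neg (by omega)]; rfl
      · rw [hh']
        calc _ ≤ yt t / 1000 * ∑ i ∈ Finset.Icc j k,
              (∏ l ∈ (Finset.Icc j k).erase i, ‖Z X t l ω‖) * X i ω := by
              gcongr
              refine (norm_sum_le _ _).trans_eq (Finset.sum_congr rfl fun i _ => ?_)
              rw [norm_smul, norm_prod, norm_deriv_Z]
          _ = _ := by
              rw [Finset.mul_sum]
              refine Finset.sum_congr rfl fun i hi => ?_
              rw [← Finset.mul_prod_erase _ _ hi, mixb, if_pos rfl]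
              have : ∏ l ∈ (Finset.Icc j k).erase i, mixb t i l (X l ω) =
                  ∏ l ∈ (Finset.Icc j k).erase i, ‖Z X t l ω‖ := by
                refine Finset.prod_congr rfl fun l hl => ?_
                rw [mixb, if_neg (Finset.ne_of_mem_erase hl)]; rfl
              rw [this]; ring
    · rw [integral_add (hint 0) (integrable_finsetSum _ fun i _ => hint i),
        integral_finsetSum _ fun i _ => hint i]
      rfl
  · intro t
    simpa using H.integrable_prod_Z t (I := ∅) (by simp) hle
  · intro t
    refine (Finset.measurable_fun_sum _ fun i hi => ?_).aestronglyMeasurable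
    exact (Finset.measurable_fun_prod _ fun l hl =>
      H.measurable_Z t (hle l (Finset.mem_of_mem_erase hl))).smul
      (H.measurable_comp (hle i hi)
        fun m : ℕ => Complex.I * (m : ℂ) * Complex.exp (Complex.I * t * (m : ℂ)))
  · intro ω t
    exact HasDerivAt.fun_finsetProd fun l _ => hasDerivAt_Z l ω t
  · intro ω t
    refine (norm_sum_le _ _).trans (Finset.sum_le_sum fun i hi => ?_)
    rw [norm_smul, norm_prod, norm_deriv_Z, rv]
    gcongr
    calc _ ≤ ∏ l ∈ (Finset.Icc j k).erase i, (2 : ℝ) :=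
          Finset.prod_le_prod (fun _ _ => norm_nonneg _) fun l _ => norm_Z_le_two t l ω
      _ = 2 ^ ((Finset.Icc j k).erase i).card := Finset.prod_const _
      _ ≤ _ := pow_le_pow_right₀ (by norm_num) (Finset.card_le_card (Finset.erase_subset _ _))
  · exact integrable_finsetSum _ fun i hi => (H.integrable_rv (hle i hi)).const_mul _

theorem Regular.blk_single_le (H : Regular P X n) (t : ℝ) (i : ℕ) {l : ℕ} (hl : l ≤ n) :
    blk P X (mixb t i) l l ≤ yt t * nu P X 1 l := by
  rw [nu_one, ← integral_const_mul]
  unfold blk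
  refine integral_mono (H.integrable_prod (adm_mixb t i) (by simpa using hl))
    ((H.integrable_rv hl).const_mul _) fun ω => ?_
  simp only [Finset.Icc_self, Finset.prod_singleton]
  exact mixb_le t i l (X l ω)

theorem blk_single_self (t : ℝ) (i : ℕ) :
    blk P X (mixb t i) i i = yt t / 1000 * nu P X 1 i := by
  rw [nu_one, ← integral_const_mul]
  unfold blk
  refine integral_congr_ae (Filter.Eventually.of_forall fun ω => ?_)
  simp [mixb, rv]

theorem Regular.blk_pair_le (H : Regular P X n) (t : ℝ) (i : ℕ) {k : ℕ} (hk0 : 1 ≤ k) (hk : k ≤ n) :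
    blk P X (mixb t i) (k - 1) k ≤ yt t ^ 2 * mom2 P X k := by
  rw [mom2, ← integral_const_mul]
  unfold blk
  refine integral_mono (H.integrable_prod (adm_mixb t i) fun l hl => by
    simp only [Finset.mem_Icc] at hl; omega)
    ((H.integrable_rv_mul (by omega) hk).const_mul _) fun ω => ?_
  obtain ⟨k, rfl⟩ := Nat.exists_eq_add_of_le' hk0
  simp only [Nat.add_sub_cancel, rv]
  rw [Finset.prod_Icc_succ_top (by omega), Finset.Icc_self, Finset.prod_singleton]
  have hy := yt_nonneg t
  calc _ ≤ (yt t * X k ω) * (yt t * X (k + 1) ω) :=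
        mul_le_mul (mixb_le _ _ _ _) (mixb_le _ _ _ _) (mixb_nonneg _ _ _ _) (by positivity)
    _ = _ := by ring

theorem Regular.blk_triple_le (H : Regular P X n) (t : ℝ) (i : ℕ) {k : ℕ} (hk0 : 2 ≤ k)
    (hk : k ≤ n) : blk P X (mixb t i) (k - 2) k ≤ yt t ^ 3 * mom3 P X k := by
  rw [mom3, ← integral_const_mul]
  unfold blk
  refine integral_mono (H.integrable_prod (adm_mixb t i) fun l hl => by
    simp only [Finset.mem_Icc] at hl; omega)
    ((H.integrable_rv_mul_mul (by omega) (by omega) hk).const_mul _) fun ω => ?_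
  obtain ⟨k, rfl⟩ := Nat.exists_eq_add_of_le' hk0
  simp only [Nat.add_sub_cancel, rv, show k + 2 - 1 = k + 1 by omega]
  rw [Finset.prod_Icc_succ_top (by omega), Finset.prod_Icc_succ_top (by omega), Finset.Icc_self,
    Finset.prod_singleton]
  have hy := yt_nonneg t
  calc _ ≤ (yt t * X k ω) * (yt t * X (k + 1) ω) * (yt t * X (k + 2) ω) :=
        mul_le_mul (mul_le_mul (mixb_le _ _ _ _) (mixb_le _ _ _ _) (mixb_nonneg _ _ _ _)
          (by positivity)) (mixb_le _ _ _ _) (mixb_nonneg _ _ _ _) (by positivity)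
    _ = _ := by ring

/-- The block `|∂Z_{k-2}| |Z_{k-1}| |Z_k|` with its derivative factor in front. -/
def headBlk (P : Measure Ω) (X : ℕ → Ω → ℕ) (t : ℝ) (k : ℕ) : ℝ :=
  if 3 ≤ k then blk P X (mixb t (k - 2)) (k - 2) k else 0

theorem headBlk_nonneg (t : ℝ) (k : ℕ) : 0 ≤ headBlk P X t k := by
  unfold headBlk; split_ifs
  · exact blk_nonneg (adm_mixb t _) _ _
  · exact le_rfl

theorem Regular.headBlk_le_mom3 (H : Regular P X n) (t : ℝ) {k : ℕ} (hk : k ≤ n) :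
    headBlk P X t k ≤ yt t ^ 3 * mom3 P X k := by
  have := yt_nonneg t
  have := mom3_nonneg (P := P) (X := X) k
  unfold headBlk; split_ifs
  · exact H.blk_triple_le t _ (by omega) hk
  · positivity

theorem Regular.blk_le_two_mul_init (H : Regular P X n) (t : ℝ) {i j k : ℕ} (hj : 1 ≤ j)
    (hjk : j ≤ k) (hk : k ≤ n) (hi : k ≠ i) :
    blk P X (mixb t i) j k ≤ 2 * blk P X (mixb t i) j (k - 1) := by
  have := H.blk_drop (adm_mixb t i) hj hjk le_rfl hk hi
  rwa [blk_empty _ (by omega : k < k + 1), mul_one] at this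

/-- The front factor is differentiated and must stay, so the last factor is dropped instead; this is
why the moment has index `k - 1`. -/
theorem Regular.headBlk_le_mom2 (H : Regular P X n) (t : ℝ) {k : ℕ} (hk : k ≤ n) :
    headBlk P X t k ≤ 2 * (yt t ^ 2 * mom2 P X (k - 1)) := by
  have := yt_nonneg t
  have := mom2_nonneg (P := P) (X := X) (k - 1)
  unfold headBlk; split_ifs
  · have h1 := H.blk_le_two_mul_init t (i := k - 2) (j := k - 2) (by omega) (by omega) hk (by omega)
    have h2 := H.blk_pair_le t (k - 2) (k := k - 1) (by omega) (by omega)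
    rw [show k - 1 - 1 = k - 2 by omega] at h2
    linarith
  · positivity

theorem Regular.blk_single_le' (H : Regular P X n) (t : ℝ) (i : ℕ) {l : ℕ} (hl : l ≤ n) :
    blk P X (mixb t i) l l ≤ 1 / 50 := by
  refine (H.blk_single_le t i hl).trans ?_
  nlinarith [H.nu1 l hl, yt_le_two t, yt_nonneg t, nu_nonneg (P := P) (X := X) 1 l]

/-- Drop every second factor: each pair of factors contributes `2 · E|Z| ≤ 2 · 1/50 = (1/5)²`. -/
theorem Regular.blk_le_pow_of_notMem (H : Regular P X n) (t : ℝ) (i : ℕ) {j k : ℕ} (hj : 1 ≤ j)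
    (hk : k ≤ n) (hi : i < j ∨ k < i) : blk P X (mixb t i) j k ≤ (1 / 5) ^ (k + 1 - j) := by
  obtain ⟨d, hd⟩ : ∃ d, d = k + 1 - j := ⟨_, rfl⟩
  induction d using Nat.strong_induction_on generalizing j with
  | _ d ih =>
    rcases lt_or_ge k j with h | h
    · rw [blk_empty _ h, show k + 1 - j = 0 by omega, pow_zero]
    rcases h.eq_or_lt with h | h
    · subst h
      have := H.blk_single_le' t i hk
      rw [show j + 1 - j = 1 by omega]
      linarith
    · have h1 := H.blk_drop (adm_mixb t i) hj (l := j + 1) (by omega) (by omega) hk (by omega)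
      have h2 := ih (k + 1 - (j + 1 + 1)) (by omega) (j := j + 1 + 1) (by omega) (by omega) rfl
      have h3 := H.blk_single_le' t i (l := j) (by omega)
      have h4 := blk_nonneg (P := P) (X := X) (adm_mixb t i) (j + 1 + 1) k
      have h5 := blk_nonneg (P := P) (X := X) (adm_mixb t i) j j
      rw [Nat.add_sub_cancel] at h1
      rw [show k + 1 - j = (k + 1 - (j + 1 + 1)) + 2 by omega, pow_add]
      calc _ ≤ 2 * (1 / 50) * (1 / 5) ^ (k + 1 - (j + 1 + 1)) := h1.trans (by gcongr)
        _ = _ := by ring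

/-- Drop the neighbour `i - 1` of the marked factor. The bound 2 and the lost length give the
constant `10 = 2 · 5`. -/
theorem Regular.blk_left_le (H : Regular P X n) (t : ℝ) {i j k : ℕ} (hj : 1 ≤ j) (hji : j ≤ i)
    (hik : i ≤ k) (hk : k ≤ n) :
    blk P X (mixb t i) j k ≤ 10 * (1 / 5) ^ (i - j) * blk P X (mixb t i) i k := by
  have h4 := blk_nonneg (P := P) (X := X) (adm_mixb t i) i k
  rcases hji.eq_or_lt with h | h
  · subst h
    rw [Nat.sub_self, pow_zero]; linarith
  · have h1 := H.blk_drop (adm_mixb t i) hj (l := i - 1) (by omega) (by omega) hk (by omega)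
    rw [show i - 1 + 1 = i by omega] at h1
    have h2 := H.blk_le_pow_of_notMem t i (j := j) (k := i - 1 - 1) hj (by omega) (by omega)
    rw [show i - 1 - 1 + 1 - j = i - j - 1 by omega] at h2
    refine h1.trans (mul_le_mul_of_nonneg_right ?_ h4)
    calc _ ≤ 2 * (1 / 5 : ℝ) ^ (i - j - 1) := by gcongr
      _ = 10 * (1 / 5) ^ (i - j - 1 + 1) := by ring
      _ = _ := by rw [show i - j - 1 + 1 = i - j by omega]

theorem Regular.blk_right_le (H : Regular P X n) (t : ℝ) {i k : ℕ} (hi : 1 ≤ i)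
    (hik : i ≤ k) (hk : k ≤ n) :
    blk P X (mixb t i) i k ≤ 10 * (1 / 5) ^ (k - i) * blk P X (mixb t i) i i := by
  have h4 := blk_nonneg (P := P) (X := X) (adm_mixb t i) i i
  rcases hik.eq_or_lt with h | h
  · subst h
    rw [Nat.sub_self, pow_zero]; linarith
  · have h1 := H.blk_drop (adm_mixb t i) hi (l := i + 1) (by omega) (by omega) hk (by omega)
    rw [Nat.add_sub_cancel] at h1
    have h2 := H.blk_le_pow_of_notMem t i (j := i + 1 + 1) (k := k) (by omega) (by omega) (by omega)
    rw [show k + 1 - (i + 1 + 1) = k - i - 1 by omega] at h2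
    calc _ ≤ 2 * blk P X (mixb t i) i i * (1 / 5 : ℝ) ^ (k - i - 1) := h1.trans (by gcongr)
      _ = 10 * (1 / 5) ^ (k - i - 1 + 1) * blk P X (mixb t i) i i := by ring
      _ = _ := by rw [show k - i - 1 + 1 = k - i by omega]

/-- Isolating the marked factor on both sides costs `10 · 10`, but its own mean is at most `2/1000 ·
1/100`; a spare factor `1/100` is left for summing over all positions of the derivative. -/
theorem Regular.blk_le_pow_of_mem (H : Regular P X n) (t : ℝ) {i j k : ℕ} (hj : 1 ≤ j)
    (hji : j ≤ i) (hik : i ≤ k) (hk : k ≤ n) :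
    blk P X (mixb t i) j k ≤ 1 / 100 * (1 / 5) ^ (k + 1 - j) := by
  have h1 := H.blk_left_le t hj hji hik hk
  have h2 := H.blk_right_le t (by omega : 1 ≤ i) hik hk
  have h3 : blk P X (mixb t i) i i ≤ 1 / 50000 := by
    rw [blk_single_self]
    nlinarith [H.nu1 i (by omega), yt_le_two t, yt_nonneg t, nu_nonneg (P := P) (X := X) 1 i]
  calc _ ≤ 10 * (1 / 5) ^ (i - j) * (10 * (1 / 5) ^ (k - i) * (1 / 50000)) :=
        h1.trans (by gcongr; exact h2.trans (by gcongr))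
    _ = 1 / 100 * (1 / 5) ^ ((i - j) + (k - i) + 1) := by ring
    _ = _ := by congr 2; omega

theorem Regular.blk_le_pow (H : Regular P X n) (t : ℝ) (i : ℕ) {j k : ℕ} (hj : 1 ≤ j)
    (hk : k ≤ n) : blk P X (mixb t i) j k ≤ (1 / 5) ^ (k + 1 - j) := by
  by_cases h : i < j ∨ k < i
  · exact H.blk_le_pow_of_notMem t i hj hk h
  · refine (H.blk_le_pow_of_mem t hj (by omega) (by omega) hk).trans ?_
    have : (0 : ℝ) ≤ (1 / 5) ^ (k + 1 - j) := by positivity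
    linarith

/-- For length `L` the derivative terms add up to `L/100` of the main bound, and `1 + L/100 ≤
(101/100)^L` by Bernoulli; `101/500 = 1/5 · 101/100`. -/
theorem Regular.jn_MZ_le_pow (H : Regular P X n) (t : ℝ) {j k : ℕ} (hj : 1 ≤ j)
    (hk : k ≤ n) : jn (MZ P X j k) t ≤ (101 / 500) ^ (k + 1 - j) := by
  refine ((H.MZ_jet hj hk).2 t).trans ?_
  have h1 := H.blk_le_pow t 0 hj hk
  have h2 : ∑ i ∈ Finset.Icc j k, blk P X (mixb t i) j k ≤
      (k + 1 - j : ℕ) * (1 / 100 * (1 / 5 : ℝ) ^ (k + 1 - j)) := by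
    have := Finset.sum_le_card_nsmul (Finset.Icc j k) (fun i => blk P X (mixb t i) j k)
      (1 / 100 * (1 / 5 : ℝ) ^ (k + 1 - j)) fun i hi => by
        simp only [Finset.mem_Icc] at hi
        exact H.blk_le_pow_of_mem t hj hi.1 hi.2 hk
    rwa [Nat.card_Icc, nsmul_eq_mul] at this
  have h3 := one_add_mul_le_pow (by norm_num : (-2 : ℝ) ≤ 1 / 100) (k + 1 - j)
  calc _ ≤ (1 / 5 : ℝ) ^ (k + 1 - j) * (1 + (k + 1 - j : ℕ) * (1 / 100)) := by linarith
    _ ≤ (1 / 5 : ℝ) ^ (k + 1 - j) * (1 + 1 / 100) ^ (k + 1 - j) := by gcongr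
    _ = _ := by rw [← mul_pow]; norm_num

theorem Regular.jn_MZ_self_le (H : Regular P X n) (t : ℝ) {k : ℕ} (hk0 : 1 ≤ k) (hk : k ≤ n) :
    jn (MZ P X k k) t ≤ 1001 / 1000 * (yt t * nu P X 1 k) := by
  refine ((H.MZ_jet hk0 hk).2 t).trans ?_
  have h1 := H.blk_single_le t 0 hk
  rw [Finset.Icc_self, Finset.sum_singleton, blk_single_self]
  linarith

theorem Regular.jn_MZ_pair_le (H : Regular P X n) (t : ℝ) {k : ℕ} (hk0 : 2 ≤ k) (hk : k ≤ n) :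
    jn (MZ P X (k - 1) k) t ≤ 3 * (yt t ^ 2 * mom2 P X k) := by
  refine ((H.MZ_jet (by omega) hk).2 t).trans ?_
  have h := fun i => H.blk_pair_le t i (by omega) hk
  have := Finset.sum_le_card_nsmul (Finset.Icc (k - 1) k) (fun i => blk P X (mixb t i) (k - 1) k)
    (yt t ^ 2 * mom2 P X k) fun i _ => h i
  rw [Nat.card_Icc, nsmul_eq_mul, show k + 1 - (k - 1) = 2 by omega] at this
  push_cast at this
  linarith [h 0]

theorem Regular.jn_MZ_triple_le (H : Regular P X n) (t : ℝ) {k : ℕ} (hk0 : 3 ≤ k) (hk : k ≤ n) :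
    jn (MZ P X (k - 2) k) t ≤ 4 * (yt t ^ 3 * mom3 P X k) := by
  refine ((H.MZ_jet (by omega) hk).2 t).trans ?_
  have h := fun i => H.blk_triple_le t i (by omega) hk
  have := Finset.sum_le_card_nsmul (Finset.Icc (k - 2) k) (fun i => blk P X (mixb t i) (k - 2) k)
    (yt t ^ 3 * mom3 P X k) fun i _ => h i
  rw [Nat.card_Icc, nsmul_eq_mul, show k + 1 - (k - 2) = 3 by omega] at this
  push_cast at this
  linarith [h 0]

/-- Blocks that end with a core `l + 1, …, k` of small mean. -/
theorem Regular.jn_MZ_le_core (H : Regular P X n) (t : ℝ) {j l k : ℕ} (hj : 1 ≤ j)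
    (hjl : j ≤ l) (hlk : l < k) (hk : k ≤ n) {B : ℝ}
    (hB : ∀ i ≠ l, blk P X (mixb t i) (l + 1) k ≤ B) (hB' : blk P X (mixb t l) l k ≤ B) :
    jn (MZ P X j k) t ≤ (k + 2 - j : ℕ) * (10 * (1 / 5) ^ (l - j) * B) := by
  have hB0 : 0 ≤ B := (blk_nonneg (adm_mixb t l) _ _).trans hB'
  have h : ∀ i, blk P X (mixb t i) j k ≤ 10 * (1 / 5) ^ (l - j) * B := by
    intro i
    -- If `l` is not differentiated it is dropped, which isolates the core; if it is, it joins the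
    -- core and `hB'` applies. Together with the undifferentiated product there are `k + 2 - j` such
    -- blocks.
    by_cases hi : i = l
    · subst hi
      exact (H.blk_left_le t hj hjl hlk.le hk).trans (by gcongr)
    · have h1 := H.blk_drop (adm_mixb t i) hj hjl hlk.le hk (Ne.symm hi)
      have h2 := H.blk_le_pow t i (j := j) (k := l - 1) hj (by omega)
      rw [show l - 1 + 1 - j = l - j by omega] at h2
      have h3 := blk_nonneg (P := P) (X := X) (adm_mixb t i) (l + 1) k
      have h4 := hB i hi
      calc _ ≤ 2 * (1 / 5) ^ (l - j) * B := h1.trans (by gcongr)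
        _ ≤ _ := by gcongr; norm_num
  refine ((H.MZ_jet hj hk).2 t).trans ?_
  have := Finset.sum_le_card_nsmul (Finset.Icc j k) (fun i => blk P X (mixb t i) j k)
    _ fun i _ => h i
  rw [Nat.card_Icc, nsmul_eq_mul] at this
  have h0 := h 0
  rw [show k + 2 - j = (k + 1 - j) + 1 by omega]
  push_cast
  linarith

end

section

variable {Ω : Type*} [MeasurableSpace Ω] {P : Measure Ω} [IsProbabilityMeasure P]
  {X : ℕ → Ω → ℕ} {n : ℕ}

/-! ### The factors of the characteristic function -/

theorem sum_Icc_geom_le {q : ℝ} (hq0 : 0 ≤ q) (hq1 : q < 1) (l : ℕ) :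
    ∑ j ∈ Finset.Icc 1 l, q ^ (l - j) ≤ (1 - q)⁻¹ := by
  have h : ∑ j ∈ Finset.Icc 1 l, q ^ (l - j) = ∑ i ∈ Finset.range l, q ^ i := by
    refine Finset.sum_bij' (fun j _ => l - j) (fun i _ => l - i) ?_ ?_ ?_ ?_ ?_ <;>
      simp only [Finset.mem_Icc, Finset.mem_range] <;>
      first | (intros; omega) | (intros; trivial)
  rw [h, ← tsum_geometric_of_lt_one hq0 hq1]
  exact (summable_geometric_of_lt_one hq0 hq1).sum_le_tsum _ fun _ _ => by positivity

/-- `φ_k`, as a quotient of characteristic functions. -/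
def ratio (P : Measure Ω) (X : ℕ → Ω → ℕ) (k : ℕ) (t : ℝ) : ℂ := cF P X k t / cF P X (k - 1) t

/-- `φ_{a+1}⁻¹ ⋯ φ_b⁻¹`, as a quotient of characteristic functions. -/
def quot (P : Measure Ω) (X : ℕ → Ω → ℕ) (a b : ℕ) (t : ℝ) : ℂ := cF P X a t / cF P X b t

/-- The four assertions need one another: the bound on the quotients for smaller indices gives that
on `φ_k - 1`, which gives nonvanishing and, through `10/9 = (1 - 1/10)⁻¹`, the next quotient bound.
The powers of `10/9` are harmless because blocks decay like `(101/500)^L`. -/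
theorem Regular.cF_jet (H : Regular P X n) (k : ℕ) (hk : k ≤ n) :
    Differentiable ℝ (cF P X k) ∧ (∀ t, cF P X k t ≠ 0) ∧
      (∀ t, jn (fun t => ratio P X k t - 1) t ≤ 1 / 10) ∧
      ∀ a ≤ k, ∀ t, jn (quot P X a k) t ≤ (10 / 9) ^ (k - a) := by
  induction k using Nat.strong_induction_on with
  | _ k ih =>
    rcases k with _ | k
    · have h0 : cF P X 0 = fun _ => 1 := funext fun t => cF_zero t
      have h1 : (fun t => ratio P X 0 t - 1) = fun _ => 0 := by
        funext t; simp [ratio, cF_zero]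
      refine ⟨h0 ▸ differentiable_const _, fun t => by simp [cF_zero], fun t => ?_, fun a ha t => ?_⟩
      · rw [h1, jn_const]; norm_num
      · obtain rfl : a = 0 := by omega
        have h2 : quot P X 0 0 = fun _ => 1 := by funext t; simp [quot, cF_zero]
        rw [h2, jn_const]; simp
    · obtain ⟨hdk, h0k, -, hqk⟩ := ih k (by omega) (by omega)
      have hM : ∀ j ∈ Finset.Icc 1 (k + 1), Differentiable ℝ (MZ P X j (k + 1)) := fun j hj =>
        (H.MZ_jet (Finset.mem_Icc.1 hj).1 hk).1
      have hF : ∀ j ∈ Finset.Icc 1 (k + 1), Differentiable ℝ (cF P X (j - 2)) := fun j hj => by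
        simp only [Finset.mem_Icc] at hj
        exact (ih (j - 2) (by omega) (by omega)).1
      have hfun : cF P X (k + 1) = fun t => cF P X k t +
          ∑ j ∈ Finset.Icc 1 (k + 1), cF P X (j - 2) t * MZ P X j (k + 1) t :=
        funext fun t => H.cF_succ t hk
      have hd : Differentiable ℝ (cF P X (k + 1)) := by
        rw [hfun]
        exact hdk.add (Differentiable.fun_sum fun j hj => (hF j hj).mul (hM j hj))
      have hr : (fun t => ratio P X (k + 1) t - 1) = fun t =>
          ∑ j ∈ Finset.Icc 1 (k + 1), quot P X (j - 2) k t * MZ P X j (k + 1) t := by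
        funext t
        have := h0k t
        simp only [ratio, quot, Nat.add_sub_cancel]
        rw [H.cF_succ t hk, add_div, div_self this, add_sub_cancel_left, Finset.sum_div]
        exact Finset.sum_congr rfl fun j _ => by ring
      have hQ : ∀ j ∈ Finset.Icc 1 (k + 1), Differentiable ℝ (quot P X (j - 2) k) := fun j hj =>
        (hF j hj).div hdk h0k
      have hrle : ∀ t, jn (fun t => ratio P X (k + 1) t - 1) t ≤ 1 / 10 := by
        intro t
        rw [hr]
        have hterm : ∀ j ∈ Finset.Icc 1 (k + 1),
            jn (fun t => quot P X (j - 2) k t * MZ P X j (k + 1) t) t ≤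
              (10 / 9) ^ (k + 2 - j) * jn (MZ P X j (k + 1)) t := by
          intro j hj
          refine (jn_mul_le (hQ j hj t) (hM j hj t)).trans ?_
          refine mul_le_mul_of_nonneg_right ?_ (jn_nonneg _ _)
          simp only [Finset.mem_Icc] at hj
          refine (hqk (j - 2) (by omega) t).trans ?_
          exact pow_le_pow_right₀ (by norm_num) (by omega)
        refine (jn_sum_le _ fun j hj => (hQ j hj t).mul (hM j hj t)).trans ?_
        refine (Finset.sum_le_sum hterm).trans ?_
        rw [Finset.sum_Icc_succ_top (by omega)]
        have hlast : (10 / 9 : ℝ) ^ (k + 2 - (k + 1)) * jn (MZ P X (k + 1) (k + 1)) t ≤ 1 / 40 := by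
          rw [show k + 2 - (k + 1) = 1 by omega]
          have h1 := H.jn_MZ_self_le t (by omega) hk
          have h2 : yt t * nu P X 1 (k + 1) ≤ 1 / 50 := by
            nlinarith [H.nu1 (k + 1) hk, yt_le_two t, yt_nonneg t,
              nu_nonneg (P := P) (X := X) 1 (k + 1)]
          linarith
        -- The ratio is `10/9 · 101/500 = 101/450`; blocks of length at least two sum to less than
        -- `0.066`, the last term adds less than `0.025`, and the total stays below `1/10`.
        have hrest : ∑ j ∈ Finset.Icc 1 k, (10 / 9 : ℝ) ^ (k + 2 - j) *
            jn (MZ P X j (k + 1)) t ≤ (101 / 450) ^ 2 * (1 - 101 / 450)⁻¹ := by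
          refine le_trans ?_ (mul_le_mul_of_nonneg_left
            (sum_Icc_geom_le (q := 101 / 450) (by norm_num) (by norm_num) k) (by positivity))
          rw [Finset.mul_sum]
          refine Finset.sum_le_sum fun j hj => ?_
          simp only [Finset.mem_Icc] at hj
          have h1 := H.jn_MZ_le_pow t hj.1 hk
          calc _ ≤ (10 / 9 : ℝ) ^ (k + 2 - j) * (101 / 500) ^ (k + 2 - j) := by
                gcongr
            _ = (101 / 450) ^ (2 + (k - j)) := by
                rw [← mul_pow, show k + 2 - j = 2 + (k - j) by omega]; norm_num
            _ = _ := pow_add _ _ _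
        norm_num at hrest ⊢
        linarith
      have h0 : ∀ t, cF P X (k + 1) t ≠ 0 := by
        intro t h
        have h1 := (norm_le_jn _ t).trans (hrle t)
        simp [ratio, h] at h1
        norm_num at h1
      refine ⟨hd, h0, hrle, fun a ha t => ?_⟩
      rcases ha.eq_or_lt with rfl | ha
      · have : quot P X (k + 1) (k + 1) = fun _ => 1 := by
          funext t; exact div_self (h0 t)
        rw [this, jn_const]; simp
      · have hrd : Differentiable ℝ (ratio P X (k + 1)) := hd.div hdk h0k
        have hr0 : ∀ t, ratio P X (k + 1) t ≠ 0 := fun t => div_ne_zero (h0 t) (h0k t)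
        have he : quot P X a (k + 1) = fun t => quot P X a k t * (ratio P X (k + 1) t)⁻¹ := by
          funext t
          have a1 := h0 t
          have a2 := h0k t
          simp only [quot, ratio, Nat.add_sub_cancel]
          field_simp
        have had : Differentiable ℝ (quot P X a k) := (ih a ha (by omega)).1.div hdk h0k
        rw [he, show k + 1 - a = (k - a) + 1 by omega, pow_succ]
        refine (jn_mul_le (had t) ((hrd t).inv (hr0 t))).trans ?_
        have h1 := jn_inv_le hrd hr0 (by norm_num) (hrle t)
        have h2 := hqk a (by omega) t
        refine mul_le_mul h2 (h1.trans_eq (by norm_num)) (jn_nonneg _ _) (by positivity)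

theorem Regular.cF_ne_zero (H : Regular P X n) {k : ℕ} (hk : k ≤ n) (t : ℝ) : cF P X k t ≠ 0 :=
  (H.cF_jet k hk).2.1 t

theorem Regular.phi_eq_ratio (H : Regular P X n) (t : ℝ) {k : ℕ} (hk0 : 1 ≤ k) (hk : k ≤ n) :
    phi P X t k = ratio P X k t := by
  obtain ⟨k, rfl⟩ := Nat.exists_eq_add_of_le' hk0
  exact H.phi_eq_div t (fun j hj => H.cF_ne_zero hj t) hk

theorem Regular.ratio_ne_zero (H : Regular P X n) {k : ℕ} (hk : k ≤ n) (t : ℝ) :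
    ratio P X k t ≠ 0 := div_ne_zero (H.cF_ne_zero hk t) (H.cF_ne_zero (by omega) t)

theorem Regular.differentiable_cF (H : Regular P X n) {k : ℕ} (hk : k ≤ n) :
    Differentiable ℝ (cF P X k) := (H.cF_jet k hk).1

theorem Regular.differentiable_ratio (H : Regular P X n) {k : ℕ} (hk : k ≤ n) :
    Differentiable ℝ (ratio P X k) :=
  (H.differentiable_cF hk).div (H.differentiable_cF (by omega)) (H.cF_ne_zero (by omega))

theorem Regular.differentiable_quot (H : Regular P X n) {a b : ℕ} (ha : a ≤ n) (hb : b ≤ n) :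
    Differentiable ℝ (quot P X a b) :=
  (H.differentiable_cF ha).div (H.differentiable_cF hb) (H.cF_ne_zero hb)

/-- With `X_0 = 0` every block that reaches index `0` vanishes, so formulas involving `k - 1` remain
valid at `k = 1`. -/
theorem Regular.MZ_zero_left (H : Regular P X n) (k : ℕ) : MZ P X 0 k = fun _ => 0 := by
  funext t
  simp only [MZ]
  have : ∀ ω, ∏ l ∈ Finset.Icc 0 k, Z X t l ω = 0 := fun ω =>
    Finset.prod_eq_zero (Finset.mem_Icc.2 ⟨le_rfl, Nat.zero_le k⟩) (by simp [Z, H.zero])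
  simp [this]

theorem Regular.differentiable_MZ (H : Regular P X n) {j k : ℕ} (hk : k ≤ n) :
    Differentiable ℝ (MZ P X j k) := by
  rcases Nat.eq_zero_or_pos j with rfl | hj
  · rw [H.MZ_zero_left]; exact differentiable_const _
  · exact (H.MZ_jet hj hk).1

theorem Regular.prod_ratio (H : Regular P X n) (t : ℝ) {k : ℕ} (hk : k ≤ n) :
    ∏ j ∈ Finset.Icc 1 k, ratio P X j t = cF P X k t := by
  induction k with
  | zero => simp [cF_zero]
  | succ k ih =>
    rw [Finset.prod_Icc_succ_top (by omega), ih (by omega), ratio, Nat.add_sub_cancel,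
      mul_div_cancel₀ _ (H.cF_ne_zero (by omega) t)]

theorem Regular.jn_ratio_sub_one_le (H : Regular P X n) {k : ℕ} (hk : k ≤ n) (t : ℝ) :
    jn (fun t => ratio P X k t - 1) t ≤ 1 / 10 := (H.cF_jet k hk).2.2.1 t

theorem Regular.jn_inv_ratio_le (H : Regular P X n) {k : ℕ} (hk : k ≤ n) (t : ℝ) :
    jn (fun t => (ratio P X k t)⁻¹) t ≤ 10 / 9 :=
  (jn_inv_le (H.differentiable_ratio hk) (H.ratio_ne_zero hk) (by norm_num)
    (H.jn_ratio_sub_one_le hk t)).trans_eq (by norm_num)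

theorem Regular.jn_quot_le (H : Regular P X n) {j k : ℕ} (hj : 1 ≤ j) (hjk : j ≤ k) (hk : k ≤ n)
    (t : ℝ) : jn (quot P X (j - 2) (k - 1)) t ≤ (10 / 9) ^ (k + 1 - j) :=
  ((H.cF_jet (k - 1) (by omega)).2.2.2 (j - 2) (by omega) t).trans
    (pow_le_pow_right₀ (by norm_num) (by omega))

/-- The contribution to `φ_k` of the blocks of length at least three. -/
def longSum (P : Measure Ω) (X : ℕ → Ω → ℕ) (k : ℕ) (t : ℝ) : ℂ :=
  ∑ j ∈ Finset.Icc 1 (k - 2), quot P X (j - 2) (k - 1) t * MZ P X j k t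

/-- `Regular.cF_succ` divided by `F_{k-1}` and sorted by block length: one, two, and at least three.
All later estimates of `φ_k` start from this. -/
theorem Regular.ratio_sub_one (H : Regular P X n) {k : ℕ} (hk0 : 1 ≤ k) (hk : k ≤ n) (t : ℝ) :
    ratio P X k t - 1 = (ratio P X (k - 1) t)⁻¹ * MZ P X k k t +
      quot P X (k - 3) (k - 1) t * MZ P X (k - 1) k t + longSum P X k t := by
  obtain ⟨k, rfl⟩ := Nat.exists_eq_add_of_le' hk0
  have h0 := H.cF_ne_zero (k := k) (by omega) t
  have h1 : ratio P X (k + 1) t - 1 =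
      ∑ j ∈ Finset.Icc 1 (k + 1), quot P X (j - 2) k t * MZ P X j (k + 1) t := by
    simp only [ratio, quot, Nat.add_sub_cancel]
    rw [H.cF_succ t hk, add_div, div_self h0, add_sub_cancel_left, Finset.sum_div]
    exact Finset.sum_congr rfl fun j _ => by ring
  have h2 : (ratio P X k t)⁻¹ = quot P X (k + 1 - 2) k t := by
    rw [ratio, inv_div, quot]; rfl
  rw [h1, Finset.sum_Icc_succ_top (by omega), longSum, Nat.add_sub_cancel, h2]
  rcases k with _ | k
  · simp [H.MZ_zero_left]
  · rw [Finset.sum_Icc_succ_top (by omega), show k + 1 + 1 - 3 = k + 1 - 2 by omega,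
      show k + 1 + 1 - 2 = k by omega]
    ring

theorem norm_MZ_le_blk (t : ℝ) {j : ℕ} (k : ℕ) (hj : 1 ≤ j) :
    ‖MZ P X j k t‖ ≤ blk P X (mixb t 0) j k := by
  refine (norm_integral_le_integral_norm _).trans_eq ?_
  refine integral_congr_ae (Filter.Eventually.of_forall fun ω => ?_)
  simp only
  rw [norm_prod]
  refine Finset.prod_congr rfl fun l hl => ?_
  simp only [Finset.mem_Icc] at hl
  rw [mixb, if_neg (by omega)]; rfl

theorem Regular.norm_MZ_pair_le (H : Regular P X n) (t : ℝ) {k : ℕ} (hk0 : 1 ≤ k) (hk : k ≤ n) :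
    ‖MZ P X (k - 1) k t‖ ≤ yt t ^ 2 * mom2 P X k := by
  rcases hk0.eq_or_lt with rfl | h
  · simp [H.MZ_zero_left, H.mom2_one]
  · exact (norm_MZ_le_blk t k (by omega)).trans (H.blk_pair_le t 0 (by omega) hk)

theorem Regular.norm_MZ_self_le (H : Regular P X n) (t : ℝ) {k : ℕ} (hk0 : 1 ≤ k) (hk : k ≤ n) :
    ‖MZ P X k k t‖ ≤ yt t * nu P X 1 k :=
  (norm_MZ_le_blk t k hk0).trans (H.blk_single_le t 0 hk)

theorem Regular.norm_quot_le (H : Regular P X n) {j k : ℕ} (hj : 1 ≤ j) (hjk : j ≤ k) (hk : k ≤ n)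
    (t : ℝ) : ‖quot P X (j - 2) (k - 1) t‖ ≤ (10 / 9) ^ (k + 1 - j) :=
  (norm_le_jn _ t).trans (H.jn_quot_le hj hjk hk t)

/-- One factor `|Z_j| ≤ y X_j` is kept in each block to gain a `y`, and the rest is summed
geometrically: `1/90 + 2/63 < 43/1000`. The numerical value matters for the constant in
`Regular.norm_ratio_le`. -/
theorem Regular.norm_ratio_sub_one_le (H : Regular P X n) {k : ℕ} (hk : k ≤ n) (t : ℝ) :
    ‖ratio P X k t - 1‖ ≤ 43 / 1000 * yt t := by
  have hy := yt_nonneg t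
  rcases k with _ | k
  · simp [ratio, cF_zero]; positivity
  have h0 := H.cF_ne_zero (k := k) (by omega) t
  have h1 : ratio P X (k + 1) t - 1 =
      ∑ j ∈ Finset.Icc 1 (k + 1), quot P X (j - 2) k t * MZ P X j (k + 1) t := by
    simp only [ratio, quot, Nat.add_sub_cancel]
    rw [H.cF_succ t hk, add_div, div_self h0, add_sub_cancel_left, Finset.sum_div]
    exact Finset.sum_congr rfl fun j _ => by ring
  have hq : ∀ j ∈ Finset.Icc 1 (k + 1), ‖quot P X (j - 2) k t‖ ≤ (10 / 9) ^ (k + 2 - j) := by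
    intro j hj
    simp only [Finset.mem_Icc] at hj
    exact H.norm_quot_le hj.1 hj.2 hk t
  rw [h1]
  refine (norm_sum_le _ _).trans ?_
  rw [Finset.sum_Icc_succ_top (by omega)]
  have hlast : ‖quot P X (k + 1 - 2) k t * MZ P X (k + 1) (k + 1) t‖ ≤ 1 / 90 * yt t := by
    rw [norm_mul]
    have a1 := hq (k + 1) (by simp)
    rw [show k + 2 - (k + 1) = 1 by omega, pow_one] at a1
    have a2 : ‖MZ P X (k + 1) (k + 1) t‖ ≤ 1 / 100 * yt t := by
      refine (H.norm_MZ_self_le t (by omega) hk).trans ?_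
      rw [mul_comm]
      exact mul_le_mul_of_nonneg_right (H.nu1 _ hk) hy
    calc _ ≤ 10 / 9 * (1 / 100 * yt t) := by gcongr
      _ = _ := by ring
  have hrest : ∑ j ∈ Finset.Icc 1 k, ‖quot P X (j - 2) k t * MZ P X j (k + 1) t‖ ≤
      yt t / 2 * (2 / 9) ^ 2 * (1 - 2 / 9)⁻¹ := by
    refine le_trans ?_ (mul_le_mul_of_nonneg_left
      (sum_Icc_geom_le (q := 2 / 9) (by norm_num) (by norm_num) k) (by positivity))
    rw [Finset.mul_sum]
    refine Finset.sum_le_sum fun j hj => ?_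
    have a1 := hq j (by simp only [Finset.mem_Icc] at hj ⊢; omega)
    simp only [Finset.mem_Icc] at hj
    have a2 : ‖MZ P X j (k + 1) t‖ ≤ yt t / 2 * (1 / 5) ^ (k + 2 - j) := by
      refine (norm_MZ_le_blk t (k + 1) hj.1).trans ?_
      have b1 := H.blk_drop (adm_mixb t 0) hj.1 (l := j + 1) (by omega) (by omega) hk (by omega)
      have b2 := H.blk_single_le t 0 (l := j) (by omega)
      have b3 := H.blk_le_pow t 0 (j := j + 1 + 1) (k := k + 1) (by omega) hk
      have b4 := blk_nonneg (P := P) (X := X) (adm_mixb t 0) (j + 1 + 1) (k + 1)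
      have b5 := nu_nonneg (P := P) (X := X) 1 j
      have b6 := H.nu1 j (by omega)
      rw [Nat.add_sub_cancel] at b1
      rw [show k + 1 + 1 - (j + 1 + 1) = k - j by omega] at b3
      calc _ ≤ 2 * (yt t * (1 / 100)) * (1 / 5) ^ (k - j) := by
            refine b1.trans ?_
            gcongr
            exact b2.trans (by gcongr)
        _ = yt t / 2 * (1 / 5) ^ (k - j + 2) := by ring
        _ = _ := by rw [show k - j + 2 = k + 2 - j by omega]
    rw [norm_mul]
    calc _ ≤ (10 / 9 : ℝ) ^ (k + 2 - j) * (yt t / 2 * (1 / 5) ^ (k + 2 - j)) := by gcongr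
      _ = yt t / 2 * ((10 / 9) * (1 / 5)) ^ (2 + (k - j)) := by
          rw [mul_pow, show k + 2 - j = 2 + (k - j) by omega]; ring
      _ = _ := by rw [pow_add]; norm_num; ring
  have : yt t / 2 * (2 / 9) ^ 2 * (1 - 2 / 9)⁻¹ = 2 / 63 * yt t := by norm_num; ring
  linarith

/-- On the unit circle `|1 + v(w - 1)|² = 1 - v(1 - v)|w - 1|²`, and `√(1 - x) ≤ 1 - x/2`. -/
theorem norm_one_add_mul_le {v : ℝ} (hv0 : 0 ≤ v) (hv : v ≤ 1 / 100) (t : ℝ) :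
    ‖1 + (v : ℂ) * (Complex.exp (Complex.I * t) - 1)‖ ≤ 1 - 99 / 200 * v * yt t ^ 2 := by
  have hy := yt_nonneg t
  have hy2 := yt_le_two t
  set z := Complex.exp (Complex.I * t) - 1 with hz
  have hz2 : yt t ^ 2 = z.re ^ 2 + z.im ^ 2 := by
    rw [yt, ← Complex.normSq_eq_norm_sq, Complex.normSq_apply]; ring
  have hcirc : (z.re + 1) ^ 2 + z.im ^ 2 = 1 := by
    have h := norm_exp_I_mul t
    have h2 : Complex.normSq (z + 1) = 1 := by
      rw [hz, sub_add_cancel, Complex.normSq_eq_norm_sq, h, one_pow]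
    rw [Complex.normSq_apply] at h2
    simp at h2
    linarith
  have hsq : ‖1 + (v : ℂ) * z‖ ^ 2 = 1 - v * (1 - v) * yt t ^ 2 := by
    rw [← Complex.normSq_eq_norm_sq, Complex.normSq_apply, hz2]
    simp
    linear_combination v * hcirc
  have hpos : 0 ≤ 1 - 99 / 200 * v * yt t ^ 2 := by nlinarith
  refine abs_le_of_sq_le_sq' ?_ hpos |>.2
  rw [hsq]
  nlinarith [sq_nonneg (v * yt t ^ 2), mul_nonneg hv0 (sq_nonneg (yt t)),
    mul_nonneg (mul_nonneg hv0 (sq_nonneg (yt t))) (sub_nonneg.2 hv)]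

theorem Regular.norm_MZ_self_sub_le (H : Regular P X n) {k : ℕ} (hk : k ≤ n) (t : ℝ) :
    ‖MZ P X k k t - nu P X 1 k * (Complex.exp (Complex.I * t) - 1)‖ ≤
      1 / 2 * (yt t ^ 2 * nu P X 2 k) := by
  have hZ : Integrable (fun ω => Z X t k ω) P := by
    simpa using H.integrable_prod_Z t (I := ∅) (J := {k}) (by simp) (by simpa using hk)
  have hX : Integrable (fun ω => ((rv X k ω : ℝ) : ℂ) * (Complex.exp (Complex.I * t) - 1)) P :=
    (H.integrable_rv hk).ofReal.mul_const _
  have e : MZ P X k k t - nu P X 1 k * (Complex.exp (Complex.I * t) - 1) =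
      ∫ ω, (Z X t k ω - ((rv X k ω : ℝ) : ℂ) * (Complex.exp (Complex.I * t) - 1)) ∂P := by
    rw [integral_sub hZ hX, integral_mul_const, nu_one]
    congr 1
    · simp [MZ]
    · rw [integral_complex_ofReal]
  rw [e, nu, ← integral_const_mul, ← integral_const_mul]
  refine norm_integral_le_of_norm_le
    (((H.integrable_fac (by norm_num) hk).const_mul _).const_mul _)
    (Filter.Eventually.of_forall fun ω => ?_)
  have := norm_pow_sub_linear_le (norm_exp_I_mul t) (X k ω)
  rw [← exp_I_mul_nat] at this
  rw [fac_two]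
  simp only [rv, Z]
  refine le_trans (le_of_eq (by push_cast; rfl)) (this.trans (le_of_eq ?_))
  rw [yt]; ring

/-- `λ_k`. -/
def lamk (P : Measure Ω) (X : ℕ → Ω → ℕ) (k : ℕ) : ℝ :=
  nu P X 1 k - 1.52 * nu P X 2 k - 12 * mom2 P X k

/-- Drop the factor `k - 2`, which isolates the last pair; the geometric sum is `2 (10/9)³ (1 -
2/9)⁻¹ ≈ 3.527`. -/
theorem Regular.norm_longSum_le (H : Regular P X n) {k : ℕ} (hk : k ≤ n) (t : ℝ) :
    ‖longSum P X k t‖ ≤ 7 / 2 * (1009 / 1000) * (yt t ^ 2 * mom2 P X k) := by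
  have hy := yt_nonneg t
  have hm := mom2_nonneg (P := P) (X := X) k
  refine (norm_sum_le _ _).trans ?_
  have : ∑ j ∈ Finset.Icc 1 (k - 2), ‖quot P X (j - 2) (k - 1) t * MZ P X j k t‖ ≤
      2 * (10 / 9) ^ 3 * (yt t ^ 2 * mom2 P X k) * (1 - 2 / 9)⁻¹ := by
    refine le_trans ?_ (mul_le_mul_of_nonneg_left
      (sum_Icc_geom_le (q := 2 / 9) (by norm_num) (by norm_num) (k - 2)) (by positivity))
    rw [Finset.mul_sum]
    refine Finset.sum_le_sum fun j hj => ?_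
    simp only [Finset.mem_Icc] at hj
    have a1 := H.norm_quot_le hj.1 (by omega : j ≤ k) hk t
    have a2 : ‖MZ P X j k t‖ ≤ 2 * (1 / 5) ^ (k - 2 - j) * (yt t ^ 2 * mom2 P X k) := by
      refine (norm_MZ_le_blk t k hj.1).trans ?_
      have b1 := H.blk_drop (adm_mixb t 0) hj.1 (l := k - 2) (by omega) (by omega) hk (by omega)
      have b2 := H.blk_pair_le t 0 (by omega) hk
      have b3 := H.blk_le_pow t 0 (j := j) (k := k - 2 - 1) (by omega) (by omega)
      have b4 := blk_nonneg (P := P) (X := X) (adm_mixb t 0) (k - 1) k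
      rw [show k - 2 + 1 = k - 1 by omega] at b1
      rw [show k - 2 - 1 + 1 - j = k - 2 - j by omega] at b3
      exact b1.trans (by gcongr)
    rw [norm_mul]
    calc _ ≤ (10 / 9 : ℝ) ^ (k + 1 - j) * (2 * (1 / 5) ^ (k - 2 - j) * (yt t ^ 2 * mom2 P X k)) := by
          gcongr
      _ = 2 * (10 / 9) ^ 3 * (yt t ^ 2 * mom2 P X k) * ((10 / 9) * (1 / 5)) ^ (k - 2 - j) := by
          rw [mul_pow, show k + 1 - j = 3 + (k - 2 - j) by omega, pow_add]; ring
      _ = _ := by norm_num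
  refine this.trans ?_
  have : 0 ≤ yt t ^ 2 * mom2 P X k := by positivity
  norm_num
  nlinarith

/-- The main term `1 + ν_1(e^{it} - 1)` gives `-0.495 ν_1 y²`; the corrections cost `0.048 ν_1`,
`0.5 ν_2` and about `4.77 E X_{k-1}X_k`, each times `y²`. These fit into `0.43 λ_k` because `0.495 -
0.048 ≥ 0.43`, `0.43 · 1.52 ≥ 0.5` and `0.43 · 12 ≥ 4.77`. -/
theorem Regular.norm_ratio_le (H : Regular P X n) {k : ℕ} (hk0 : 1 ≤ k) (hk : k ≤ n) (t : ℝ) :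
    ‖ratio P X k t‖ ≤ Real.exp (-(43 / 100) * lamk P X k * yt t ^ 2) := by
  have hy := yt_nonneg t
  have hm := mom2_nonneg (P := P) (X := X) k
  have hv := nu_nonneg (P := P) (X := X) 1 k
  have hv2 := nu_nonneg (P := P) (X := X) 2 k
  have hinv : ‖(ratio P X (k - 1) t)⁻¹‖ ≤ 10 / 9 :=
    (norm_le_jn _ t).trans (H.jn_inv_ratio_le (by omega) t)
  have h1 : ratio P X k t = (1 + (nu P X 1 k : ℂ) * (Complex.exp (Complex.I * t) - 1)) +
      (MZ P X k k t - nu P X 1 k * (Complex.exp (Complex.I * t) - 1)) +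
      MZ P X k k t * ((ratio P X (k - 1) t)⁻¹ * (1 - ratio P X (k - 1) t)) +
      quot P X (k - 3) (k - 1) t * MZ P X (k - 1) k t + longSum P X k t := by
    have h2 := H.ratio_sub_one hk0 hk t
    have h3 : (ratio P X (k - 1) t)⁻¹ * (1 - ratio P X (k - 1) t) =
        (ratio P X (k - 1) t)⁻¹ - 1 := by
      rw [mul_sub, mul_one, inv_mul_cancel₀ (H.ratio_ne_zero (by omega) t)]
    rw [h3]
    linear_combination h2
  have hpair : ‖quot P X (k - 3) (k - 1) t * MZ P X (k - 1) k t‖ ≤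
      100 / 81 * (yt t ^ 2 * mom2 P X k) := by
    rcases hk0.eq_or_lt with rfl | h
    · simp [H.MZ_zero_left, H.mom2_one]
    · rw [norm_mul]
      have a1 := H.norm_quot_le (j := k - 1) (by omega) (by omega) hk t
      rw [show k - 1 - 2 = k - 3 by omega, show k + 1 - (k - 1) = 2 by omega] at a1
      have a2 := H.norm_MZ_pair_le t hk0 hk
      calc _ ≤ (10 / 9 : ℝ) ^ 2 * (yt t ^ 2 * mom2 P X k) := by gcongr
        _ = _ := by norm_num
  have hcross : ‖MZ P X k k t * ((ratio P X (k - 1) t)⁻¹ * (1 - ratio P X (k - 1) t))‖ ≤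
      48 / 1000 * (yt t ^ 2 * nu P X 1 k) := by
    rw [norm_mul, norm_mul, norm_sub_rev]
    have a1 := H.norm_ratio_sub_one_le (k := k - 1) (by omega) t
    have a2 := H.norm_MZ_self_le t hk0 hk
    have : 0 ≤ yt t ^ 2 * nu P X 1 k := by positivity
    calc _ ≤ yt t * nu P X 1 k * (10 / 9 * (43 / 1000 * yt t)) := by gcongr
      _ ≤ _ := by nlinarith
  have e1 := norm_one_add_mul_le hv (H.nu1 k hk) t
  have e2 := H.norm_MZ_self_sub_le hk t
  have e3 := H.norm_longSum_le hk t
  rw [h1]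
  refine ((norm_add_le _ _).trans (add_le_add (norm_add₄_le) e3)).trans ?_
  refine le_trans ?_ (Real.add_one_le_exp _)
  have f1 : 0 ≤ yt t ^ 2 * mom2 P X k := by positivity
  have f2 : 0 ≤ yt t ^ 2 * nu P X 1 k := by positivity
  have f3 : 0 ≤ yt t ^ 2 * nu P X 2 k := by positivity
  rw [lamk]
  nlinarith

/-! ### Jets of the factors -/

/-- The number of derivative positions is at most `5 · 2^p`, and `10/9 · 2 · 1/5 = 4/9 ≤ 1/2`, so
the sum over the left ends of blocks still converges. -/
theorem core_coeff_le (p c : ℕ) (hc : c ≤ 3) :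
    (10 / 9 : ℝ) ^ (p + c + 1) * ((p + c + 2 : ℕ) * (10 * (1 / 5) ^ p)) ≤ 80 * (1 / 2) ^ p := by
  have h1 : ((p + c + 2 : ℕ) : ℝ) ≤ 5 * 2 ^ p := by
    have h2 : (p : ℝ) + 1 ≤ 2 ^ p := by exact_mod_cast Nat.lt_two_pow_self (n := p)
    have h3 : (c : ℝ) ≤ 3 := by exact_mod_cast hc
    have h4 : (0 : ℝ) ≤ p := Nat.cast_nonneg p
    push_cast; linarith
  have h5 : (10 / 9 : ℝ) ^ (c + 1) ≤ (10 / 9) ^ 4 := pow_le_pow_right₀ (by norm_num) (by omega)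
  calc _ = (10 / 9 : ℝ) ^ (c + 1) * (10 / 9) ^ p * ((p + c + 2 : ℕ) * (10 * (1 / 5) ^ p)) := by
        rw [← pow_add]; congr 2; omega
    _ ≤ (10 / 9) ^ 4 * (10 / 9) ^ p * (5 * 2 ^ p * (10 * (1 / 5) ^ p)) := by gcongr
    _ = (10 / 9) ^ 4 * 50 * ((10 / 9) * 2 * (1 / 5)) ^ p := by rw [mul_pow, mul_pow]; ring
    _ ≤ 80 * (1 / 2) ^ p := by gcongr <;> norm_num

theorem Regular.jn_core_sum_le (H : Regular P X n) (t : ℝ) {c k : ℕ} (hc1 : 1 ≤ c) (hc : c ≤ 3)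
    (hk : k ≤ n) {B : ℝ} (hB0 : 0 ≤ B)
    (hB : c < k → ∀ i ≠ k - c, blk P X (mixb t i) (k - c + 1) k ≤ B)
    (hB' : c < k → blk P X (mixb t (k - c)) (k - c) k ≤ B) :
    jn (fun t => ∑ j ∈ Finset.Icc 1 (k - c), quot P X (j - 2) (k - 1) t * MZ P X j k t) t ≤
      160 * B := by
  have hd : ∀ j ∈ Finset.Icc 1 (k - c), DifferentiableAt ℝ (quot P X (j - 2) (k - 1)) t ∧
      DifferentiableAt ℝ (MZ P X j k) t := by
    intro j hj
    simp only [Finset.mem_Icc] at hj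
    exact ⟨H.differentiable_quot (by omega) (by omega) t, H.differentiable_MZ hk t⟩
  refine (jn_sum_le _ fun j hj => (hd j hj).1.mul (hd j hj).2).trans ?_
  calc _ ≤ ∑ j ∈ Finset.Icc 1 (k - c), 80 * B * (1 / 2) ^ (k - c - j) := by
        refine Finset.sum_le_sum fun j hj => ?_
        refine (jn_mul_le (hd j hj).1 (hd j hj).2).trans ?_
        simp only [Finset.mem_Icc] at hj
        have a1 := H.jn_quot_le hj.1 (by omega : j ≤ k) hk t
        have a2 := H.jn_MZ_le_core t hj.1 hj.2 (by omega) hk (hB (by omega)) (hB' (by omega))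
        have a3 := core_coeff_le (k - c - j) c hc
        rw [show k - c - j + c + 1 = k + 1 - j by omega,
          show k - c - j + c + 2 = k + 2 - j by omega] at a3
        calc _ ≤ (10 / 9 : ℝ) ^ (k + 1 - j) *
              ((k + 2 - j : ℕ) * (10 * (1 / 5) ^ (k - c - j) * B)) := by
              gcongr
              exact jn_nonneg _ _
          _ = ((10 / 9 : ℝ) ^ (k + 1 - j) * ((k + 2 - j : ℕ) * (10 * (1 / 5) ^ (k - c - j)))) * B := by
              ring
          _ ≤ 80 * (1 / 2) ^ (k - c - j) * B := by gcongr
          _ = _ := by ring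
    _ ≤ 80 * B * (1 - 1 / 2)⁻¹ := by
        rw [← Finset.mul_sum]
        gcongr
        exact sum_Icc_geom_le (by norm_num) (by norm_num) _
    _ = _ := by norm_num; ring

/-- The core is the pair `k - 1, k`. The one block whose separating factor `k - 2` cannot be
dropped, because it is the differentiated one, is recorded as `headBlk`. -/
theorem Regular.jn_longSum_le (H : Regular P X n) (t : ℝ) {k : ℕ} (hk : k ≤ n) :
    jn (longSum P X k) t ≤ 160 * (yt t ^ 2 * mom2 P X k + headBlk P X t k) := by
  have hm := mom2_nonneg (P := P) (X := X) k
  have hh := headBlk_nonneg (P := P) (X := X) t k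
  have h1 : 0 ≤ yt t ^ 2 * mom2 P X k := by positivity
  refine H.jn_core_sum_le t (c := 2) (by norm_num) (by norm_num) hk (by positivity) ?_ ?_
  · intro h i _
    have := H.blk_pair_le t i (by omega) hk
    rw [show k - 2 + 1 = k - 1 by omega]
    linarith
  · intro h
    rw [headBlk, if_pos (by omega : 3 ≤ k)]
    linarith

/-- The third order version: the core is the triple ending at `k`. If the factor `k - 3` in front of
it is differentiated, the last factor is dropped instead, which leaves the triple ending at `k - 1`.
-/
theorem Regular.jn_longSum_le' (H : Regular P X n) (t : ℝ) {k : ℕ} (hk : k ≤ n) :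
    jn (longSum P X k) t ≤ 400 * (yt t ^ 3 * (mom3 P X k + mom3 P X (k - 1))) := by
  have hy := yt_nonneg t
  have hm := mom3_nonneg (P := P) (X := X) k
  have hm' := mom3_nonneg (P := P) (X := X) (k - 1)
  rcases lt_or_ge k 3 with h | h
  · have : longSum P X k = fun _ => 0 := by
      funext t
      rw [longSum, show k - 2 = 0 by omega]; simp
    rw [this, jn_const, norm_zero]; positivity
  have h1 : longSum P X k = fun t =>
      (∑ j ∈ Finset.Icc 1 (k - 3), quot P X (j - 2) (k - 1) t * MZ P X j k t) +
      quot P X (k - 2 - 2) (k - 1) t * MZ P X (k - 2) k t := by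
    funext t
    rw [longSum, show k - 2 = k - 3 + 1 by omega, Finset.sum_Icc_succ_top (by omega)]
  have hq := H.differentiable_quot (a := k - 2 - 2) (b := k - 1) (by omega) (by omega) t
  have hM := H.differentiable_MZ (j := k - 2) hk t
  have hs : DifferentiableAt ℝ (fun t => ∑ j ∈ Finset.Icc 1 (k - 3),
      quot P X (j - 2) (k - 1) t * MZ P X j k t) t := by
    refine DifferentiableAt.fun_sum fun j hj => ?_
    simp only [Finset.mem_Icc] at hj
    exact (H.differentiable_quot (by omega) (by omega) t).mul (H.differentiable_MZ hk t)
  have h2 := H.jn_core_sum_le t (c := 3) (k := k) (B := 2 * (yt t ^ 3 * (mom3 P X k + mom3 P X (k - 1))))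
    (by norm_num) (by norm_num) hk (by positivity) ?_ ?_
  · have h3 := H.jn_quot_le (j := k - 2) (by omega) (by omega) hk t
    rw [show k + 1 - (k - 2) = 3 by omega] at h3
    have h4 := H.jn_MZ_triple_le t h hk
    rw [h1]
    calc _ ≤ _ := (jn_add_le hs (hq.mul hM)).trans (add_le_add h2 (jn_mul_le hq hM))
      _ ≤ 160 * (2 * (yt t ^ 3 * (mom3 P X k + mom3 P X (k - 1)))) +
          (10 / 9) ^ 3 * (4 * (yt t ^ 3 * mom3 P X k)) := by
          gcongr
          exact jn_nonneg _ _
      _ ≤ _ := by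
          have : 0 ≤ yt t ^ 3 * mom3 P X k := by positivity
          have : 0 ≤ yt t ^ 3 * mom3 P X (k - 1) := by positivity
          norm_num
          nlinarith
  · intro hk3 i _
    have := H.blk_triple_le t i (by omega) hk
    rw [show k - 3 + 1 = k - 2 by omega]
    have : 0 ≤ yt t ^ 3 * mom3 P X k := by positivity
    have : 0 ≤ yt t ^ 3 * mom3 P X (k - 1) := by positivity
    linarith
  · intro hk3
    have a1 := H.blk_le_two_mul_init t (i := k - 3) (j := k - 3) (by omega) (by omega) hk (by omega)
    have a2 := H.blk_triple_le t (k - 3) (k := k - 1) (by omega) (by omega)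
    rw [show k - 1 - 2 = k - 3 by omega] at a2
    have : 0 ≤ yt t ^ 3 * mom3 P X k := by positivity
    linarith

theorem Regular.jn_MZ_pair_le' (H : Regular P X n) (t : ℝ) {k : ℕ} (hk0 : 1 ≤ k) (hk : k ≤ n) :
    jn (MZ P X (k - 1) k) t ≤ 3 * (yt t ^ 2 * mom2 P X k) := by
  rcases hk0.eq_or_lt with rfl | h
  · rw [H.MZ_zero_left, jn_const, H.mom2_one]; simp
  · exact H.jn_MZ_pair_le t h hk

theorem Regular.jn_pair_term_le (H : Regular P X n) (t : ℝ) {k : ℕ} (hk0 : 1 ≤ k) (hk : k ≤ n) :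
    jn (fun t => quot P X (k - 3) (k - 1) t * MZ P X (k - 1) k t) t ≤
      4 * (yt t ^ 2 * mom2 P X k) := by
  have hm := mom2_nonneg (P := P) (X := X) k
  rcases hk0.eq_or_lt with rfl | h
  · simp [H.MZ_zero_left, jn_const, H.mom2_one]
  · have a1 := H.jn_quot_le (j := k - 1) (by omega) (by omega) hk t
    rw [show k - 1 - 2 = k - 3 by omega, show k + 1 - (k - 1) = 2 by omega] at a1
    refine (jn_mul_le (H.differentiable_quot (by omega) (by omega) t)
      (H.differentiable_MZ hk t)).trans ?_
    calc _ ≤ (10 / 9 : ℝ) ^ 2 * (3 * (yt t ^ 2 * mom2 P X k)) := by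
          gcongr
          · exact jn_nonneg _ _
          · exact H.jn_MZ_pair_le' t hk0 hk
      _ ≤ _ := by
          have : 0 ≤ yt t ^ 2 * mom2 P X k := by positivity
          norm_num; nlinarith

theorem Regular.jn_ratio_sub_one_le' (H : Regular P X n) (t : ℝ) {k : ℕ} (hk : k ≤ n) :
    jn (fun t => ratio P X k t - 1) t ≤
      200 * (yt t * nu P X 1 k + yt t ^ 2 * mom2 P X k + headBlk P X t k) := by
  have hy := yt_nonneg t
  have hm := mom2_nonneg (P := P) (X := X) k
  have hv := nu_nonneg (P := P) (X := X) 1 k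
  have hh := headBlk_nonneg (P := P) (X := X) t k
  rcases Nat.eq_zero_or_pos k with rfl | hk0
  · have h1 : (fun t => ratio P X 0 t - 1) = fun _ => 0 := by funext t; simp [ratio, cF_zero]
    rw [h1, jn_const, norm_zero]; positivity
  have hi : DifferentiableAt ℝ (fun t => (ratio P X (k - 1) t)⁻¹) t :=
    (H.differentiable_ratio (by omega) t).inv (H.ratio_ne_zero (by omega) t)
  have hMk := H.differentiable_MZ (j := k) hk t
  have hq := H.differentiable_quot (a := k - 3) (b := k - 1) (by omega) (by omega) t
  have hM2 := H.differentiable_MZ (j := k - 1) hk t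
  have hL : DifferentiableAt ℝ (longSum P X k) t := by
    refine DifferentiableAt.fun_sum fun j hj => ?_
    simp only [Finset.mem_Icc] at hj
    exact (H.differentiable_quot (by omega) (by omega) t).mul (H.differentiable_MZ hk t)
  rw [funext fun t => H.ratio_sub_one hk0 hk t]
  have b1 := H.jn_inv_ratio_le (k := k - 1) (by omega) t
  have b2 := H.jn_MZ_self_le t hk0 hk
  have b3 := H.jn_pair_term_le t hk0 hk
  have b4 := H.jn_longSum_le t hk
  have b5 : jn (fun t => (ratio P X (k - 1) t)⁻¹ * MZ P X k k t) t ≤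
      10 / 9 * (1001 / 1000 * (yt t * nu P X 1 k)) :=
    (jn_mul_le hi hMk).trans (mul_le_mul b1 b2 (jn_nonneg _ _) (by norm_num))
  refine ((jn_add_le ((hi.fun_mul hMk).fun_add (hq.fun_mul hM2)) hL).trans
    (add_le_add (jn_add_le (hi.fun_mul hMk) (hq.fun_mul hM2)) b4)).trans ?_
  have : 0 ≤ yt t ^ 2 * mom2 P X k := by positivity
  have : 0 ≤ yt t * nu P X 1 k := by positivity
  linarith

theorem Regular.jn_inv_ratio_sub_one_le (H : Regular P X n) (t : ℝ) {k : ℕ} (hk : k ≤ n) :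
    jn (fun t => (ratio P X k t)⁻¹ - 1) t ≤ 10 / 9 * jn (fun t => ratio P X k t - 1) t := by
  have hr := H.differentiable_ratio hk t
  have hi : DifferentiableAt ℝ (fun t => (ratio P X k t)⁻¹) t := hr.inv (H.ratio_ne_zero hk t)
  have e : (fun t => (ratio P X k t)⁻¹ - 1) =
      fun t => 0 - (ratio P X k t)⁻¹ * (ratio P X k t - 1) := by
    funext t
    have := H.ratio_ne_zero hk t
    field_simp
    ring
  rw [e]
  refine (jn_sub_le (differentiableAt_const _) (hi.mul (hr.sub_const 1))).trans ?_
  rw [jn_const, norm_zero, zero_add]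
  exact (jn_mul_le hi (hr.sub_const 1)).trans
    (mul_le_mul_of_nonneg_right (H.jn_inv_ratio_le hk t) (jn_nonneg _ _))

theorem Regular.differentiable_longSum (H : Regular P X n) {k : ℕ} (hk : k ≤ n) :
    Differentiable ℝ (longSum P X k) := by
  refine Differentiable.fun_sum fun j hj => ?_
  simp only [Finset.mem_Icc] at hj
  exact (H.differentiable_quot (by omega) (by omega)).mul (H.differentiable_MZ hk)

/-- In `Regular.ratio_sub_one` the mean has coefficient `φ_{k-1}⁻¹ = 1 + (φ_{k-1}⁻¹ - 1)`. The
deviation of `φ_{k-1}` from `1` is left unevaluated, so that it can be bounded to whatever order is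
needed. -/
theorem Regular.jn_ratio_sub_mean_le (H : Regular P X n) (t : ℝ) {k : ℕ} (hk : k ≤ n) :
    jn (fun t => ratio P X k t - 1 - MZ P X k k t) t ≤
      2 * (yt t * nu P X 1 k) * jn (fun t => ratio P X (k - 1) t - 1) t +
        200 * (yt t ^ 2 * mom2 P X k + headBlk P X t k) := by
  have hy := yt_nonneg t
  have hm := mom2_nonneg (P := P) (X := X) k
  have hv := nu_nonneg (P := P) (X := X) 1 k
  have hh := headBlk_nonneg (P := P) (X := X) t k
  have hj0 := jn_nonneg (fun t => ratio P X (k - 1) t - 1) t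
  rcases Nat.eq_zero_or_pos k with rfl | hk0
  · have h1 : (fun t => ratio P X 0 t - 1 - MZ P X 0 0 t) = fun _ => 0 := by
      funext t; simp [ratio, cF_zero, H.MZ_zero_left]
    rw [h1, jn_const, norm_zero]; positivity
  have hi : DifferentiableAt ℝ (fun t => (ratio P X (k - 1) t)⁻¹ - 1) t :=
    ((H.differentiable_ratio (by omega) t).inv (H.ratio_ne_zero (by omega) t)).sub_const 1
  have hMk := H.differentiable_MZ (j := k) hk t
  have hq := H.differentiable_quot (a := k - 3) (b := k - 1) (by omega) (by omega) t
  have hM2 := H.differentiable_MZ (j := k - 1) hk t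
  have hL := H.differentiable_longSum hk t
  have e : (fun t => ratio P X k t - 1 - MZ P X k k t) = fun t =>
      ((ratio P X (k - 1) t)⁻¹ - 1) * MZ P X k k t +
      quot P X (k - 3) (k - 1) t * MZ P X (k - 1) k t + longSum P X k t := by
    funext t
    rw [H.ratio_sub_one hk0 hk t]; ring
  rw [e]
  have b1 := H.jn_inv_ratio_sub_one_le t (k := k - 1) (by omega)
  have b2 := H.jn_MZ_self_le t hk0 hk
  have b3 := H.jn_pair_term_le t hk0 hk
  have b4 := H.jn_longSum_le t hk
  have b5 : jn (fun t => ((ratio P X (k - 1) t)⁻¹ - 1) * MZ P X k k t) t ≤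
      10 / 9 * jn (fun t => ratio P X (k - 1) t - 1) t * (1001 / 1000 * (yt t * nu P X 1 k)) :=
    (jn_mul_le hi hMk).trans (mul_le_mul b1 b2 (jn_nonneg _ _) (by positivity))
  refine ((jn_add_le ((hi.fun_mul hMk).fun_add (hq.fun_mul hM2)) hL).trans
    (add_le_add (jn_add_le (hi.fun_mul hMk) (hq.fun_mul hM2)) b4)).trans ?_
  have : 0 ≤ yt t ^ 2 * mom2 P X k := by positivity
  have : 0 ≤ (yt t * nu P X 1 k) * jn (fun t => ratio P X (k - 1) t - 1) t := by positivity
  linarith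

end

section

variable {Ω : Type*} [MeasurableSpace Ω] {P : Measure Ω} [IsProbabilityMeasure P]
  {X : ℕ → Ω → ℕ} {n : ℕ}

/-! ### Taylor expansions of the blocks -/

/-- `e^{it} - 1`. -/
def zt (t : ℝ) : ℂ := Complex.exp (Complex.I * t) - 1

theorem norm_zt (t : ℝ) : ‖zt t‖ = yt t := rfl

theorem hasDerivAt_zt (t : ℝ) : HasDerivAt zt (Complex.I * Complex.exp (Complex.I * t)) t := by
  have h0 : HasDerivAt (fun t : ℝ => (t : ℂ)) 1 t := Complex.ofRealCLM.hasDerivAt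
  exact (((h0.const_mul Complex.I).cexp).sub_const 1).congr_deriv (by ring)

theorem differentiable_zt : Differentiable ℝ zt := fun t => (hasDerivAt_zt t).differentiableAt

theorem jn_zt (t : ℝ) : jn zt t = 1001 / 1000 * yt t := by
  rw [jn_of_hasDerivAt (hasDerivAt_zt t), norm_zt, norm_mul, Complex.norm_I, norm_exp_I_mul]
  ring

theorem jn_const_mul {f : ℝ → ℂ} {t : ℝ} (hf : DifferentiableAt ℝ f t) (c : ℂ) :
    jn (fun t => c * f t) t = ‖c‖ * jn f t := by
  rw [jn_of_hasDerivAt (f := fun t => c * f t) (hf.hasDerivAt.const_mul c), jn, norm_mul, norm_mul]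
  ring

theorem jn_zt_pow_le (t : ℝ) (j : ℕ) : jn (fun t => zt t ^ j) t ≤ (1001 / 1000 * yt t) ^ j := by
  induction j with
  | zero => simp [jn_const]
  | succ j ih =>
    simp only [pow_succ]
    refine (jn_mul_le ((differentiable_zt t).fun_pow j) (differentiable_zt t)).trans ?_
    rw [jn_zt]
    have := yt_nonneg t
    gcongr

theorem jn_Z_le (k : ℕ) (ω : Ω) (t : ℝ) :
    jn (fun t => Z X t k ω) t ≤ 2 * (yt t * rv X k ω) := by
  rw [jn_of_hasDerivAt (hasDerivAt_Z k ω t), norm_deriv_Z, rv]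
  have h1 := norm_exp_sub_one_le t (X k ω)
  have h2 : (0 : ℝ) ≤ yt t * X k ω := mul_nonneg (yt_nonneg t) (Nat.cast_nonneg _)
  simp only [Z]
  linarith

theorem hasDerivAt_Z_sub (k : ℕ) (ω : Ω) (t : ℝ) :
    HasDerivAt (fun t => Z X t k ω - ((rv X k ω : ℝ) : ℂ) * zt t)
      (Complex.I * (X k ω : ℂ) * Complex.exp (Complex.I * t * (X k ω : ℂ)) -
        ((rv X k ω : ℝ) : ℂ) * (Complex.I * Complex.exp (Complex.I * t))) t :=
  (hasDerivAt_Z k ω t).fun_sub ((hasDerivAt_zt t).const_mul _)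

/-- With `w = e^{it}` and `X = m + 1` the derivative is `iXw(w^m - 1)`, which is bounded by `y
X(X-1)`; differentiation costs just one power of `y`. -/
theorem norm_deriv_Z_sub_le (k : ℕ) (ω : Ω) (t : ℝ) :
    ‖Complex.I * (X k ω : ℂ) * Complex.exp (Complex.I * t * (X k ω : ℂ)) -
        ((rv X k ω : ℝ) : ℂ) * (Complex.I * Complex.exp (Complex.I * t))‖ ≤ yt t * fac X 2 k ω := by
  rw [fac_two]
  simp only [rv]
  rw [exp_I_mul_nat]
  set w := Complex.exp (Complex.I * t) with hw
  rcases X k ω with _ | m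
  · simp
  · have e : Complex.I * ((m + 1 : ℕ) : ℂ) * w ^ (m + 1) - (((m + 1 : ℕ) : ℝ) : ℂ) * (Complex.I * w) =
        Complex.I * ((m + 1 : ℕ) : ℂ) * w * (w ^ m - 1) := by push_cast; ring
    rw [e, norm_mul, norm_mul, norm_mul, Complex.norm_I, Complex.norm_natCast, hw, norm_exp_I_mul,
      one_mul, mul_one]
    have := norm_pow_sub_one_le (norm_exp_I_mul t) m
    calc _ ≤ ((m + 1 : ℕ) : ℝ) * (m * ‖Complex.exp (Complex.I * t) - 1‖) := by gcongr
      _ = _ := by rw [yt]; push_cast; ring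

theorem jn_Z_sub_le (k : ℕ) (ω : Ω) (t : ℝ) :
    jn (fun t => Z X t k ω - ((rv X k ω : ℝ) : ℂ) * zt t) t ≤ yt t ^ 2 * fac X 2 k ω := by
  rw [jn_of_hasDerivAt (hasDerivAt_Z_sub k ω t)]
  have hy := yt_nonneg t
  have h1 := norm_deriv_Z_sub_le (X := X) k ω t
  have h2 := norm_pow_sub_linear_le (norm_exp_I_mul t) (X k ω)
  rw [← exp_I_mul_nat] at h2
  have h3 : ‖Z X t k ω - ((rv X k ω : ℝ) : ℂ) * zt t‖ ≤ yt t ^ 2 * fac X 2 k ω / 2 := by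
    refine le_trans (le_of_eq ?_) (h2.trans (le_of_eq ?_))
    · simp [Z, rv, zt]
    · rw [fac_two, rv, yt]; ring
  have h4 := mul_le_mul_of_nonneg_left h1 (by positivity : 0 ≤ yt t / 1000)
  have h5 : 0 ≤ yt t ^ 2 * fac X 2 k ω := mul_nonneg (by positivity) (fac_nonneg _ _ _)
  nlinarith

theorem hasDerivAt_Z_sub_sub (k : ℕ) (ω : Ω) (t : ℝ) :
    HasDerivAt (fun t => Z X t k ω - ((rv X k ω : ℝ) : ℂ) * zt t -
        ((fac X 2 k ω / 2 : ℝ) : ℂ) * zt t ^ 2)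
      (Complex.I * (X k ω : ℂ) * Complex.exp (Complex.I * t * (X k ω : ℂ)) -
        ((rv X k ω : ℝ) : ℂ) * (Complex.I * Complex.exp (Complex.I * t)) -
        ((fac X 2 k ω / 2 : ℝ) : ℂ) * (2 * zt t * (Complex.I * Complex.exp (Complex.I * t)))) t :=
  (hasDerivAt_Z_sub k ω t).fun_sub ((((hasDerivAt_zt t).fun_pow 2).congr_deriv (by
    push_cast; ring)).const_mul _)

theorem norm_deriv_Z_sub_sub_le (k : ℕ) (ω : Ω) (t : ℝ) :
    ‖Complex.I * (X k ω : ℂ) * Complex.exp (Complex.I * t * (X k ω : ℂ)) -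
        ((rv X k ω : ℝ) : ℂ) * (Complex.I * Complex.exp (Complex.I * t)) -
        ((fac X 2 k ω / 2 : ℝ) : ℂ) * (2 * zt t * (Complex.I * Complex.exp (Complex.I * t)))‖ ≤
      yt t ^ 2 * fac X 3 k ω := by
  rw [fac_two, fac_three]
  simp only [rv, zt]
  rw [exp_I_mul_nat]
  set w := Complex.exp (Complex.I * t) with hw
  rcases X k ω with _ | m
  · simp
  · have e : Complex.I * ((m + 1 : ℕ) : ℂ) * w ^ (m + 1) - (((m + 1 : ℕ) : ℝ) : ℂ) * (Complex.I * w) -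
        (((((m + 1 : ℕ) : ℝ) * (((m + 1 : ℕ) : ℝ) - 1) / 2 : ℝ)) : ℂ) *
          (2 * (w - 1) * (Complex.I * w)) =
        Complex.I * ((m + 1 : ℕ) : ℂ) * w * (w ^ m - 1 - m * (w - 1)) := by push_cast; ring
    rw [e, norm_mul, norm_mul, norm_mul, Complex.norm_I, Complex.norm_natCast, hw, norm_exp_I_mul,
      one_mul, mul_one]
    have h1 := norm_pow_sub_linear_le (norm_exp_I_mul t) m
    have h2 : 0 ≤ (m * (m - 1) / 2 : ℝ) * ‖Complex.exp (Complex.I * t) - 1‖ ^ 2 :=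
      (norm_nonneg _).trans h1
    calc _ ≤ ((m + 1 : ℕ) : ℝ) * ((m * (m - 1) / 2 : ℝ) * ‖Complex.exp (Complex.I * t) - 1‖ ^ 2) := by
          gcongr
      _ ≤ 2 * (((m + 1 : ℕ) : ℝ) *
          ((m * (m - 1) / 2 : ℝ) * ‖Complex.exp (Complex.I * t) - 1‖ ^ 2)) := by
          have : 0 ≤ ((m + 1 : ℕ) : ℝ) *
            ((m * (m - 1) / 2 : ℝ) * ‖Complex.exp (Complex.I * t) - 1‖ ^ 2) := by positivity
          linarith
      _ = _ := by rw [yt]; push_cast; ring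

theorem jn_Z_sub_sub_le (k : ℕ) (ω : Ω) (t : ℝ) :
    jn (fun t => Z X t k ω - ((rv X k ω : ℝ) : ℂ) * zt t -
      ((fac X 2 k ω / 2 : ℝ) : ℂ) * zt t ^ 2) t ≤ yt t ^ 3 * fac X 3 k ω := by
  rw [jn_of_hasDerivAt (hasDerivAt_Z_sub_sub k ω t)]
  have hy := yt_nonneg t
  have h1 := norm_deriv_Z_sub_sub_le (X := X) k ω t
  have h2 := norm_pow_sub_quadratic_le (norm_exp_I_mul t) (X k ω)
  rw [← exp_I_mul_nat] at h2
  have h3 : ‖Z X t k ω - ((rv X k ω : ℝ) : ℂ) * zt t - ((fac X 2 k ω / 2 : ℝ) : ℂ) * zt t ^ 2‖ ≤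
      yt t ^ 3 * fac X 3 k ω / 6 := by
    refine le_trans (le_of_eq ?_) (h2.trans (le_of_eq ?_))
    · rw [fac_two]; simp [Z, rv, zt]
    · rw [fac_three, rv, yt]; ring
  have h4 := mul_le_mul_of_nonneg_left h1 (by positivity : 0 ≤ yt t / 1000)
  have h5 : 0 ≤ yt t ^ 3 * fac X 3 k ω := mul_nonneg (by positivity) (fac_nonneg _ _ _)
  nlinarith

theorem Regular.measurable_fun (H : Regular P X n) {k : ℕ} (hk : k ≤ n) (u : ℕ → ℂ) :
    Measurable fun ω => u (X k ω) := H.measurable_comp hk u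

theorem Regular.integrable_Z (H : Regular P X n) {k : ℕ} (hk : k ≤ n) (t : ℝ) :
    Integrable (fun ω => Z X t k ω) P := by
  simpa using H.integrable_prod_Z t (I := ∅) (J := {k}) (by simp) (by simpa using hk)

theorem MZ_self (k : ℕ) (t : ℝ) : MZ P X k k t = ∫ ω, Z X t k ω ∂P := by simp [MZ]

theorem Regular.MZ_self_sub_eq (H : Regular P X n) {k : ℕ} (hk : k ≤ n) (t : ℝ) :
    MZ P X k k t - nu P X 1 k * zt t =
      ∫ ω, (Z X t k ω - ((rv X k ω : ℝ) : ℂ) * zt t) ∂P := by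
  have hX : Integrable (fun ω => ((rv X k ω : ℝ) : ℂ) * zt t) P :=
    (H.integrable_rv hk).ofReal.mul_const _
  rw [integral_sub (H.integrable_Z hk t) hX, integral_mul_const, MZ_self, nu_one, integral_complex_ofReal]

theorem Regular.jn_MZ_self_sub_le (H : Regular P X n) {k : ℕ} (hk : k ≤ n) (t : ℝ) :
    jn (fun t => MZ P X k k t - nu P X 1 k * zt t) t ≤ yt t ^ 2 * nu P X 2 k := by
  rw [funext fun t => H.MZ_self_sub_eq hk t, nu, ← integral_const_mul]
  have hf := H.integrable_fac (j := 2) (by norm_num) hk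
  refine (differentiable_integral (P := P) (h := fun ω t => Z X t k ω - ((rv X k ω : ℝ) : ℂ) * zt t)
    (h' := fun ω t => Complex.I * (X k ω : ℂ) * Complex.exp (Complex.I * t * (X k ω : ℂ)) -
        ((rv X k ω : ℝ) : ℂ) * (Complex.I * Complex.exp (Complex.I * t)))
    (B := fun ω => 2 * fac X 2 k ω) (fun t => (H.integrable_Z hk t).sub
      ((H.integrable_rv hk).ofReal.mul_const _)) (fun t => ?_)
    (fun ω t => hasDerivAt_Z_sub k ω t) (fun ω t => ?_) (hf.const_mul 2)).2 t _
    (hf.const_mul _) fun ω => ?_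
  · exact (H.measurable_fun hk fun m => Complex.I * (m : ℂ) *
      Complex.exp (Complex.I * t * (m : ℂ)) -
        (((m : ℝ)) : ℂ) * (Complex.I * Complex.exp (Complex.I * t))).aestronglyMeasurable
  · exact (norm_deriv_Z_sub_le k ω t).trans
      (mul_le_mul_of_nonneg_right (yt_le_two t) (fac_nonneg _ _ _))
  · exact (jn_of_hasDerivAt (hasDerivAt_Z_sub k ω t)).symm.le.trans (jn_Z_sub_le k ω t)

theorem Regular.jn_MZ_self_sub_sub_le (H : Regular P X n) {k : ℕ} (hk : k ≤ n) (t : ℝ) :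
    jn (fun t => MZ P X k k t - nu P X 1 k * zt t - ((nu P X 2 k / 2 : ℝ) : ℂ) * zt t ^ 2) t ≤
      yt t ^ 3 * nu P X 3 k := by
  have hf2 := H.integrable_fac (j := 2) (by norm_num) hk
  have hf := H.integrable_fac (j := 3) (by norm_num) hk
  have hi : ∀ t, Integrable (fun ω => Z X t k ω - ((rv X k ω : ℝ) : ℂ) * zt t) P := fun t =>
    (H.integrable_Z hk t).sub ((H.integrable_rv hk).ofReal.mul_const _)
  have hi2 : ∀ t, Integrable (fun ω => ((fac X 2 k ω / 2 : ℝ) : ℂ) * zt t ^ 2) P := fun t =>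
    (hf2.div_const 2).ofReal.mul_const _
  have e : (fun t => MZ P X k k t - nu P X 1 k * zt t - ((nu P X 2 k / 2 : ℝ) : ℂ) * zt t ^ 2) =
      fun t => ∫ ω, (Z X t k ω - ((rv X k ω : ℝ) : ℂ) * zt t -
        ((fac X 2 k ω / 2 : ℝ) : ℂ) * zt t ^ 2) ∂P := by
    funext t
    rw [integral_sub (hi t) (hi2 t), ← H.MZ_self_sub_eq hk t, integral_mul_const,
      integral_complex_ofReal, integral_div]
    rfl
  rw [e, nu, ← integral_const_mul]
  refine (differentiable_integral (P := P) (h := fun ω t => Z X t k ω - ((rv X k ω : ℝ) : ℂ) * zt t -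
        ((fac X 2 k ω / 2 : ℝ) : ℂ) * zt t ^ 2)
    (h' := fun ω t => Complex.I * (X k ω : ℂ) * Complex.exp (Complex.I * t * (X k ω : ℂ)) -
        ((rv X k ω : ℝ) : ℂ) * (Complex.I * Complex.exp (Complex.I * t)) -
        ((fac X 2 k ω / 2 : ℝ) : ℂ) * (2 * zt t * (Complex.I * Complex.exp (Complex.I * t))))
    (B := fun ω => 4 * fac X 3 k ω) (fun t => (hi t).sub (hi2 t)) (fun t => ?_)
    (fun ω t => hasDerivAt_Z_sub_sub k ω t) (fun ω t => ?_) (hf.const_mul 4)).2 t _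
    (hf.const_mul _) fun ω => ?_
  · exact (H.measurable_fun hk fun m => Complex.I * (m : ℂ) *
      Complex.exp (Complex.I * t * (m : ℂ)) -
        (((m : ℝ)) : ℂ) * (Complex.I * Complex.exp (Complex.I * t)) -
        (((m.descFactorial 2 : ℝ) / 2 : ℝ) : ℂ) *
          (2 * zt t * (Complex.I * Complex.exp (Complex.I * t)))).aestronglyMeasurable
  · refine (norm_deriv_Z_sub_sub_le k ω t).trans
      (mul_le_mul_of_nonneg_right ?_ (fac_nonneg _ _ _))
    nlinarith [yt_le_two t, yt_nonneg t]
  · exact (jn_of_hasDerivAt (hasDerivAt_Z_sub_sub k ω t)).symm.le.trans (jn_Z_sub_sub_le k ω t)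

/-- `E X_{k-1} (X_{k-1} - 1) X_k`. -/
def momA (P : Measure Ω) (X : ℕ → Ω → ℕ) (k : ℕ) : ℝ := ∫ ω, fac X 2 (k - 1) ω * rv X k ω ∂P

/-- `E X_{k-1} X_k (X_k - 1)`. -/
def momB (P : Measure Ω) (X : ℕ → Ω → ℕ) (k : ℕ) : ℝ := ∫ ω, rv X (k - 1) ω * fac X 2 k ω ∂P

theorem momA_nonneg (k : ℕ) : 0 ≤ momA P X k :=
  integral_nonneg fun ω => mul_nonneg (fac_nonneg _ _ ω) (rv_nonneg _ ω)

theorem momB_nonneg (k : ℕ) : 0 ≤ momB P X k :=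
  integral_nonneg fun ω => mul_nonneg (rv_nonneg _ ω) (fac_nonneg _ _ ω)

theorem Regular.jn_MZ_pair_sub_le (H : Regular P X n) {k : ℕ} (hk0 : 1 ≤ k) (hk : k ≤ n) (t : ℝ) :
    jn (fun t => MZ P X (k - 1) k t - mom2 P X k * zt t ^ 2) t ≤
      4 * (yt t ^ 3 * (momA P X k + momB P X k)) := by
  have hk1 : k - 1 ≤ n := by omega
  have hy := yt_nonneg t
  have hA := H.integrable_fac_two_mul_rv hk1 hk
  have hB : Integrable (fun ω => rv X (k - 1) ω * fac X 2 k ω) P := by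
    simpa only [mul_comm] using H.integrable_fac_two_mul_rv hk hk1
  have hX := H.integrable_rv_mul hk1 hk
  have hZZ : ∀ t, Integrable (fun ω => Z X t (k - 1) ω * Z X t k ω) P := by
    intro t
    have := H.integrable_prod_Z t (I := ∅) (J := Finset.Icc (k - 1) k) (by simp)
      (fun l hl => by simp only [Finset.mem_Icc] at hl; omega)
    obtain ⟨k, rfl⟩ := Nat.exists_eq_add_of_le' hk0
    simpa [Finset.prod_Icc_succ_top] using this
  have hXz : ∀ t, Integrable (fun ω => ((rv X (k - 1) ω * rv X k ω : ℝ) : ℂ) * zt t ^ 2) P :=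
    fun t => hX.ofReal.mul_const _
  have e : (fun t => MZ P X (k - 1) k t - mom2 P X k * zt t ^ 2) = fun t =>
      ∫ ω, (Z X t (k - 1) ω * Z X t k ω - ((rv X (k - 1) ω * rv X k ω : ℝ) : ℂ) * zt t ^ 2) ∂P := by
    funext t
    rw [integral_sub (hZZ t) (hXz t), integral_mul_const, integral_complex_ofReal, mom2]
    congr 1
    obtain ⟨k, rfl⟩ := Nat.exists_eq_add_of_le' hk0
    simp [MZ, Finset.prod_Icc_succ_top]
  rw [e, momA, momB, ← integral_add hA hB, ← integral_const_mul, ← integral_const_mul]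
  have hd : ∀ (ω : Ω) (t : ℝ), HasDerivAt (fun t => Z X t (k - 1) ω * Z X t k ω -
      ((rv X (k - 1) ω * rv X k ω : ℝ) : ℂ) * zt t ^ 2)
      (Complex.I * (X (k - 1) ω : ℂ) * Complex.exp (Complex.I * t * (X (k - 1) ω : ℂ)) * Z X t k ω +
        Z X t (k - 1) ω * (Complex.I * (X k ω : ℂ) * Complex.exp (Complex.I * t * (X k ω : ℂ))) -
        ((rv X (k - 1) ω * rv X k ω : ℝ) : ℂ) *
          (2 * zt t * (Complex.I * Complex.exp (Complex.I * t)))) t := fun ω t =>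
    ((hasDerivAt_Z (k - 1) ω t).fun_mul (hasDerivAt_Z k ω t)).fun_sub
      ((((hasDerivAt_zt t).fun_pow 2).congr_deriv (by push_cast; ring)).const_mul _)
  refine (differentiable_integral (P := P)
    (B := fun ω => 2 * rv X (k - 1) ω + 2 * rv X k ω + 4 * (rv X (k - 1) ω * rv X k ω))
    (fun t => (hZZ t).sub (hXz t)) (fun t => ?_) hd (fun ω t => ?_) ?_).2 t _
    (((hA.add hB).const_mul _).const_mul _) fun ω => ?_
  · refine Measurable.aestronglyMeasurable (Measurable.sub (Measurable.add
      (Measurable.mul ?_ (H.measurable_Z t hk)) (Measurable.mul (H.measurable_Z t hk1) ?_))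
      (Measurable.mul ?_ measurable_const))
    · exact H.measurable_fun hk1 fun m => Complex.I * (m : ℂ) * Complex.exp (Complex.I * t * (m : ℂ))
    · exact H.measurable_fun hk fun m => Complex.I * (m : ℂ) * Complex.exp (Complex.I * t * (m : ℂ))
    · exact Complex.measurable_ofReal.comp ((H.measurable_comp hk1 fun m => (m : ℝ)).mul
        (H.measurable_comp hk fun m => (m : ℝ)))
  · refine (norm_sub_le _ _).trans (add_le_add ((norm_add_le _ _).trans (add_le_add ?_ ?_)) ?_)
    · rw [norm_mul, norm_deriv_Z, mul_comm]
      exact mul_le_mul_of_nonneg_right (norm_Z_le_two t k ω) (rv_nonneg _ _)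
    · rw [norm_mul, norm_deriv_Z]
      exact mul_le_mul_of_nonneg_right (norm_Z_le_two t (k - 1) ω) (rv_nonneg _ _)
    · rw [norm_mul, norm_mul, norm_mul, norm_mul, Complex.norm_I, norm_exp_I_mul, norm_zt,
        Complex.norm_real, Real.norm_of_nonneg (mul_nonneg (rv_nonneg _ _) (rv_nonneg _ _)), mul_comm]
      refine mul_le_mul_of_nonneg_right ?_ (mul_nonneg (rv_nonneg _ _) (rv_nonneg _ _))
      rw [Complex.norm_ofNat]
      linarith [yt_le_two t]
  · exact (((H.integrable_rv hk1).const_mul 2).add ((H.integrable_rv hk).const_mul 2)).add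
      (hX.const_mul 4)
  · refine (jn_of_hasDerivAt (hd ω t)).symm.le.trans ?_
    -- Replacing one factor at a time by its linear part puts a second factorial power on exactly
    -- one of the two variables.
    have e2 : (fun t => Z X t (k - 1) ω * Z X t k ω -
        ((rv X (k - 1) ω * rv X k ω : ℝ) : ℂ) * zt t ^ 2) = fun t =>
        (Z X t (k - 1) ω - ((rv X (k - 1) ω : ℝ) : ℂ) * zt t) * Z X t k ω +
        ((rv X (k - 1) ω : ℝ) : ℂ) * (zt t * (Z X t k ω - ((rv X k ω : ℝ) : ℂ) * zt t)) := by
      funext t; push_cast; ring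
    rw [e2]
    have d1 := (hasDerivAt_Z_sub (X := X) (k - 1) ω t).differentiableAt
    have d2 := (hasDerivAt_Z_sub (X := X) k ω t).differentiableAt
    have d3 := (hasDerivAt_Z (X := X) k ω t).differentiableAt
    have d4 := differentiable_zt t
    refine (jn_add_le (d1.fun_mul d3) ((d4.fun_mul d2).const_mul _)).trans ?_
    rw [jn_const_mul (d4.fun_mul d2), Complex.norm_real, Real.norm_of_nonneg (rv_nonneg _ _)]
    have a1 := jn_Z_sub_le (X := X) (k - 1) ω t
    have a2 := jn_Z_le (X := X) k ω t
    have a3 := jn_Z_sub_le (X := X) k ω t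
    have f1 := fac_nonneg (X := X) 2 (k - 1) ω
    have f2 := fac_nonneg (X := X) 2 k ω
    have g1 := rv_nonneg (X := X) (k - 1) ω
    have g2 := rv_nonneg (X := X) k ω
    calc _ ≤ yt t ^ 2 * fac X 2 (k - 1) ω * (2 * (yt t * rv X k ω)) +
          rv X (k - 1) ω * (1001 / 1000 * yt t * (yt t ^ 2 * fac X 2 k ω)) := by
          gcongr
          · exact (jn_mul_le d1 d3).trans (mul_le_mul a1 a2 (jn_nonneg _ _) (by positivity))
          · refine (jn_mul_le d4 d2).trans ?_
            rw [jn_zt]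
            exact mul_le_mul_of_nonneg_left a3 (by positivity)
      _ ≤ _ := by
          have h1 : 0 ≤ yt t ^ 3 * (fac X 2 (k - 1) ω * rv X k ω) := by positivity
          have h2 : 0 ≤ yt t ^ 3 * (rv X (k - 1) ω * fac X 2 k ω) := by positivity
          nlinarith

/-! ### Taylor expansions of exponentials -/

theorem jn_exp_sub_linear_le {u : ℝ → ℂ} {t : ℝ} (hu : DifferentiableAt ℝ u t) (h1 : ‖u t‖ ≤ 1) :
    jn (fun t => Complex.exp (u t) - 1 - u t) t ≤ jn u t ^ 2 := by
  have hd : HasDerivAt (fun t => Complex.exp (u t) - 1 - u t)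
      (Complex.exp (u t) * deriv u t - deriv u t) t :=
    (hu.hasDerivAt.cexp.sub_const 1).fun_sub hu.hasDerivAt
  rw [jn_of_hasDerivAt hd]
  have e : Complex.exp (u t) * deriv u t - deriv u t = (Complex.exp (u t) - 1) * deriv u t := by ring
  have hy := yt_nonneg t
  have a1 := Complex.norm_exp_sub_one_sub_id_le h1
  have a2 := Complex.norm_exp_sub_one_le h1
  rw [e, norm_mul, jn]
  calc _ ≤ ‖u t‖ ^ 2 + yt t / 1000 * (2 * ‖u t‖ * ‖deriv u t‖) := by gcongr
    _ ≤ _ := by nlinarith [sq_nonneg (yt t / 1000 * ‖deriv u t‖)]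

theorem norm_exp_sub_quadratic_le {x : ℂ} (h : ‖x‖ ≤ 1) :
    ‖Complex.exp x - 1 - x - x ^ 2 / 2‖ ≤ ‖x‖ ^ 3 := by
  have h1 := Complex.exp_bound h (n := 3) (by norm_num)
  have e : Complex.exp x - ∑ m ∈ Finset.range 3, x ^ m / (m.factorial : ℂ) =
      Complex.exp x - 1 - x - x ^ 2 / 2 := by
    simp [Finset.sum_range_succ, Nat.factorial]
    ring
  rw [e] at h1
  refine h1.trans (mul_le_of_le_one_right (by positivity) ?_)
  norm_num [Nat.factorial]

theorem jn_exp_sub_quadratic_le {u : ℝ → ℂ} {t : ℝ} (hu : DifferentiableAt ℝ u t)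
    (h1 : ‖u t‖ ≤ 1) :
    jn (fun t => Complex.exp (u t) - 1 - u t - u t ^ 2 / 2) t ≤ jn u t ^ 3 := by
  have hd : HasDerivAt (fun t => Complex.exp (u t) - 1 - u t - u t ^ 2 / 2)
      (Complex.exp (u t) * deriv u t - deriv u t - (2 * u t * deriv u t) / 2) t :=
    ((hu.hasDerivAt.cexp.sub_const 1).fun_sub hu.hasDerivAt).fun_sub
      (((hu.hasDerivAt.fun_pow 2).congr_deriv (by push_cast; ring)).div_const 2)
  rw [jn_of_hasDerivAt hd]
  have e : Complex.exp (u t) * deriv u t - deriv u t - (2 * u t * deriv u t) / 2 =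
      (Complex.exp (u t) - 1 - u t) * deriv u t := by ring
  have hy := yt_nonneg t
  have a1 := Complex.norm_exp_sub_one_sub_id_le h1
  have a2 := norm_exp_sub_quadratic_le h1
  rw [e, norm_mul, jn]
  have hx := norm_nonneg (u t)
  have hp : 0 ≤ yt t / 1000 * ‖deriv u t‖ := by positivity
  calc _ ≤ ‖u t‖ ^ 3 + yt t / 1000 * (‖u t‖ ^ 2 * ‖deriv u t‖) := by gcongr
    _ = ‖u t‖ ^ 3 + ‖u t‖ ^ 2 * (yt t / 1000 * ‖deriv u t‖) := by ring
    _ ≤ _ := by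
      set a := ‖u t‖
      set b := yt t / 1000 * ‖deriv u t‖
      have : (a + b) ^ 3 = a ^ 3 + a ^ 2 * b + (2 * a ^ 2 * b + 3 * a * b ^ 2 + b ^ 3) := by ring
      have : 0 ≤ 2 * a ^ 2 * b + 3 * a * b ^ 2 + b ^ 3 := by positivity
      linarith

end

section

variable {Ω : Type*} [MeasurableSpace Ω] {P : Measure Ω} [IsProbabilityMeasure P]
  {X : ℕ → Ω → ℕ} {n : ℕ}

/-! ### The summands of the remainder terms -/

theorem wE_pair (f g : Ω → ℝ) :
    wE P [f, g] = (∫ ω, f ω * g ω ∂P) - (∫ ω, f ω ∂P) * ∫ ω, g ω ∂P := by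
  have h1 : wE P [f] = ∫ ω, f ω ∂P := by rw [wE]; simp
  rw [wE]
  simp [h1]

theorem wEPlus_single (f : Ω → ℝ) : wEPlus P [f] = ∫ ω, f ω ∂P := by rw [wEPlus]; simp

theorem wEPlus_pair (f g : Ω → ℝ) :
    wEPlus P [f, g] = (∫ ω, f ω * g ω ∂P) + (∫ ω, f ω ∂P) * ∫ ω, g ω ∂P := by
  rw [wEPlus]
  simp [wEPlus_single]

theorem wEPlus_triple (f g h : Ω → ℝ) :
    wEPlus P [f, g, h] = (∫ ω, f ω * g ω * h ω ∂P) + (∫ ω, f ω ∂P) * (∫ ω, g ω * h ω ∂P) +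
      ((∫ ω, f ω * g ω ∂P) + (∫ ω, f ω ∂P) * ∫ ω, g ω ∂P) * ∫ ω, h ω ∂P := by
  rw [wEPlus]
  simp [Fin.sum_univ_two, wEPlus_pair, wEPlus_single, mul_assoc, add_assoc]

/-- The `k`-th summand of `R0`. -/
def r0 (P : Measure Ω) (X : ℕ → Ω → ℕ) (k : ℕ) : ℝ := nu P X 2 k + nu P X 1 k ^ 2 + mom2 P X k

/-- The `k`-th summand of `R1`. -/
def r1 (P : Measure Ω) (X : ℕ → Ω → ℕ) (k : ℕ) : ℝ :=
  nu P X 1 k ^ 3 + nu P X 1 k * nu P X 2 k + nu P X 3 k +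
    (nu P X 1 (k - 2) + nu P X 1 (k - 1) + nu P X 1 k) * mom2 P X k +
    wEPlus2 P X k + wEPlus P [rv X (k - 2), rv X (k - 1), rv X k]

theorem r1_eq (k : ℕ) : r1 P X k =
    nu P X 1 k ^ 3 + nu P X 1 k * nu P X 2 k + nu P X 3 k +
    (nu P X 1 (k - 2) + nu P X 1 (k - 1) + nu P X 1 k) * mom2 P X k +
    (momA P X k + nu P X 2 (k - 1) * nu P X 1 k + (momB P X k + nu P X 1 (k - 1) * nu P X 2 k)) +
    (mom3 P X k + nu P X 1 (k - 2) * mom2 P X k +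
      (mom2 P X (k - 1) + nu P X 1 (k - 2) * nu P X 1 (k - 1)) * nu P X 1 k) := by
  rw [r1, wEPlus2, wEPlus_pair, wEPlus_pair, wEPlus_triple]
  simp only [nu, momA, momB, mom3, mom2, fac_one, Nat.sub_sub]

theorem r0_nonneg (k : ℕ) : 0 ≤ r0 P X k := by
  have := nu_nonneg (P := P) (X := X) 2 k
  have := mom2_nonneg (P := P) (X := X) k
  rw [r0]; positivity

theorem Regular.r0_zero (H : Regular P X n) : r0 P X 0 = 0 := by
  simp [r0, H.nu_zero, H.mom2_zero]

theorem Regular.r1_zero (H : Regular P X n) : r1 P X 0 = 0 := by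
  simp [r1_eq, H.nu_zero, H.mom2_zero, H.mom3_zero, momA, momB, H.rv_zero]

/-- All summands are nonnegative, so each is dominated by the whole. Collected once, to serve as the
list of third order quantities that `R1` can absorb. -/
theorem r1_bounds (k : ℕ) :
    0 ≤ r1 P X k ∧ nu P X 1 k ^ 3 ≤ r1 P X k ∧ nu P X 1 k * nu P X 2 k ≤ r1 P X k ∧
    nu P X 3 k ≤ r1 P X k ∧ nu P X 1 (k - 2) * mom2 P X k ≤ r1 P X k ∧
    nu P X 1 (k - 1) * mom2 P X k ≤ r1 P X k ∧ nu P X 1 k * mom2 P X k ≤ r1 P X k ∧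
    momA P X k + momB P X k ≤ r1 P X k ∧ nu P X 2 (k - 1) * nu P X 1 k ≤ r1 P X k ∧
    nu P X 1 (k - 1) * nu P X 2 k ≤ r1 P X k ∧ mom3 P X k ≤ r1 P X k ∧
    mom2 P X (k - 1) * nu P X 1 k ≤ r1 P X k := by
  have n1 := nu_nonneg (P := P) (X := X) 1 k
  have n2 := nu_nonneg (P := P) (X := X) 2 k
  have n3 := nu_nonneg (P := P) (X := X) 3 k
  have n1' := nu_nonneg (P := P) (X := X) 1 (k - 1)
  have n2' := nu_nonneg (P := P) (X := X) 2 (k - 1)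
  have n1'' := nu_nonneg (P := P) (X := X) 1 (k - 2)
  have m := mom2_nonneg (P := P) (X := X) k
  have m' := mom2_nonneg (P := P) (X := X) (k - 1)
  have m3 := mom3_nonneg (P := P) (X := X) k
  have a := momA_nonneg (P := P) (X := X) k
  have b := momB_nonneg (P := P) (X := X) k
  have t1 : 0 ≤ nu P X 1 k ^ 3 := by positivity
  have t2 := mul_nonneg n1 n2
  have t3 := mul_nonneg n1'' m
  have t4 := mul_nonneg n1' m
  have t5 := mul_nonneg n1 m
  have t6 := mul_nonneg n2' n1
  have t7 := mul_nonneg n1' n2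
  have t8 := mul_nonneg m' n1
  have t9 := mul_nonneg (mul_nonneg n1'' n1') n1
  have e := r1_eq (P := P) (X := X) k
  have e' : r1 P X k = nu P X 1 k ^ 3 + nu P X 1 k * nu P X 2 k + nu P X 3 k +
      nu P X 1 (k - 2) * mom2 P X k + nu P X 1 (k - 1) * mom2 P X k + nu P X 1 k * mom2 P X k +
      momA P X k + nu P X 2 (k - 1) * nu P X 1 k + momB P X k + nu P X 1 (k - 1) * nu P X 2 k +
      mom3 P X k + nu P X 1 (k - 2) * mom2 P X k + mom2 P X (k - 1) * nu P X 1 k +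
      nu P X 1 (k - 2) * nu P X 1 (k - 1) * nu P X 1 k := by rw [e]; ring
  refine ⟨?_, ?_, ?_, ?_, ?_, ?_, ?_, ?_, ?_, ?_, ?_, ?_⟩ <;> linarith

theorem r1_nonneg (k : ℕ) : 0 ≤ r1 P X k := r1_bounds k |>.1

/-- Three consecutive summands. -/
def sh (r : ℕ → ℝ) (k : ℕ) : ℝ := r k + r (k - 1) + r (k - 2)

/-- Truncated subtraction sends the small indices to `r 0 = 0`, so a shift only loses terms. Shifts
arise because `φ_k` depends on the moments at `k - 1` and `k - 2`. -/
theorem sum_shift_le {r : ℕ → ℝ} (h0 : r 0 = 0) (hr : ∀ k, 0 ≤ r k) (d n : ℕ) :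
    ∑ k ∈ Finset.Icc 1 n, r (k - d) ≤ ∑ k ∈ Finset.Icc 1 n, r k := by
  induction d with
  | zero => simp
  | succ d ih =>
    refine le_trans ?_ ih
    have e : ∀ m, ∑ k ∈ Finset.Icc 1 m, r (k - (d + 1)) + r (m - d) = ∑ k ∈ Finset.Icc 1 m, r (k - d) := by
      intro m
      induction m with
      | zero => simp [h0]
      | succ m ihm =>
        rw [Finset.sum_Icc_succ_top (by omega), Finset.sum_Icc_succ_top (by omega), ← ihm,
          show m + 1 - (d + 1) = m - d by omega]
    linarith [e n, hr (n - d)]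

theorem sum_sh_le {r : ℕ → ℝ} (h0 : r 0 = 0) (hr : ∀ k, 0 ≤ r k) (n : ℕ) :
    ∑ k ∈ Finset.Icc 1 n, sh r k ≤ 3 * ∑ k ∈ Finset.Icc 1 n, r k := by
  have h1 := sum_shift_le h0 hr 1 n
  have h2 := sum_shift_le h0 hr 2 n
  simp only [sh, Finset.sum_add_distrib]
  linarith

theorem mul_mul_le_cubes {a b c : ℝ} (ha : 0 ≤ a) (hb : 0 ≤ b) (hc : 0 ≤ c) :
    a * b * c ≤ a ^ 3 + b ^ 3 + c ^ 3 := by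
  have h : 0 ≤ (a + b + c) * ((a - b) ^ 2 + (b - c) ^ 2 + (a - c) ^ 2) := by positivity
  have : 0 ≤ a ^ 3 := by positivity
  have : 0 ≤ b ^ 3 := by positivity
  have : 0 ≤ c ^ 3 := by positivity
  nlinarith

theorem sq_add_four_le (a b c d : ℝ) :
    (a + b + c + d) ^ 2 ≤ 4 * (a ^ 2 + b ^ 2 + c ^ 2 + d ^ 2) := by
  nlinarith [sq_nonneg (a - b), sq_nonneg (a - c), sq_nonneg (a - d), sq_nonneg (b - c),
    sq_nonneg (b - d), sq_nonneg (c - d)]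

/-! ### The Poisson factors -/

theorem Regular.nu_one_le (H : Regular P X n) {k : ℕ} (hk : k ≤ n) : nu P X 1 k ≤ 1 / 100 :=
  H.nu1 k hk

theorem psi_eq (t : ℝ) (k : ℕ) : psi P X t k = Complex.exp ((nu P X 1 k : ℂ) * zt t) := rfl

theorem differentiable_psi (k : ℕ) : Differentiable ℝ fun t => psi P X t k :=
  fun t => (((hasDerivAt_zt t).const_mul _).cexp).differentiableAt

theorem Regular.jn_psi_sub_le (H : Regular P X n) {k : ℕ} (hk : k ≤ n) (t : ℝ) :
    jn (fun t => psi P X t k - 1 - nu P X 1 k * zt t) t ≤ (1001 / 1000 * (yt t * nu P X 1 k)) ^ 2 := by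
  have hV := nu_nonneg (P := P) (X := X) 1 k
  have hV1 := H.nu_one_le hk
  have hd : DifferentiableAt ℝ (fun t => (nu P X 1 k : ℂ) * zt t) t :=
    (differentiable_zt t).const_mul _
  refine (jn_exp_sub_linear_le hd ?_).trans (le_of_eq ?_)
  · rw [norm_mul, Complex.norm_real, Real.norm_of_nonneg hV, norm_zt]
    nlinarith [yt_le_two t, yt_nonneg t]
  · rw [jn_const_mul (differentiable_zt t), jn_zt, Complex.norm_real, Real.norm_of_nonneg hV]
    ring

/-- Both factors have the linear part `ν_1(k)(e^{it} - 1)`; what is left on either side is of second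
order. -/
theorem Regular.jn_ratio_sub_psi_le (H : Regular P X n) {k : ℕ} (hk : k ≤ n) (t : ℝ) :
    jn (fun t => ratio P X k t - psi P X t k) t ≤ 1000 * (yt t ^ 2 * sh (r0 P X) k) := by
  have e : (fun t => ratio P X k t - psi P X t k) = fun t =>
      ((ratio P X k t - 1 - MZ P X k k t) + (MZ P X k k t - nu P X 1 k * zt t)) -
        (psi P X t k - 1 - nu P X 1 k * zt t) := by funext t; ring
  have d1 := H.differentiable_ratio hk t
  have d2 := H.differentiable_MZ (j := k) hk t
  have d3 := (differentiable_zt t).const_mul (nu P X 1 k : ℂ)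
  have d4 := differentiable_psi (P := P) (X := X) k t
  have y0 := yt_nonneg t
  have y2 := yt_le_two t
  have V0 := nu_nonneg (P := P) (X := X) 1 k
  have V0' := nu_nonneg (P := P) (X := X) 1 (k - 1)
  have V1 := H.nu_one_le hk
  have m0 := mom2_nonneg (P := P) (X := X) k
  have m0' := mom2_nonneg (P := P) (X := X) (k - 1)
  have m0'' := mom2_nonneg (P := P) (X := X) (k - 2)
  have n2 := nu_nonneg (P := P) (X := X) 2 k
  have n2' := nu_nonneg (P := P) (X := X) 2 (k - 1)
  have r0'' := r0_nonneg (P := P) (X := X) (k - 2)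
  have h1 := H.jn_ratio_sub_mean_le t hk
  have h2 := H.jn_ratio_sub_one_le' t (k := k - 1) (by omega)
  have h3 := H.headBlk_le_mom2 t hk
  have h4 := H.headBlk_le_mom2 t (k := k - 1) (by omega)
  rw [show k - 1 - 1 = k - 2 by omega] at h4
  have h5 := H.jn_MZ_self_sub_le hk t
  have h6 := H.jn_psi_sub_le hk t
  rw [e]
  refine (jn_sub_le (((d1.sub_const 1).fun_sub d2).fun_add (d2.fun_sub d3))
    ((d4.sub_const 1).fun_sub d3)).trans ?_
  refine (add_le_add (jn_add_le ((d1.sub_const 1).fun_sub d2) (d2.fun_sub d3)) le_rfl).trans ?_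
  set y := yt t
  set V := nu P X 1 k
  set V' := nu P X 1 (k - 1)
  set m := mom2 P X k
  set m' := mom2 P X (k - 1)
  set m'' := mom2 P X (k - 2)
  have hyV : y * V ≤ 1 / 50 := by nlinarith
  have h7 : 2 * (y * V) * jn (fun t => ratio P X (k - 1) t - 1) t ≤
      2 * (y * V) * (200 * (y * V' + y ^ 2 * m' + 2 * (y ^ 2 * m''))) := by
    gcongr; linarith
  have h8 : 2 * (y * V) * (200 * (y * V' + y ^ 2 * m' + 2 * (y ^ 2 * m''))) =
      y ^ 2 * (400 * (V * V') + 400 * (y * V) * m' + 800 * (y * V) * m'') := by ring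
  have h9 : 400 * (V * V') + 400 * (y * V) * m' + 800 * (y * V) * m'' ≤
      -- AM-GM for `V V'`; in the other two terms `y V ≤ 1/50` disposes of the surplus factor.
      200 * V ^ 2 + 200 * V' ^ 2 + 8 * m' + 16 * m'' := by
    nlinarith [sq_nonneg (V - V'), mul_le_mul_of_nonneg_right hyV m0', mul_le_mul_of_nonneg_right hyV m0'']
  have h10 := mul_le_mul_of_nonneg_left h9 (by positivity : 0 ≤ y ^ 2)
  have h11 : sh (r0 P X) k = (nu P X 2 k + V ^ 2 + m) + (nu P X 2 (k - 1) + V' ^ 2 + m') +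
      r0 P X (k - 2) := rfl
  have h12 : m'' ≤ r0 P X (k - 2) := by
    have a1 := nu_nonneg (P := P) (X := X) 2 (k - 2)
    have a2 := sq_nonneg (nu P X 1 (k - 2))
    have a3 : r0 P X (k - 2) = nu P X 2 (k - 2) + nu P X 1 (k - 2) ^ 2 + m'' := rfl
    linarith
  have h13 : y ^ 2 * (200 * V ^ 2 + 200 * V' ^ 2 + 8 * m' + 16 * m'') + 200 * (y ^ 2 * m + 2 * (y ^ 2 * m')) +
      y ^ 2 * nu P X 2 k + (1001 / 1000 * (y * V)) ^ 2 =
      y ^ 2 * ((200 + (1001 / 1000) ^ 2) * V ^ 2 + 200 * V' ^ 2 + 408 * m' + 16 * m'' + 200 * m + nu P X 2 k) := by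
    ring
  have h14 : (200 + (1001 / 1000) ^ 2) * V ^ 2 + 200 * V' ^ 2 + 408 * m' + 16 * m'' + 200 * m + nu P X 2 k ≤
      1000 * sh (r0 P X) k := by
    rw [h11]; nlinarith [sq_nonneg V, sq_nonneg V']
  have h15 := mul_le_mul_of_nonneg_left h14 (by positivity : 0 ≤ y ^ 2)
  linarith

/-! ### The factors with a second order correction -/

/-- The coefficient of `(e^{it} - 1)²` in the exponent of `g_k`. -/
def qk (P : Measure Ω) (X : ℕ → Ω → ℕ) (k : ℕ) : ℝ :=
  (nu P X 2 k - nu P X 1 k ^ 2) / 2 + wE P [rv X (k - 1), rv X k]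

theorem qk_eq (k : ℕ) : qk P X k = (nu P X 2 k - nu P X 1 k ^ 2) / 2 +
    (mom2 P X k - nu P X 1 (k - 1) * nu P X 1 k) := by
  rw [qk, wE_pair, nu_one, nu_one, mom2]

theorem g_eq (t : ℝ) (k : ℕ) :
    g P X t k = Complex.exp ((nu P X 1 k : ℂ) * zt t + (qk P X k : ℂ) * zt t ^ 2) := rfl

theorem hasDerivAt_g_exponent (k : ℕ) (t : ℝ) :
    HasDerivAt (fun t => (nu P X 1 k : ℂ) * zt t + (qk P X k : ℂ) * zt t ^ 2)
      ((nu P X 1 k : ℂ) * (Complex.I * Complex.exp (Complex.I * t)) +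
        (qk P X k : ℂ) * (2 * zt t * (Complex.I * Complex.exp (Complex.I * t)))) t :=
  ((hasDerivAt_zt t).const_mul _).fun_add
    ((((hasDerivAt_zt t).fun_pow 2).congr_deriv (by push_cast; ring)).const_mul _)

theorem differentiable_g (k : ℕ) : Differentiable ℝ fun t => g P X t k :=
  fun t => (hasDerivAt_g_exponent k t).cexp.differentiableAt

theorem Regular.abs_qk_le (H : Regular P X n) {k : ℕ} (hk : k ≤ n) :
    |qk P X k| ≤ (nu P X 2 k + nu P X 1 k ^ 2) / 2 + mom2 P X k + nu P X 1 (k - 1) * nu P X 1 k ∧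
      |qk P X k| ≤ 1 / 20 := by
  have V0 := nu_nonneg (P := P) (X := X) 1 k
  have V0' := nu_nonneg (P := P) (X := X) 1 (k - 1)
  have V1 := H.nu_one_le hk
  have V1' := H.nu_one_le (k := k - 1) (by omega)
  have m0 := mom2_nonneg (P := P) (X := X) k
  have n0 := nu_nonneg (P := P) (X := X) 2 k
  have n1 := H.nu2 k hk
  have m1 := H.mom2_le hk
  have vv := mul_nonneg V0' V0
  have h : |qk P X k| ≤ (nu P X 2 k + nu P X 1 k ^ 2) / 2 + mom2 P X k +
      nu P X 1 (k - 1) * nu P X 1 k := by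
    rw [qk_eq, abs_le]
    constructor <;> nlinarith [sq_nonneg (nu P X 1 k)]
  refine ⟨h, h.trans ?_⟩
  nlinarith

/-- Arithmetic for `Regular.jn_g_sub_le`: `V, V'` are the means at `k, k-1`, `N = ν_2(k)`, `m` the
pair moment, `q = |q_k|`. Squares become third order through `N ≤ V` and `m ≤ V' + V`, mixed
products of means through AM-GM for cubes. -/
theorem second_order_coeff_le {V V' N m q S : ℝ} (V0 : 0 ≤ V) (V0' : 0 ≤ V') (V1 : V ≤ 1 / 100)
    (V1' : V' ≤ 1 / 100) (n0 : 0 ≤ N) (n1 : N ≤ V) (m0 : 0 ≤ m) (m1 : m ≤ V' + V) (hq0 : 0 ≤ q)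
    (q1 : q ≤ (N + V ^ 2) / 2 + m + V' * V) (q2 : q ≤ 1 / 20) (s1 : V ^ 3 ≤ S) (s2 : V' ^ 3 + V ^ 3 ≤ S)
    (s3 : V * N ≤ S) (s4 : V * m ≤ S) (s5 : V' * m ≤ S) :
    27 * (V + q) ^ 3 + (2 * (V * q) + 2 * q ^ 2) ≤ 3000 * S := by
  have v1 : V' * V * V ≤ V' ^ 3 + V ^ 3 + V ^ 3 := mul_mul_le_cubes V0' V0 V0
  have f1 : V * q ≤ V * ((N + V ^ 2) / 2 + m + V' * V) := by gcongr
  have f2 : q ^ 2 ≤ ((N + V ^ 2) / 2 + m + V' * V) ^ 2 := by gcongr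
  have f3 : ((N + V ^ 2) / 2 + m + V' * V) ^ 2 ≤
      4 * (N ^ 2 / 4 + V ^ 4 / 4 + m ^ 2 + (V' * V) ^ 2) := by
    refine le_trans (le_of_eq ?_) ((sq_add_four_le (N / 2) (V ^ 2 / 2) m (V' * V)).trans
      (le_of_eq ?_)) <;> ring
  have f4 : N ^ 2 ≤ V * N := by rw [sq]; exact mul_le_mul_of_nonneg_right n1 n0
  have p3 : 0 ≤ V ^ 3 := by positivity
  have f5 : V ^ 4 ≤ V ^ 3 := pow_le_pow_of_le_one V0 (by linarith) (by norm_num)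
  have f6 : m ^ 2 ≤ V' * m + V * m := by
    rw [sq, ← add_mul]; exact mul_le_mul_of_nonneg_right m1 m0
  have f7 : (V' * V) ^ 2 ≤ V' * V * V := by
    have h : 0 ≤ V' * V * V := by positivity
    calc (V' * V) ^ 2 = V' * (V' * V * V) := by ring
      _ ≤ 1 * (V' * V * V) := mul_le_mul_of_nonneg_right (by linarith) h
      _ = _ := one_mul _
  have f9 : (V + q) ^ 3 ≤ 4 * V ^ 3 + 4 * q ^ 2 := by
    have a1 : 4 * V ^ 3 + 4 * q ^ 3 - (V + q) ^ 3 = 3 * ((V + q) * (V - q) ^ 2) := by ring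
    have a2 : 0 ≤ (V + q) * (V - q) ^ 2 := by positivity
    have a3 : q ^ 3 ≤ q ^ 2 := pow_le_pow_of_le_one hq0 (by linarith) (by norm_num)
    linarith
  have g2 : V * ((N + V ^ 2) / 2 + m + V' * V) =
    (V * N) / 2 + V ^ 3 / 2 + V * m + V' * V * V := by ring
  linarith

theorem Regular.jn_g_sub_le (H : Regular P X n) {k : ℕ} (hk : k ≤ n) (t : ℝ) :
    jn (fun t => g P X t k - 1 - nu P X 1 k * zt t -
      ((qk P X k + nu P X 1 k ^ 2 / 2 : ℝ) : ℂ) * zt t ^ 2) t ≤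
      3000 * (yt t ^ 3 * sh (r1 P X) k) := by
  have y0 := yt_nonneg t
  have y2 := yt_le_two t
  have V0 := nu_nonneg (P := P) (X := X) 1 k
  have V0' := nu_nonneg (P := P) (X := X) 1 (k - 1)
  have V1 := H.nu_one_le hk
  have V1' := H.nu_one_le (k := k - 1) (by omega)
  obtain ⟨q1, q2⟩ := H.abs_qk_le hk
  have n0 := nu_nonneg (P := P) (X := X) 2 k
  have n1 := H.nu2 k hk
  have m0 := mom2_nonneg (P := P) (X := X) k
  have m1 := H.mom2_le hk
  obtain ⟨b0, b1, b2, -, -, b5, b6, -⟩ := r1_bounds (P := P) (X := X) k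
  obtain ⟨c0, c1, -⟩ := r1_bounds (P := P) (X := X) (k - 1)
  have e0 := r1_nonneg (P := P) (X := X) (k - 2)
  have hS : sh (r1 P X) k = r1 P X k + r1 P X (k - 1) + r1 P X (k - 2) := rfl
  have hu := hasDerivAt_g_exponent (P := P) (X := X) k t
  have hq0 := abs_nonneg (qk P X k)
  have dz := differentiable_zt t
  have hju : jn (fun t => (nu P X 1 k : ℂ) * zt t + (qk P X k : ℂ) * zt t ^ 2) t ≤
      3 * (yt t * (nu P X 1 k + |qk P X k|)) := by
    refine (jn_add_le (dz.const_mul _) ((dz.fun_pow 2).const_mul _)).trans ?_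
    rw [jn_const_mul dz, jn_const_mul (dz.fun_pow 2), jn_zt, Complex.norm_real, Complex.norm_real,
      Real.norm_of_nonneg V0, Real.norm_eq_abs]
    have h1 := mul_le_mul_of_nonneg_left (jn_zt_pow_le t 2) hq0
    have h2 : |qk P X k| * yt t * yt t ≤ |qk P X k| * yt t * 2 := by gcongr
    have h3 := mul_nonneg y0 V0
    have h4 := mul_nonneg hq0 y0
    nlinarith
  have hu1 : ‖(nu P X 1 k : ℂ) * zt t + (qk P X k : ℂ) * zt t ^ 2‖ ≤ 1 :=
    (norm_le_jn _ t).trans (hju.trans (by nlinarith))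
  -- With `u = νz + qz²`, the square `u²/2` contributes `ν²z²/2` to the second order coefficient and
  -- `νq z³ + q²z⁴/2` to the remainder.
  have e : (fun t => g P X t k - 1 - nu P X 1 k * zt t -
      ((qk P X k + nu P X 1 k ^ 2 / 2 : ℝ) : ℂ) * zt t ^ 2) = fun t =>
      (Complex.exp ((nu P X 1 k : ℂ) * zt t + (qk P X k : ℂ) * zt t ^ 2) - 1 -
        ((nu P X 1 k : ℂ) * zt t + (qk P X k : ℂ) * zt t ^ 2) -
        ((nu P X 1 k : ℂ) * zt t + (qk P X k : ℂ) * zt t ^ 2) ^ 2 / 2) +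
      (((nu P X 1 k * qk P X k : ℝ) : ℂ) * zt t ^ 3 + ((qk P X k ^ 2 / 2 : ℝ) : ℂ) * zt t ^ 4) := by
    funext t
    rw [g_eq]
    push_cast
    ring
  have du := hu.differentiableAt
  rw [e]
  refine (jn_add_le ((((du.cexp).sub_const 1).fun_sub du).fun_sub ((du.fun_pow 2).div_const 2))
    (((dz.fun_pow 3).const_mul _).fun_add ((dz.fun_pow 4).const_mul _))).trans ?_
  have h1 := jn_exp_sub_quadratic_le du hu1
  have h2 : jn (fun t => ((nu P X 1 k * qk P X k : ℝ) : ℂ) * zt t ^ 3 +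
      ((qk P X k ^ 2 / 2 : ℝ) : ℂ) * zt t ^ 4) t ≤
      yt t ^ 3 * (2 * (nu P X 1 k * |qk P X k|) + 2 * |qk P X k| ^ 2) := by
    rw [sq_abs]
    refine (jn_add_le ((dz.fun_pow 3).const_mul _) ((dz.fun_pow 4).const_mul _)).trans ?_
    rw [jn_const_mul (dz.fun_pow 3), jn_const_mul (dz.fun_pow 4), Complex.norm_real,
      Complex.norm_real, Real.norm_eq_abs, Real.norm_of_nonneg (by positivity), abs_mul,
      abs_of_nonneg V0]
    have h3 := mul_le_mul_of_nonneg_left (jn_zt_pow_le t 3) (mul_nonneg V0 hq0)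
    have h4 := mul_le_mul_of_nonneg_left (jn_zt_pow_le t 4) (by positivity : 0 ≤ qk P X k ^ 2 / 2)
    have h5 : yt t ^ 3 * qk P X k ^ 2 * yt t ≤ yt t ^ 3 * qk P X k ^ 2 * 2 := by gcongr
    have h6 : 0 ≤ yt t ^ 3 * (nu P X 1 k * |qk P X k|) := by positivity
    have h7 : 0 ≤ yt t ^ 3 * qk P X k ^ 2 := by positivity
    nlinarith
  have h3 : jn (fun t => (nu P X 1 k : ℂ) * zt t + (qk P X k : ℂ) * zt t ^ 2) t ^ 3 ≤
      (3 * (yt t * (nu P X 1 k + |qk P X k|))) ^ 3 := by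
    have := jn_nonneg (fun t => (nu P X 1 k : ℂ) * zt t + (qk P X k : ℂ) * zt t ^ 2) t
    gcongr
  have f11 := second_order_coeff_le (S := sh (r1 P X) k) V0 V0' V1 V1' n0 n1 m0 m1 hq0 q1 q2
    (by linarith) (by linarith) (by linarith) (by linarith) (by linarith)
  have h6 := mul_le_mul_of_nonneg_left f11 (by positivity : 0 ≤ yt t ^ 3)
  have h7 : (3 * (yt t * (nu P X 1 k + |qk P X k|))) ^ 3 =
    yt t ^ 3 * (27 * (nu P X 1 k + |qk P X k|) ^ 3) := by ring
  linarith

end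

/-! ### Third order agreement of `φ_k` and `g_k` -/

section

variable {Ω : Type*} [MeasurableSpace Ω] {P : Measure Ω} [IsProbabilityMeasure P]
  {X : ℕ → Ω → ℕ} {n : ℕ}

/-- Arithmetic for `Regular.jn_mean_term_le`: one and two primes refer to the indices `k - 1` and `k
- 2`, `m` are pair moments, `T` triple moments. The summand of `R1` offers nothing for `V V' m''`,
so `m''` is first replaced by `V'' + A` with `A` from `Regular.mom2_le'`. -/
theorem mean_coeff_le {y V V' V'' m' m'' T' T'' A S : ℝ} (y0 : 0 ≤ y) (y2 : y ≤ 2) (V0 : 0 ≤ V)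
    (V0' : 0 ≤ V') (V0'' : 0 ≤ V'') (V1 : V ≤ 1 / 100) (V1' : V' ≤ 1 / 100) (m0' : 0 ≤ m')
    (T0' : 0 ≤ T') (T0'' : 0 ≤ T'') (A0 : 0 ≤ A) (hm : m'' ≤ V'' + A)
    (s1 : V ^ 3 + V' ^ 3 + V'' ^ 3 ≤ S) (s1' : V ^ 3 + V' ^ 3 + V' ^ 3 ≤ 2 * S) (s2 : V * m' ≤ S)
    (s3 : T' ≤ S) (s4 : T'' ≤ S) (s5 : A ≤ S) :
    2 * (y * V) * (2 * (y * V') * (200 * (y * V'' + y ^ 2 * m'' + y ^ 3 * T'')) +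
      200 * (y ^ 2 * m' + y ^ 3 * T') + 2 * (y * V') * (200 * (y * V' + y ^ 2 * m' + y ^ 3 * T'))) ≤
    10000 * (y ^ 3 * S) := by
  have hyV : y * V ≤ 1 / 50 := by nlinarith
  have hyV' : y * V' ≤ 1 / 50 := by nlinarith
  have y0V := mul_nonneg y0 V0
  have y0V' := mul_nonneg y0 V0'
  have a1 : V * V' * V'' ≤ S := (mul_mul_le_cubes V0 V0' V0'').trans s1
  have a2 : V * V' * V' ≤ 2 * S := (mul_mul_le_cubes V0 V0' V0').trans s1'
  have S0 : 0 ≤ S := T0'.trans s3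
  have a3 : y * V * V' * m'' ≤ 3 * S := by
    have h1 : y * V * V' * m'' ≤ y * V * V' * (V'' + A) := by gcongr
    have h2 : y * (V * V' * V'') ≤ 2 * S := mul_le_mul y2 a1 (by positivity) (by norm_num)
    have h3 : (y * V) * V' * A ≤ 1 * 1 * A := by gcongr <;> linarith
    linarith
  have a4 : (y * V) * (y * V') * T'' ≤ 1 * 1 * T'' := by gcongr <;> linarith
  have a5 : (y * V) * T' ≤ 1 * T' := by gcongr; linarith
  have a6 : (y * V') * (V * m') ≤ 1 * (V * m') := by gcongr; linarith
  have a7 : (y * V) * (y * V') * T' ≤ 1 * 1 * T' := by gcongr <;> linarith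
  have key : 800 * (V * V' * V'') + 800 * (y * V * V' * m'') + 800 * ((y * V) * (y * V') * T'') +
      400 * (V * m') + 400 * ((y * V) * T') + 800 * (V * V' * V') + 800 * ((y * V') * (V * m')) +
      800 * ((y * V) * (y * V') * T') ≤ 10000 * S := by linarith
  have := mul_le_mul_of_nonneg_left key (by positivity : 0 ≤ y ^ 3)
  refine le_trans (le_of_eq ?_) (this.trans (le_of_eq ?_)) <;> ring

theorem pair_coeff_le {y V' V'' m m' m'' T' T'' A S : ℝ} (y0 : 0 ≤ y) (y2 : y ≤ 2)
    (m0 : 0 ≤ m) (m1 : m ≤ 1 / 50) (T0' : 0 ≤ T') (T0'' : 0 ≤ T'') (A0 : 0 ≤ A)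
    (hm : m'' ≤ V'' + A) (hm' : m' ≤ V'' + V') (V0' : 0 ≤ V') (V0'' : 0 ≤ V'')
    (s1 : V'' * m ≤ S) (s2 : V' * m ≤ S) (s3 : T' ≤ S) (s4 : T'' ≤ S) (s5 : A ≤ S) :
    3 * (y ^ 2 * m) * (2 * (200 * (y * V'' + y ^ 2 * m'' + y ^ 3 * T'') +
      200 * (y * V' + y ^ 2 * m' + y ^ 3 * T'))) ≤ 14000 * (y ^ 3 * S) := by
  have ym : y * m ≤ 1 / 25 := by nlinarith
  have yym : y * (y * m) ≤ 1 := by nlinarith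
  have y0m := mul_nonneg y0 m0
  have a1 : y * m * m'' ≤ 3 * S := by
    have h1 : y * m * m'' ≤ y * m * (V'' + A) := by gcongr
    have h2 : y * (V'' * m) ≤ 2 * S := mul_le_mul y2 s1 (by positivity) (by norm_num)
    have h3 : (y * m) * A ≤ 1 * A := by gcongr; linarith
    linarith
  have a2 : y * m * m' ≤ 4 * S := by
    have h1 : y * m * m' ≤ y * m * (V'' + V') := by gcongr
    have h2 : y * (V'' * m) ≤ 2 * S := mul_le_mul y2 s1 (by positivity) (by norm_num)
    have h3 : y * (V' * m) ≤ 2 * S := mul_le_mul y2 s2 (by positivity) (by norm_num)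
    linarith
  have a3 : y * (y * m) * T' ≤ 1 * T' := by gcongr
  have a4 : y * (y * m) * T'' ≤ 1 * T'' := by gcongr
  have key : 1200 * (V'' * m + y * m * m'' + y * (y * m) * T'' + V' * m + y * m * m' +
      y * (y * m) * T') ≤ 14000 * S := by linarith
  have := mul_le_mul_of_nonneg_left key (by positivity : 0 ≤ y ^ 3)
  refine le_trans (le_of_eq ?_) (this.trans (le_of_eq ?_)) <;> ring

theorem Regular.jn_MZ_self_le' (H : Regular P X n) (t : ℝ) {k : ℕ} (hk : k ≤ n) :
    jn (MZ P X k k) t ≤ 1001 / 1000 * (yt t * nu P X 1 k) := by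
  rcases Nat.eq_zero_or_pos k with rfl | h
  · rw [H.MZ_zero_left, jn_const, norm_zero]
    exact mul_nonneg (by norm_num) (mul_nonneg (yt_nonneg t) (nu_nonneg _ _))
  · exact H.jn_MZ_self_le t h hk

theorem Regular.jn_ratio_sub_one_le_mom3 (H : Regular P X n) (t : ℝ) {k : ℕ} (hk : k ≤ n) :
    jn (fun t => ratio P X k t - 1) t ≤
      200 * (yt t * nu P X 1 k + yt t ^ 2 * mom2 P X k + yt t ^ 3 * mom3 P X k) := by
  have h1 := H.jn_ratio_sub_one_le' t hk
  have h2 := H.headBlk_le_mom3 t hk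
  linarith

theorem Regular.quot_eq (H : Regular P X n) {k : ℕ} (hk : k ≤ n) (t : ℝ) :
    quot P X (k - 3) (k - 1) t = (ratio P X (k - 2) t)⁻¹ * (ratio P X (k - 1) t)⁻¹ := by
  have h1 := H.cF_ne_zero (k := k - 1) (by omega) t
  have h2 := H.cF_ne_zero (k := k - 2) (by omega) t
  have h3 := H.cF_ne_zero (k := k - 3) (by omega) t
  rw [quot, ratio, ratio, show k - 1 - 1 = k - 2 by omega, show k - 2 - 1 = k - 3 by omega]
  field_simp

theorem Regular.differentiable_inv_ratio (H : Regular P X n) {k : ℕ} (hk : k ≤ n) :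
    Differentiable ℝ fun t => (ratio P X k t)⁻¹ := fun t =>
  (H.differentiable_ratio hk t).fun_inv (H.ratio_ne_zero hk t)

theorem Regular.jn_quot_sub_one_le (H : Regular P X n) (t : ℝ) {k : ℕ} (hk : k ≤ n) :
    jn (fun t => quot P X (k - 3) (k - 1) t - 1) t ≤
      2 * (jn (fun t => ratio P X (k - 2) t - 1) t + jn (fun t => ratio P X (k - 1) t - 1) t) := by
  have hk1 : k - 1 ≤ n := by omega
  have hk2 : k - 2 ≤ n := by omega
  have e : (fun t => quot P X (k - 3) (k - 1) t - 1) = fun t =>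
      ((ratio P X (k - 2) t)⁻¹ - 1) * (ratio P X (k - 1) t)⁻¹ + ((ratio P X (k - 1) t)⁻¹ - 1) := by
    funext t
    rw [H.quot_eq hk]
    ring
  have d1 := H.differentiable_inv_ratio hk1 t
  have d2 := H.differentiable_inv_ratio hk2 t
  rw [e]
  refine (jn_add_le ((d2.sub_const 1).fun_mul d1) (d1.sub_const 1)).trans ?_
  have h1 := jn_mul_le (d2.sub_const 1) d1
  have h2 := H.jn_inv_ratio_sub_one_le t hk1
  have h3 := H.jn_inv_ratio_sub_one_le t hk2
  have h4 := H.jn_inv_ratio_le hk1 t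
  have p1 := jn_nonneg (fun t => ratio P X (k - 1) t - 1) t
  have p2 := jn_nonneg (fun t => ratio P X (k - 2) t - 1) t
  have h5 := mul_le_mul h3 h4 (jn_nonneg _ _) (mul_nonneg (by norm_num) p2)
  linarith

theorem Regular.mom2_le_small (H : Regular P X n) {k : ℕ} (hk : k ≤ n) : mom2 P X k ≤ 1 / 50 := by
  have h1 := H.mom2_le hk
  have h2 := H.nu_one_le hk
  have h3 := H.nu_one_le (k := k - 1) (by omega)
  linarith

theorem Regular.jn_mean_term_le (H : Regular P X n) {k : ℕ} (hk : k ≤ n) (t : ℝ) :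
    jn (fun t => MZ P X k k t * ((ratio P X (k - 1) t)⁻¹ - 1 + MZ P X (k - 1) (k - 1) t)) t ≤
      10000 * (yt t ^ 3 * sh (r1 P X) k) := by
  have hk1 : k - 1 ≤ n := by omega
  have hk2 : k - 2 ≤ n := by omega
  have dr := H.differentiable_ratio hk1 t
  have di := H.differentiable_inv_ratio hk1 t
  have de := H.differentiable_MZ (j := k) hk t
  have de' := H.differentiable_MZ (j := k - 1) hk1 t
  -- Shows that `φ_{k-1}⁻¹` equals `1 - E Z_{k-1}` up to second order, so that multiplication by the
  -- mean of `Z_k` yields third order.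
  have e : (fun t => (ratio P X (k - 1) t)⁻¹ - 1 + MZ P X (k - 1) (k - 1) t) = fun t =>
      (ratio P X (k - 1) t)⁻¹ * (MZ P X (k - 1) (k - 1) t * (ratio P X (k - 1) t - 1) -
        (ratio P X (k - 1) t - 1 - MZ P X (k - 1) (k - 1) t)) := by
    funext t
    have := H.ratio_ne_zero hk1 t
    field_simp
    ring
  have y0 := yt_nonneg t
  have V0 := nu_nonneg (P := P) (X := X) 1 k
  have V0' := nu_nonneg (P := P) (X := X) 1 (k - 1)
  have V0'' := nu_nonneg (P := P) (X := X) 1 (k - 2)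
  have h1 : jn (fun t => (ratio P X (k - 1) t)⁻¹ - 1 + MZ P X (k - 1) (k - 1) t) t ≤
      10 / 9 * (1001 / 1000 * (yt t * nu P X 1 (k - 1)) * jn (fun t => ratio P X (k - 1) t - 1) t +
        jn (fun t => ratio P X (k - 1) t - 1 - MZ P X (k - 1) (k - 1) t) t) := by
    rw [e]
    refine (jn_mul_le di ((de'.fun_mul (dr.sub_const 1)).fun_sub
      ((dr.sub_const 1).fun_sub de'))).trans ?_
    refine mul_le_mul (H.jn_inv_ratio_le hk1 t) ?_ (jn_nonneg _ _) (by norm_num)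
    refine (jn_sub_le (de'.fun_mul (dr.sub_const 1)) ((dr.sub_const 1).fun_sub de')).trans ?_
    gcongr
    exact (jn_mul_le de' (dr.sub_const 1)).trans
      (mul_le_mul_of_nonneg_right (H.jn_MZ_self_le' t hk1) (jn_nonneg _ _))
  have h2 := H.jn_ratio_sub_mean_le t hk1
  have h3 := H.jn_ratio_sub_one_le_mom3 t hk1
  have h4 := H.jn_ratio_sub_one_le_mom3 t hk2
  have h5 := H.headBlk_le_mom3 t hk1
  rw [show k - 1 - 1 = k - 2 by omega] at h2
  obtain ⟨-, b1, -, -, -, -, -, -, -, -, -, b11⟩ := r1_bounds (P := P) (X := X) k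
  obtain ⟨-, c1, -, -, -, -, -, -, -, -, c10, -⟩ := r1_bounds (P := P) (X := X) (k - 1)
  obtain ⟨-, d1, -, -, -, -, -, d7, -, -, d10, -⟩ := r1_bounds (P := P) (X := X) (k - 2)
  have b0 := r1_nonneg (P := P) (X := X) k
  have c0 := r1_nonneg (P := P) (X := X) (k - 1)
  have e0 := r1_nonneg (P := P) (X := X) (k - 2)
  have hB := momB_nonneg (P := P) (X := X) (k - 2)
  have hS : sh (r1 P X) k = r1 P X k + r1 P X (k - 1) + r1 P X (k - 2) := rfl
  have key := mean_coeff_le (S := sh (r1 P X) k) y0 (yt_le_two t) V0 V0' V0'' (H.nu_one_le hk)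
    (H.nu_one_le hk1) (mom2_nonneg (P := P) (X := X) (k - 1)) (mom3_nonneg (P := P) (X := X) (k - 1))
    (mom3_nonneg (P := P) (X := X) (k - 2)) (momA_nonneg (P := P) (X := X) (k - 2))
    (H.mom2_le' hk2) (by linarith) (by linarith) (by linarith) (by linarith) (by linarith)
    (by linarith)
  refine ((jn_mul_le de ((di.sub_const 1).fun_add de')).trans ?_).trans key
  have yV := mul_nonneg y0 V0
  have yV' := mul_nonneg y0 V0'
  have X0 := jn_nonneg (fun t => ratio P X (k - 1) t - 1) t
  calc _ ≤ 1001 / 1000 * (yt t * nu P X 1 k) * (10 / 9 * (1001 / 1000 * (yt t * nu P X 1 (k - 1)) *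
        jn (fun t => ratio P X (k - 1) t - 1) t +
        jn (fun t => ratio P X (k - 1) t - 1 - MZ P X (k - 1) (k - 1) t) t)) :=
        mul_le_mul (H.jn_MZ_self_le' t hk) h1 (jn_nonneg _ _) (by positivity)
    _ = (1001 / 1000 * (10 / 9)) * (yt t * nu P X 1 k) * (1001 / 1000 * (yt t * nu P X 1 (k - 1)) *
        jn (fun t => ratio P X (k - 1) t - 1) t +
        jn (fun t => ratio P X (k - 1) t - 1 - MZ P X (k - 1) (k - 1) t) t) := by ring
    _ ≤ 2 * (yt t * nu P X 1 k) * (2 * (yt t * nu P X 1 (k - 1)) *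
          jn (fun t => ratio P X (k - 1) t - 1) t +
        (2 * (yt t * nu P X 1 (k - 1)) * jn (fun t => ratio P X (k - 2) t - 1) t +
          200 * (yt t ^ 2 * mom2 P X (k - 1) + yt t ^ 3 * mom3 P X (k - 1)))) := by
        refine mul_le_mul ?_ (add_le_add ?_ (by linarith)) ?_ (by positivity)
        · gcongr; norm_num
        · gcongr; norm_num
        · exact add_nonneg (by positivity) (jn_nonneg _ _)
    _ ≤ 2 * (yt t * nu P X 1 k) * (2 * (yt t * nu P X 1 (k - 1)) *
          (200 * (yt t * nu P X 1 (k - 1) + yt t ^ 2 * mom2 P X (k - 1) +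
            yt t ^ 3 * mom3 P X (k - 1))) +
        (2 * (yt t * nu P X 1 (k - 1)) * (200 * (yt t * nu P X 1 (k - 2) +
            yt t ^ 2 * mom2 P X (k - 2) + yt t ^ 3 * mom3 P X (k - 2))) +
          200 * (yt t ^ 2 * mom2 P X (k - 1) + yt t ^ 3 * mom3 P X (k - 1)))) := by gcongr
    _ = _ := by ring

theorem Regular.jn_pair_term_sub_le (H : Regular P X n) {k : ℕ} (hk0 : 1 ≤ k) (hk : k ≤ n) (t : ℝ) :
    jn (fun t => MZ P X (k - 1) k t * (quot P X (k - 3) (k - 1) t - 1)) t ≤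
      14000 * (yt t ^ 3 * sh (r1 P X) k) := by
  have hk1 : k - 1 ≤ n := by omega
  have hk2 : k - 2 ≤ n := by omega
  have y0 := yt_nonneg t
  have m0 := mom2_nonneg (P := P) (X := X) k
  have h3 := H.jn_ratio_sub_one_le_mom3 t hk1
  have h4 := H.jn_ratio_sub_one_le_mom3 t hk2
  obtain ⟨-, -, -, -, b4, b5, -⟩ := r1_bounds (P := P) (X := X) k
  obtain ⟨-, -, -, -, -, -, -, -, -, -, c10, -⟩ := r1_bounds (P := P) (X := X) (k - 1)
  obtain ⟨-, -, -, -, -, -, -, d7, -, -, d10, -⟩ := r1_bounds (P := P) (X := X) (k - 2)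
  have b0 := r1_nonneg (P := P) (X := X) k
  have c0 := r1_nonneg (P := P) (X := X) (k - 1)
  have e0 := r1_nonneg (P := P) (X := X) (k - 2)
  have hB := momB_nonneg (P := P) (X := X) (k - 2)
  have hS : sh (r1 P X) k = r1 P X k + r1 P X (k - 1) + r1 P X (k - 2) := rfl
  have hm' := H.mom2_le hk1
  rw [show k - 1 - 1 = k - 2 by omega] at hm'
  have key := pair_coeff_le (S := sh (r1 P X) k) y0 (yt_le_two t) m0 (H.mom2_le_small hk)
    (mom3_nonneg (P := P) (X := X) (k - 1))
    (mom3_nonneg (P := P) (X := X) (k - 2)) (momA_nonneg (P := P) (X := X) (k - 2))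
    (H.mom2_le' hk2) hm' (nu_nonneg _ _) (nu_nonneg _ _) (by linarith) (by linarith) (by linarith)
    (by linarith) (by linarith)
  refine ((jn_mul_le (H.differentiable_MZ hk t)
    ((H.differentiable_quot (by omega) hk1 t).sub_const 1)).trans ?_).trans key
  refine mul_le_mul (H.jn_MZ_pair_le' t hk0 hk) ((H.jn_quot_sub_one_le t hk).trans ?_)
    (jn_nonneg _ _) (by positivity)
  linarith

theorem Regular.jn_mean_mul_mean_sub_le (H : Regular P X n) {k : ℕ} (hk : k ≤ n) (t : ℝ) :
    jn (fun t => (MZ P X k k t - nu P X 1 k * zt t) * MZ P X (k - 1) (k - 1) t +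
      nu P X 1 k * (zt t * (MZ P X (k - 1) (k - 1) t - nu P X 1 (k - 1) * zt t))) t ≤
      4 * (yt t ^ 3 * sh (r1 P X) k) := by
  have hk1 : k - 1 ≤ n := by omega
  have y0 := yt_nonneg t
  have V0 := nu_nonneg (P := P) (X := X) 1 k
  have V0' := nu_nonneg (P := P) (X := X) 1 (k - 1)
  have n0 := nu_nonneg (P := P) (X := X) 2 k
  have n0' := nu_nonneg (P := P) (X := X) 2 (k - 1)
  have dz := differentiable_zt t
  have de := H.differentiable_MZ (j := k) hk t
  have de' := H.differentiable_MZ (j := k - 1) hk1 t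
  have d1 := de.fun_sub (dz.const_mul (nu P X 1 k : ℂ))
  have d2 := de'.fun_sub (dz.const_mul (nu P X 1 (k - 1) : ℂ))
  obtain ⟨-, -, -, -, -, -, -, -, b8, b9, -⟩ := r1_bounds (P := P) (X := X) k
  have c0 := r1_nonneg (P := P) (X := X) (k - 1)
  have e0 := r1_nonneg (P := P) (X := X) (k - 2)
  have hS : sh (r1 P X) k = r1 P X k + r1 P X (k - 1) + r1 P X (k - 2) := rfl
  refine (jn_add_le (d1.fun_mul de') ((dz.fun_mul d2).const_mul _)).trans ?_
  rw [jn_const_mul (dz.fun_mul d2), Complex.norm_real, Real.norm_of_nonneg V0]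
  calc _ ≤ yt t ^ 2 * nu P X 2 k * (1001 / 1000 * (yt t * nu P X 1 (k - 1))) +
        nu P X 1 k * (1001 / 1000 * yt t * (yt t ^ 2 * nu P X 2 (k - 1))) := by
        gcongr
        · exact (jn_mul_le d1 de').trans (mul_le_mul (H.jn_MZ_self_sub_le hk t)
            (H.jn_MZ_self_le' t hk1) (jn_nonneg _ _) (by positivity))
        · refine (jn_mul_le dz d2).trans ?_
          rw [jn_zt]
          exact mul_le_mul_of_nonneg_left (H.jn_MZ_self_sub_le hk1 t) (by positivity)
    _ = yt t ^ 3 * (1001 / 1000 * (nu P X 1 (k - 1) * nu P X 2 k +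
        nu P X 2 (k - 1) * nu P X 1 k)) := by ring
    _ ≤ yt t ^ 3 * (4 * sh (r1 P X) k) := by
        have b0 := r1_nonneg (P := P) (X := X) k
        exact mul_le_mul_of_nonneg_left (by linarith) (by positivity)
    _ = _ := by ring

/-- `φ_k` and `g_k` agree up to terms of the third order. -/
theorem Regular.jn_ratio_sub_g_le (H : Regular P X n) {k : ℕ} (hk0 : 1 ≤ k) (hk : k ≤ n) (t : ℝ) :
    jn (fun t => ratio P X k t - g P X t k) t ≤ 30000 * (yt t ^ 3 * sh (r1 P X) k) := by
  have hk1 : k - 1 ≤ n := by omega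
  have y0 := yt_nonneg t
  -- Each bracket is of third order. The second order terms cancel: `ν_2/2` from the mean, `E
  -- X_{k-1}X_k` from the pair, and `-ν_1(k-1)ν_1(k)` from the first order part of `φ_{k-1}⁻¹`
  -- together make `q_k + ν_1²/2`. This is why `g_k` contains `Ê(X_{k-1}, X_k)`.
  have e : (fun t => ratio P X k t - g P X t k) = fun t =>
      MZ P X k k t * ((ratio P X (k - 1) t)⁻¹ - 1 + MZ P X (k - 1) (k - 1) t) +
      MZ P X (k - 1) k t * (quot P X (k - 3) (k - 1) t - 1) + longSum P X k t +
      (MZ P X k k t - nu P X 1 k * zt t - ((nu P X 2 k / 2 : ℝ) : ℂ) * zt t ^ 2) +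
      (MZ P X (k - 1) k t - mom2 P X k * zt t ^ 2) -
      ((MZ P X k k t - nu P X 1 k * zt t) * MZ P X (k - 1) (k - 1) t +
        nu P X 1 k * (zt t * (MZ P X (k - 1) (k - 1) t - nu P X 1 (k - 1) * zt t))) -
      (g P X t k - 1 - nu P X 1 k * zt t -
        ((qk P X k + nu P X 1 k ^ 2 / 2 : ℝ) : ℂ) * zt t ^ 2) := by
    funext t
    rw [eq_add_of_sub_eq (H.ratio_sub_one hk0 hk t), qk_eq]
    push_cast
    ring
  have dz := differentiable_zt t
  have de := H.differentiable_MZ (j := k) hk t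
  have de' := H.differentiable_MZ (j := k - 1) hk1 t
  have dm := H.differentiable_MZ (j := k - 1) hk t
  have dq := H.differentiable_quot (a := k - 3) (by omega) hk1 t
  have di := H.differentiable_inv_ratio hk1 t
  have d1 := de.fun_mul ((di.sub_const 1).fun_add de')
  have d2 := dm.fun_mul (dq.sub_const 1)
  have d3 := H.differentiable_longSum hk t
  have d4 := (de.fun_sub (dz.const_mul (nu P X 1 k : ℂ))).fun_sub
    ((dz.fun_pow 2).const_mul ((nu P X 2 k / 2 : ℝ) : ℂ))
  have d5 := dm.fun_sub ((dz.fun_pow 2).const_mul (mom2 P X k : ℂ))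
  have d6 := ((de.fun_sub (dz.const_mul (nu P X 1 k : ℂ))).fun_mul de').fun_add
    ((dz.fun_mul (de'.fun_sub (dz.const_mul (nu P X 1 (k - 1) : ℂ)))).const_mul (nu P X 1 k : ℂ))
  have d7 := (((differentiable_g (P := P) (X := X) k t).sub_const 1).fun_sub
    (dz.const_mul (nu P X 1 k : ℂ))).fun_sub
    ((dz.fun_pow 2).const_mul ((qk P X k + nu P X 1 k ^ 2 / 2 : ℝ) : ℂ))
  rw [e]
  refine (jn_sub_le (((((d1.fun_add d2).fun_add d3).fun_add d4).fun_add d5).fun_sub d6) d7).trans ?_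
  have a1 := jn_sub_le ((((d1.fun_add d2).fun_add d3).fun_add d4).fun_add d5) d6
  have a2 := jn_add_le (((d1.fun_add d2).fun_add d3).fun_add d4) d5
  have a3 := jn_add_le ((d1.fun_add d2).fun_add d3) d4
  have a4 := jn_add_le (d1.fun_add d2) d3
  have a5 := jn_add_le d1 d2
  have b1 := H.jn_mean_term_le hk t
  have b2 := H.jn_pair_term_sub_le hk0 hk t
  have b3 := H.jn_longSum_le' t hk
  have b4 := H.jn_MZ_self_sub_sub_le hk t
  have b5 := H.jn_MZ_pair_sub_le hk0 hk t
  have b6 := H.jn_mean_mul_mean_sub_le hk t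
  have b7 := H.jn_g_sub_le hk t
  obtain ⟨-, -, -, c3, -, -, -, c7, -, -, c10, -⟩ := r1_bounds (P := P) (X := X) k
  obtain ⟨-, -, -, -, -, -, -, -, -, -, f10, -⟩ := r1_bounds (P := P) (X := X) (k - 1)
  have e0 := r1_nonneg (P := P) (X := X) (k - 2)
  have e1 := r1_nonneg (P := P) (X := X) (k - 1)
  have hS : sh (r1 P X) k = r1 P X k + r1 P X (k - 1) + r1 P X (k - 2) := rfl
  have y3 : 0 ≤ yt t ^ 3 := by positivity
  have g1 : yt t ^ 3 * (mom3 P X k + mom3 P X (k - 1)) ≤ yt t ^ 3 * sh (r1 P X) k :=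
    mul_le_mul_of_nonneg_left (by linarith) y3
  have g2 : yt t ^ 3 * nu P X 3 k ≤ yt t ^ 3 * sh (r1 P X) k :=
    mul_le_mul_of_nonneg_left (by linarith) y3
  have g3 : yt t ^ 3 * (momA P X k + momB P X k) ≤ yt t ^ 3 * sh (r1 P X) k :=
    mul_le_mul_of_nonneg_left (by linarith) y3
  have g4 : 0 ≤ yt t ^ 3 * sh (r1 P X) k :=
    mul_nonneg y3 (by rw [hS]; linarith [r1_nonneg (P := P) (X := X) k])
  linarith

end

section

variable {Ω : Type*} [MeasurableSpace Ω] {P : Measure Ω} [IsProbabilityMeasure P]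
  {X : ℕ → Ω → ℕ} {n : ℕ}

/-! ### Decay of the approximating factors -/

theorem re_zt (t : ℝ) : (zt t).re = -(yt t ^ 2 / 2) := by
  have h : yt t ^ 2 = 2 - 2 * Real.cos t := by
    rw [← norm_zt, ← Complex.normSq_eq_norm_sq, zt, mul_comm, Complex.normSq_apply]
    simp only [Complex.sub_re, Complex.sub_im, Complex.exp_ofReal_mul_I_re,
      Complex.exp_ofReal_mul_I_im, Complex.one_re, Complex.one_im]
    linear_combination Real.sin_sq_add_cos_sq t
  rw [h, zt, mul_comm, Complex.sub_re, Complex.exp_ofReal_mul_I_re, Complex.one_re]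
  ring

theorem Regular.lamk_le (H : Regular P X n) {k : ℕ} (hk : k ≤ n) : lamk P X k ≤ 1 / 100 := by
  have h1 := H.nu_one_le hk
  have h2 := nu_nonneg (P := P) (X := X) 2 k
  have h3 := mom2_nonneg (P := P) (X := X) k
  rw [lamk]
  linarith

theorem norm_psi_le (k : ℕ) (t : ℝ) :
    ‖psi P X t k‖ ≤ Real.exp (-(43 / 100) * lamk P X k * yt t ^ 2) := by
  rw [psi_eq, Complex.norm_exp, Real.exp_le_exp, Complex.re_ofReal_mul, re_zt, lamk]
  have h1 := nu_nonneg (P := P) (X := X) 1 k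
  have h2 := nu_nonneg (P := P) (X := X) 2 k
  have h3 := mom2_nonneg (P := P) (X := X) k
  have h : 0 ≤ (7 / 100 * nu P X 1 k + 43 / 100 * (1.52 * nu P X 2 k + 12 * mom2 P X k)) *
    yt t ^ 2 := by positivity
  linarith

/-- The linear exponent has real part `-ν_1 y²/2`, which leaves `0.07 ν_1 y²` to spare; this and the
subtracted terms in `λ_k` absorb `|q_k| y²`. -/
theorem Regular.norm_g_le (H : Regular P X n) {k : ℕ} (hk : k ≤ n) (t : ℝ) :
    ‖g P X t k‖ ≤ Real.exp (-(43 / 100) * lamk P X k * yt t ^ 2) := by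
  rw [g_eq, Complex.norm_exp, Real.exp_le_exp, Complex.add_re, Complex.re_ofReal_mul,
    Complex.re_ofReal_mul, re_zt, lamk]
  have V0 := nu_nonneg (P := P) (X := X) 1 k
  have V0' := nu_nonneg (P := P) (X := X) 1 (k - 1)
  have V1 := H.nu_one_le hk
  have V1' := H.nu_one_le (k := k - 1) (by omega)
  have n0 := nu_nonneg (P := P) (X := X) 2 k
  have m0 := mom2_nonneg (P := P) (X := X) k
  have h1 : qk P X k * (zt t ^ 2).re ≤ |qk P X k| * yt t ^ 2 := by
    refine (le_abs_self _).trans ?_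
    rw [abs_mul]
    gcongr
    refine (Complex.abs_re_le_norm _).trans ?_
    rw [norm_pow, norm_zt]
  have h2 := (H.abs_qk_le hk).1
  have h3 : |qk P X k| ≤ 7 / 100 * nu P X 1 k + 43 / 100 * (1.52 * nu P X 2 k + 12 * mom2 P X k) := by
    have e1 : nu P X 1 k ^ 2 ≤ 1 / 100 * nu P X 1 k := by
      rw [sq]; exact mul_le_mul_of_nonneg_right V1 V0
    have e2 : nu P X 1 (k - 1) * nu P X 1 k ≤ 1 / 100 * nu P X 1 k :=
      mul_le_mul_of_nonneg_right V1' V0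
    linarith
  have h4 := mul_le_mul_of_nonneg_right h3 (sq_nonneg (yt t))
  linarith

theorem Regular.lam_eq (H : Regular P X n) : lam P X n = ∑ k ∈ Finset.Icc 1 n, lamk P X k := by
  have h : ∑ k ∈ Finset.Icc 2 n, mom2 P X k = ∑ k ∈ Finset.Icc 1 n, mom2 P X k := by
    refine Finset.sum_subset (Finset.Icc_subset_Icc_left (by norm_num)) fun k hk hk2 => ?_
    simp only [Finset.mem_Icc] at hk hk2
    obtain rfl : k = 1 := by omega
    exact H.mom2_one
  simp only [lam, lamk, h, Finset.sum_sub_distrib, Finset.mul_sum]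

theorem Regular.prod_exp_lamk (H : Regular P X n) (t : ℝ) :
    ∏ k ∈ Finset.Icc 1 n, Real.exp (-(43 / 100) * lamk P X k * yt t ^ 2) =
      Real.exp (-(43 / 100) * lam P X n * yt t ^ 2) := by
  rw [← Real.exp_sum, H.lam_eq, Finset.mul_sum, Finset.sum_mul]

/-- No single factor decays by much, as `λ_k y² ≤ 1/25`. This supplies the constant `K = 2` of the
Bergström bounds. -/
theorem Regular.one_le_two_mul_exp_lamk (H : Regular P X n) {k : ℕ} (hk : k ≤ n) (t : ℝ) :
    1 ≤ 2 * Real.exp (-(43 / 100) * lamk P X k * yt t ^ 2) := by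
  have h1 := H.lamk_le hk
  have h2 : yt t ^ 2 ≤ 4 := by nlinarith [yt_nonneg t, yt_le_two t]
  have h3 : lamk P X k * yt t ^ 2 ≤ 1 / 25 := by
    calc lamk P X k * yt t ^ 2 ≤ 1 / 100 * yt t ^ 2 := mul_le_mul_of_nonneg_right h1 (sq_nonneg _)
      _ ≤ _ := by linarith
  have h4 := Real.add_one_le_exp (-(43 / 100) * lamk P X k * yt t ^ 2)
  linarith

/-! ### Twisted derivatives -/

theorem yt_pos {t : ℝ} (ht : t ∈ Set.Icc (-Real.pi) Real.pi) (h0 : t ≠ 0) : 0 < yt t :=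
  lt_of_lt_of_le (by have := Real.pi_pos; positivity) (le_yt ht)

theorem norm_deriv_le_jn {f : ℝ → ℂ} {t : ℝ} (hy : 0 < yt t) :
    ‖deriv f t‖ ≤ 1000 / yt t * jn f t := by
  have h : 1000 / yt t * jn f t = 1000 / yt t * ‖f t‖ + ‖deriv f t‖ := by
    rw [jn]; field_simp
  have h2 : 0 ≤ 1000 / yt t * ‖f t‖ := by positivity
  linarith

/-- Since `e^{it} = 1 + z`, the derivative `iν e^{it} ψ` is the rotation `iνψ` and a part that is
small with `y`. -/
theorem psi_deriv (k : ℕ) (t : ℝ) :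
    ∃ a1 : ℂ, HasDerivAt (fun t => psi P X t k)
      (Complex.I * (nu P X 1 k : ℝ) * psi P X t k + a1) t ∧ ‖a1‖ ≤ nu P X 1 k * yt t := by
  have V0 := nu_nonneg (P := P) (X := X) 1 k
  refine ⟨(nu P X 1 k : ℂ) * (Complex.I * zt t) * psi P X t k, ?_, ?_⟩
  · refine (((hasDerivAt_zt t).const_mul (nu P X 1 k : ℂ)).cexp).congr_deriv ?_
    rw [psi_eq, zt]
    ring
  · have h1 : ‖psi P X t k‖ ≤ 1 := by
      rw [psi_eq, Complex.norm_exp, Complex.re_ofReal_mul, re_zt]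
      refine Real.exp_le_one_iff.2 ?_
      nlinarith [mul_nonneg V0 (sq_nonneg (yt t))]
    rw [norm_mul, norm_mul, norm_mul, Complex.norm_real, Complex.norm_I, one_mul, norm_zt,
      Real.norm_of_nonneg V0]
    exact mul_le_of_le_one_right (mul_nonneg V0 (yt_nonneg t)) h1

theorem abs_qk_le_sh (k : ℕ) : |qk P X k| ≤ 2 * sh (r0 P X) k := by
  have V0 := nu_nonneg (P := P) (X := X) 1 k
  have V0' := nu_nonneg (P := P) (X := X) 1 (k - 1)
  have n0 := nu_nonneg (P := P) (X := X) 2 k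
  have n0' := nu_nonneg (P := P) (X := X) 2 (k - 1)
  have m0 := mom2_nonneg (P := P) (X := X) k
  have m0' := mom2_nonneg (P := P) (X := X) (k - 1)
  have h := r0_nonneg (P := P) (X := X) (k - 2)
  have e : sh (r0 P X) k = (nu P X 2 k + nu P X 1 k ^ 2 + mom2 P X k) +
    (nu P X 2 (k - 1) + nu P X 1 (k - 1) ^ 2 + mom2 P X (k - 1)) + r0 P X (k - 2) := rfl
  have h1 := sq_nonneg (nu P X 1 k - nu P X 1 (k - 1))
  have h2 := mul_nonneg V0' V0
  have h3 := sq_nonneg (nu P X 1 k)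
  have h4 := sq_nonneg (nu P X 1 (k - 1))
  rw [qk_eq, e, abs_le]
  constructor <;> linarith

theorem Regular.lamk_ge (H : Regular P X n) {k : ℕ} (hk : k ≤ n) : -1 ≤ lamk P X k := by
  have h2 := H.nu2 k hk
  have h1 := H.nu_one_le hk
  have h3 := H.mom2_le_small hk
  have h0 := nu_nonneg (P := P) (X := X) 1 k
  rw [lamk]
  linarith

theorem Regular.g_deriv (H : Regular P X n) {k : ℕ} (hk : k ≤ n) (t : ℝ) :
    ∃ a1 : ℂ, HasDerivAt (fun t => g P X t k)
      (Complex.I * (nu P X 1 k : ℝ) * g P X t k + a1) t ∧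
      ‖a1‖ ≤ 100 * (yt t * (nu P X 1 k + sh (r0 P X) k)) := by
  have V0 := nu_nonneg (P := P) (X := X) 1 k
  have y0 := yt_nonneg t
  have hq := abs_qk_le_sh (P := P) (X := X) k
  refine ⟨((nu P X 1 k : ℂ) * (Complex.I * zt t) + (qk P X k : ℂ) *
    (2 * zt t * (Complex.I * Complex.exp (Complex.I * t)))) * g P X t k, ?_, ?_⟩
  · refine ((hasDerivAt_g_exponent k t).cexp).congr_deriv ?_
    rw [g_eq, zt]
    ring
  · have h1 : ‖g P X t k‖ ≤ 8 := by
      refine (H.norm_g_le hk t).trans ?_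
      have h2 : yt t ^ 2 ≤ 4 := by nlinarith [yt_le_two t]
      have h3 := H.lamk_ge hk
      have h4 : -(43 / 100) * lamk P X k * yt t ^ 2 ≤ 2 := by nlinarith [sq_nonneg (yt t)]
      refine (Real.exp_le_exp.2 h4).trans ?_
      have e1 : Real.exp 2 = Real.exp 1 * Real.exp 1 := by rw [← Real.exp_add]; norm_num
      nlinarith [Real.exp_one_lt_d9, Real.exp_pos 1]
    have h2 : ‖(nu P X 1 k : ℂ) * (Complex.I * zt t) + (qk P X k : ℂ) *
        (2 * zt t * (Complex.I * Complex.exp (Complex.I * t)))‖ ≤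
        yt t * (nu P X 1 k + 2 * |qk P X k|) := by
      refine (norm_add_le _ _).trans (le_of_eq ?_)
      simp only [norm_mul, Complex.norm_I, Complex.norm_real, norm_zt, norm_exp_I_mul,
        Real.norm_of_nonneg V0, Real.norm_eq_abs, Complex.norm_ofNat]
      ring
    rw [norm_mul]
    have h3 : yt t * (nu P X 1 k + 2 * |qk P X k|) ≤ yt t * (4 * (nu P X 1 k + sh (r0 P X) k)) := by
      gcongr; linarith
    calc _ ≤ yt t * (4 * (nu P X 1 k + sh (r0 P X) k)) * 8 :=
          mul_le_mul (h2.trans h3) h1 (norm_nonneg _) ((norm_nonneg _).trans (h2.trans h3))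
      _ ≤ _ := by
          have h4 : 0 ≤ yt t * (nu P X 1 k + sh (r0 P X) k) := by
            have := abs_nonneg (qk P X k)
            exact mul_nonneg y0 (by linarith)
          linarith

/-- Each second order quantity is at most linear in neighbouring means, so the twisted derivatives
sum to a multiple of `y Γ₁`. -/
theorem sum_r0_le_Gamma1 (H : Regular P X n) :
    ∑ k ∈ Finset.Icc 1 n, (nu P X 1 k + sh (r0 P X) k) ≤ 20 * Gamma1 P X n := by
  have h1 := sum_sh_le H.r0_zero (fun k => r0_nonneg (P := P) (X := X) k) n
  have h2 : ∑ k ∈ Finset.Icc 1 n, r0 P X k ≤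
      ∑ k ∈ Finset.Icc 1 n, (3 * nu P X 1 k + nu P X 1 (k - 1)) := by
    refine Finset.sum_le_sum fun k hk => ?_
    have hk := (Finset.mem_Icc.1 hk).2
    have V0 := nu_nonneg (P := P) (X := X) 1 k
    have a1 := H.nu2 k hk
    have a2 : nu P X 1 k ^ 2 ≤ 1 * nu P X 1 k := by
      rw [sq]; exact mul_le_mul_of_nonneg_right (by linarith [H.nu_one_le hk]) V0
    have a3 := H.mom2_le hk
    rw [r0]
    linarith
  have h3 := sum_shift_le (H.nu_zero (j := 1) le_rfl) (fun k => nu_nonneg (P := P) (X := X) 1 k) 1 n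
  rw [Finset.sum_add_distrib, ← Finset.mul_sum] at h2
  have h4 : 0 ≤ ∑ k ∈ Finset.Icc 1 n, nu P X 1 k := Finset.sum_nonneg fun k _ => nu_nonneg _ _
  rw [Finset.sum_add_distrib, Gamma1]
  linarith

/-- Bounds for the Bergström remainder and for its twisted derivative. -/
theorem Regular.brgRem_bounds (H : Regular P X n) {a : ℕ → ℝ → ℂ} {a1 : ℕ → ℂ} {δ : ℕ → ℝ} {t : ℝ}
    (hy : 0 < yt t)
    (ha : ∀ j ∈ Finset.Icc 1 n, ‖a j t‖ ≤ Real.exp (-(43 / 100) * lamk P X j * yt t ^ 2))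
    (ha' : ∀ j ∈ Finset.Icc 1 n, HasDerivAt (a j) (Complex.I * (nu P X 1 j : ℝ) * a j t + a1 j) t)
    (ha1 : ∀ j ∈ Finset.Icc 1 n, ‖a1 j‖ ≤ 100 * (yt t * (nu P X 1 j + sh (r0 P X) j)))
    (hd : ∀ j ∈ Finset.Icc 1 n, jn (fun t => ratio P X j t - a j t) t ≤ δ j) (r : ℕ) :
    ∃ D : ℂ, HasDerivAt (fun t => brgRem r n (fun j => ratio P X j t) (fun j => a j t))
        (Complex.I * (Gamma1 P X n : ℝ) *
          brgRem r n (fun j => ratio P X j t) (fun j => a j t) + D) t ∧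
      ‖D‖ ≤ Real.exp (-(43 / 100) * lam P X n * yt t ^ 2) *
        (2 * ∑ j ∈ Finset.Icc 1 n, δ j) ^ r *
        (10 ^ 9 * (yt t * Gamma1 P X n) + r * (1001 / yt t)) := by
  have y2 := yt_le_two t
  choose p1 hp1 hp1' using fun j => psi_deriv (P := P) (X := X) j t
  have hδ : ∀ j ∈ Finset.Icc 1 n, 0 ≤ δ j := fun j hj => (jn_nonneg _ _).trans (hd j hj)
  -- The twisted derivative is linear, so it can be read off the jet of `φ_j - b_j`: undoing the
  -- weight costs `1000/y`, and the rotation costs `ν_1 ≤ 1/y` more.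
  have twist : ∀ {b : ℕ → ℝ → ℂ} {b1 : ℕ → ℂ} {j : ℕ}, j ≤ n →
      HasDerivAt (b j) (Complex.I * (nu P X 1 j : ℝ) * b j t + b1 j) t →
      ‖(deriv (ratio P X j) t - Complex.I * (nu P X 1 j : ℝ) * ratio P X j t) - b1 j‖ ≤
        1001 / yt t * jn (fun t => ratio P X j t - b j t) t := by
    intro b b1 j hj hb
    have V0 := nu_nonneg (P := P) (X := X) 1 j
    have V1 := H.nu_one_le hj
    have hh : HasDerivAt (fun t => ratio P X j t - b j t)
        (deriv (ratio P X j) t - (Complex.I * (nu P X 1 j : ℝ) * b j t + b1 j)) t :=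
      (H.differentiable_ratio hj t).hasDerivAt.fun_sub hb
    have e : (deriv (ratio P X j) t - Complex.I * (nu P X 1 j : ℝ) * ratio P X j t) - b1 j =
        deriv (fun t => ratio P X j t - b j t) t -
          Complex.I * (nu P X 1 j : ℝ) * (ratio P X j t - b j t) := by
      rw [hh.deriv]; ring
    rw [e]
    refine (norm_sub_le _ _).trans ?_
    rw [norm_mul, norm_mul, Complex.norm_I, one_mul, Complex.norm_real, Real.norm_of_nonneg V0]
    have h1 := norm_deriv_le_jn (f := fun t => ratio P X j t - b j t) hy
    have h2 : nu P X 1 j * ‖ratio P X j t - b j t‖ ≤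
        1 / yt t * jn (fun t => ratio P X j t - b j t) t := by
      refine mul_le_mul ?_ (norm_le_jn (fun t => ratio P X j t - b j t) t) (norm_nonneg _)
        (by positivity)
      rw [le_div_iff₀ hy]
      nlinarith
    have h3 : 1001 / yt t * jn (fun t => ratio P X j t - b j t) t =
        1000 / yt t * jn (fun t => ratio P X j t - b j t) t +
          1 / yt t * jn (fun t => ratio P X j t - b j t) t := by ring
    linarith
  have hγ0 : ∀ j, 0 ≤ nu P X 1 j + sh (r0 P X) j := fun j => by
    have h1 := nu_nonneg (P := P) (X := X) 1 j
    have h2 := abs_nonneg (qk P X j)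
    have h3 := abs_qk_le_sh (P := P) (X := X) j
    linarith
  have key := exists_brgRem_deriv (N := n) (f := fun j => ratio P X j) (a := a)
    (f1 := fun j => deriv (ratio P X j) t - Complex.I * (nu P X 1 j : ℝ) * ratio P X j t) (a1 := a1)
    (ν := fun j => nu P X 1 j) (t := t)
    (e := fun j => Real.exp (-(43 / 100) * lamk P X j * yt t ^ 2)) (δ := δ)
    (γ := fun j => 2000000 * (yt t * (nu P X 1 j + sh (r0 P X) j))) (K := 2) (w := 1001 / yt t)
    (by norm_num) (by positivity)
    (fun j hj => ⟨(Real.exp_pos _).le, H.one_le_two_mul_exp_lamk (Finset.mem_Icc.1 hj).2 t⟩) hδ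
    (fun j hj => H.norm_ratio_le (Finset.mem_Icc.1 hj).1 (Finset.mem_Icc.1 hj).2 t) ha
    (fun j hj => (norm_le_jn (fun t => ratio P X j t - a j t) t).trans (hd j hj))
    (fun j hj => (H.differentiable_ratio (Finset.mem_Icc.1 hj).2 t).hasDerivAt.congr_deriv
      (by ring)) ha'
    (fun j hj => ?_) (fun j hj => (ha1 j hj).trans ?_)
    (fun j hj => (twist (Finset.mem_Icc.1 hj).2 (ha' j hj)).trans
      (mul_le_mul_of_nonneg_left (hd j hj) (by positivity))) r n le_rfl
  · obtain ⟨D, hD, hD'⟩ := key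
    refine ⟨D, hD, hD'.trans ?_⟩
    rw [H.prod_exp_lamk]
    have hs : 0 ≤ ∑ j ∈ Finset.Icc 1 n, δ j := Finset.sum_nonneg hδ
    refine mul_le_mul_of_nonneg_left ?_ (by positivity)
    rw [← Finset.mul_sum, ← Finset.mul_sum]
    have h1 := mul_le_mul_of_nonneg_left (sum_r0_le_Gamma1 H) hy.le
    have h2 : 0 ≤ yt t * Gamma1 P X n :=
      mul_nonneg hy.le (Finset.sum_nonneg fun k _ => nu_nonneg _ _)
    linarith
  -- The twisted derivative of `φ_j` itself is found by comparison with `ψ_j`, whichever family `a`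
  -- is used: `1001/y` times a jet of order `y²` leaves one power of `y`.
  · have hj2 := (Finset.mem_Icc.1 hj).2
    have V0 := nu_nonneg (P := P) (X := X) 1 j
    have h1 := twist (b := fun j t => psi P X t j) hj2 (hp1 j)
    have h2 := H.jn_ratio_sub_psi_le hj2 t
    have h3 := norm_le_norm_sub_add (deriv (ratio P X j) t -
      Complex.I * (nu P X 1 j : ℝ) * ratio P X j t) (p1 j)
    have h4 : 1001 / yt t * jn (fun t => ratio P X j t - psi P X t j) t ≤
        1001 / yt t * (1000 * (yt t ^ 2 * sh (r0 P X) j)) := by gcongr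
    have h5 : 1001 / yt t * (1000 * (yt t ^ 2 * sh (r0 P X) j)) =
        1001000 * (yt t * sh (r0 P X) j) := by field_simp; ring
    have h6 : 0 ≤ yt t * sh (r0 P X) j := by
      have := abs_nonneg (qk P X j)
      have := abs_qk_le_sh (P := P) (X := X) j
      exact mul_nonneg hy.le (by linarith)
    have h7 := mul_nonneg hy.le V0
    have h8 := hp1' j
    have h9 : yt t * (nu P X 1 j + sh (r0 P X) j) = yt t * nu P X 1 j + yt t * sh (r0 P X) j := by ring
    linarith
  · have := mul_nonneg hy.le (hγ0 j)
    linarith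

theorem Regular.norm_brgRem_ratio_le (H : Regular P X n) {a : ℕ → ℂ} {δ : ℕ → ℝ} {t : ℝ}
    (ha : ∀ j ∈ Finset.Icc 1 n, ‖a j‖ ≤ Real.exp (-(43 / 100) * lamk P X j * yt t ^ 2))
    (hd : ∀ j ∈ Finset.Icc 1 n, ‖ratio P X j t - a j‖ ≤ δ j) (r : ℕ) :
    ‖brgRem r n (fun j => ratio P X j t) a‖ ≤
      Real.exp (-(43 / 100) * lam P X n * yt t ^ 2) * (2 * ∑ j ∈ Finset.Icc 1 n, δ j) ^ r := by
  rw [← H.prod_exp_lamk]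
  exact norm_brgRem_le (N := n) (by norm_num)
    (fun j hj => ⟨(Real.exp_pos _).le, H.one_le_two_mul_exp_lamk (Finset.mem_Icc.1 hj).2 t⟩)
    (fun j hj => (norm_nonneg _).trans (hd j hj))
    (fun j hj => H.norm_ratio_le (Finset.mem_Icc.1 hj).1 (Finset.mem_Icc.1 hj).2 t) ha hd r n le_rfl

end

section

/-! ### From bounds on the Fourier transform to bounds on the norms -/

/-- The decay rate of the Gaussian majorant. -/
def gRate : ℝ := 43 / 25 / Real.pi ^ 2

theorem gRate_pos : 0 < gRate := by
  have := Real.pi_pos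
  rw [gRate]; positivity

/-- Uses `y ≥ 2|t|/π`. With `b = max(1, √l)` one majorant serves all `l`: for `l ≤ 1` the Gaussian
of width one is bounded below on `[-π, π]`, and `exp 2` compensates since `0.43 · 4 < 2`. -/
theorem exp_neg_le_gaussian {l t : ℝ} (hl : 0 < l) (ht : t ∈ Set.Icc (-Real.pi) Real.pi) :
    Real.exp (-(43 / 100) * l * yt t ^ 2) ≤
      Real.exp 2 * Real.exp (-gRate * (max 1 (Real.sqrt l) * t) ^ 2) := by
  have hpi := Real.pi_pos
  rw [← Real.exp_add, Real.exp_le_exp]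
  have h1 : 4 / Real.pi ^ 2 * t ^ 2 ≤ yt t ^ 2 := by
    have h := le_yt ht
    calc 4 / Real.pi ^ 2 * t ^ 2 = (2 / Real.pi * |t|) ^ 2 := by
          rw [mul_pow, sq_abs]; ring
      _ ≤ _ := by gcongr
  have h2 : gRate * t ^ 2 = 43 / 100 * (4 / Real.pi ^ 2 * t ^ 2) := by rw [gRate]; ring
  rcases le_total 1 l with h | h
  · have hb : max 1 (Real.sqrt l) = Real.sqrt l := max_eq_right (Real.one_le_sqrt.2 h)
    rw [hb, mul_pow, Real.sq_sqrt hl.le]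
    have h3 := mul_le_mul_of_nonneg_left h1 hl.le
    have h4 : gRate * (l * t ^ 2) = 43 / 100 * (l * (4 / Real.pi ^ 2 * t ^ 2)) := by
      rw [gRate]; ring
    linarith
  · have hb : max 1 (Real.sqrt l) = 1 := max_eq_left (Real.sqrt_le_one.2 h)
    rw [hb, one_mul]
    have h3 : t ^ 2 ≤ Real.pi ^ 2 := sq_le_sq' ht.1 ht.2
    have h4 : 4 / Real.pi ^ 2 * t ^ 2 ≤ 4 := by
      rw [div_mul_eq_mul_div, div_le_iff₀ (by positivity)]
      linarith
    have h5 : 0 ≤ l * yt t ^ 2 := by positivity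
    linarith

theorem quadratic_le_sq {u v w d x : ℝ} (hu : 0 ≤ u) (hv : 0 ≤ v) (hw : 0 ≤ w) (hd : 0 ≤ d)
    (hx : 0 ≤ x) : u + v * x ^ 2 + w ≤ ((u + v + w + 1 + d) * (1 + x)) ^ 2 := by
  have a1 : 1 ≤ (1 + x) ^ 2 := one_le_pow₀ (by linarith)
  have a2 : x ^ 2 ≤ (1 + x) ^ 2 := by gcongr; linarith
  have h1 : u * 1 ≤ u * (1 + x) ^ 2 := by gcongr
  have h2 : v * x ^ 2 ≤ v * (1 + x) ^ 2 := by gcongr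
  have h3 : w * 1 ≤ w * (1 + x) ^ 2 := by gcongr
  have h4 : u + v + w ≤ (u + v + w + 1 + d) ^ 2 := by
    have : u + v + w + 1 + d ≤ (u + v + w + 1 + d) ^ 2 := le_self_pow₀ (by linarith) (by norm_num)
    linarith
  rw [mul_pow]
  have h5 : (u + v + w) * (1 + x) ^ 2 ≤ (u + v + w + 1 + d) ^ 2 * (1 + x) ^ 2 := by gcongr
  linarith

-- The majorants of `h` and of its twisted derivative are powers of `|t|` times a Gaussian of width
-- `1/b`. In the weighted inequality centred at `Γ`, the factors of `b` balance to `b^{-2(p+1)}`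
-- times `O((1 + Γ/b²)²)`. The exponent is written `p + 1` so that the division by `y` in the
-- derivative bound is harmless at `0`.
set_option maxHeartbeats 1000000 in
theorem exists_norm_invFourier_bounds (p r : ℕ) :
    ∃ C : ℝ, 0 < C ∧ ∀ (A Γ l : ℝ) (h : ℝ → ℂ), 0 ≤ A → 0 ≤ Γ → 0 < l → Differentiable ℝ h →
      h (-Real.pi) = h Real.pi →
      (∀ t ∈ Set.Icc (-Real.pi) Real.pi,
        ‖h t‖ ≤ Real.exp (-(43 / 100) * l * yt t ^ 2) * (A * yt t ^ (p + 1))) →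
      (∀ t ∈ Set.Icc (-Real.pi) Real.pi, t ≠ 0 → ‖deriv h t - Complex.I * Γ * h t‖ ≤
        Real.exp (-(43 / 100) * l * yt t ^ 2) * (A * yt t ^ (p + 1)) *
          (10 ^ 9 * (yt t * Γ) + r * (1001 / yt t))) →
      (∀ S : Finset ℤ, ∑ k ∈ S, ‖invFourier h k‖ ≤
        C * A * (1 + Γ * (max 1 (Real.sqrt l) ^ 2)⁻¹) * (max 1 (Real.sqrt l) ^ (p + 1))⁻¹) ∧
      ∀ k, ‖invFourier h k‖ ≤ C * A * (max 1 (Real.sqrt l) ^ (p + 2))⁻¹ := by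
  have hpi := Real.pi_pos
  have hc := gRate_pos
  obtain ⟨K1, hK1, H1⟩ := exists_integral_gaussian_le (2 * p + 2) (mul_pos two_pos hc)
  obtain ⟨K2, hK2, H2⟩ := exists_integral_gaussian_le (2 * p + 4) (mul_pos two_pos hc)
  obtain ⟨K3, hK3, H3⟩ := exists_integral_gaussian_le (2 * p) (mul_pos two_pos hc)
  obtain ⟨K4, hK4, H4⟩ := exists_integral_gaussian_le (p + 1) hc
  set e2 := Real.exp 2 with he2
  have he2p : 0 < e2 := Real.exp_pos 2
  set M : ℝ := 3 / 2 * e2 ^ 2 * K1 + 3 * e2 ^ 2 * ((10 ^ 9) ^ 2 * K2 + (r * 1001) ^ 2 * K3) with hM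
  have hM0 : 0 ≤ M := by positivity
  refine ⟨M + 1 + e2 * K4, by positivity, fun A Γ l h hA hΓ hl hd hper hU hW => ?_⟩
  set b := max 1 (Real.sqrt l) with hb
  have hb1 : 1 ≤ b := le_max_left _ _
  have hb0 : 0 < b := by linarith
  set E : ℝ → ℝ := fun t => Real.exp (-gRate * (b * t) ^ 2) with hE
  have hE0 : ∀ t, 0 < E t := fun t => Real.exp_pos _
  have hEc : Continuous E := by fun_prop
  have hE2 : ∀ t, E t ^ 2 = Real.exp (-(2 * gRate) * (b * t) ^ 2) := fun t => by
    simp only [hE]; rw [← Real.exp_nat_mul]; congr 1; push_cast; ring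
  have hexp : ∀ t ∈ Set.Icc (-Real.pi) Real.pi,
      Real.exp (-(43 / 100) * l * yt t ^ 2) ≤ e2 * E t := fun t ht => exp_neg_le_gaussian hl ht
  set U : ℝ → ℝ := fun t => A * e2 * (|t| ^ (p + 1) * E t) with hUdef
  set W : ℝ → ℝ := fun t => A * e2 * ((10 ^ 9 * Γ * |t| ^ (p + 2) + r * 1001 * |t| ^ p) * E t) with hWdef
  have hUc : Continuous U := by fun_prop
  have hWc : Continuous W := by fun_prop
  have hU' : ∀ t ∈ Set.Icc (-Real.pi) Real.pi, ‖h t‖ ≤ U t := fun t ht => by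
    have y0 := yt_nonneg t
    have y1 := yt_le_abs t
    refine (hU t ht).trans ?_
    calc _ ≤ e2 * E t * (A * |t| ^ (p + 1)) := by
          have := hexp t ht
          gcongr
      _ = _ := by rw [hUdef]; ring
  have hW' : ∀ t ∈ Set.Icc (-Real.pi) Real.pi, t ≠ 0 → ‖deriv h t - Complex.I * Γ * h t‖ ≤ W t :=
    fun t ht h0 => by
    have y0 := yt_pos ht h0
    have y1 := yt_le_abs t
    refine (hW t ht h0).trans ?_
    have e : Real.exp (-(43 / 100) * l * yt t ^ 2) * (A * yt t ^ (p + 1)) *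
          (10 ^ 9 * (yt t * Γ) + r * (1001 / yt t)) =
        Real.exp (-(43 / 100) * l * yt t ^ 2) *
          (A * (10 ^ 9 * Γ * yt t ^ (p + 2) + r * 1001 * yt t ^ p)) := by
      field_simp
      ring
    rw [e]
    calc _ ≤ e2 * E t * (A * (10 ^ 9 * Γ * |t| ^ (p + 2) + r * 1001 * |t| ^ p)) := by
          have := hexp t ht
          gcongr
      _ = _ := by rw [hWdef]; ring
  have hii : ∀ f : ℝ → ℝ, Continuous f → IntervalIntegrable f volume (-Real.pi) Real.pi :=
    fun f hf => hf.intervalIntegrable _ _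
  have iU : ∫ t in (-Real.pi)..Real.pi, U t ^ 2 ≤ A ^ 2 * e2 ^ 2 * (K1 * (b ^ (2 * p + 3))⁻¹) := by
    have e : ∀ t, U t ^ 2 = A ^ 2 * e2 ^ 2 *
        (|t| ^ (2 * p + 2) * Real.exp (-(2 * gRate) * (b * t) ^ 2)) := fun t => by
      rw [← hE2, hUdef]; ring
    simp_rw [e]
    rw [intervalIntegral.integral_const_mul]
    exact mul_le_mul_of_nonneg_left (H1 b hb0) (by positivity)
  have iW : ∫ t in (-Real.pi)..Real.pi, W t ^ 2 ≤ 2 * A ^ 2 * e2 ^ 2 *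
      ((10 ^ 9 * Γ) ^ 2 * (K2 * (b ^ (2 * p + 5))⁻¹) + (r * 1001) ^ 2 * (K3 * (b ^ (2 * p + 1))⁻¹)) := by
    have e : ∀ t, W t ^ 2 ≤ 2 * A ^ 2 * e2 ^ 2 * ((10 ^ 9 * Γ) ^ 2 *
          (|t| ^ (2 * p + 4) * Real.exp (-(2 * gRate) * (b * t) ^ 2)) +
        (r * 1001) ^ 2 * (|t| ^ (2 * p) * Real.exp (-(2 * gRate) * (b * t) ^ 2))) := fun t => by
      rw [← hE2, hWdef]
      have h1 : (10 ^ 9 * Γ * |t| ^ (p + 2) + r * 1001 * |t| ^ p) ^ 2 ≤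
        2 * ((10 ^ 9 * Γ * |t| ^ (p + 2)) ^ 2 + (r * 1001 * |t| ^ p) ^ 2) := add_sq_le
      have h2 := mul_le_mul_of_nonneg_left h1 (by positivity : 0 ≤ A ^ 2 * e2 ^ 2 * E t ^ 2)
      refine le_trans (le_of_eq ?_) (h2.trans (le_of_eq ?_)) <;> ring
    refine (intervalIntegral.integral_mono_on (by linarith) (hii _ (by fun_prop))
      (hii _ (by fun_prop)) fun t _ => e t).trans ?_
    rw [intervalIntegral.integral_const_mul, intervalIntegral.integral_add
      (hii _ (by fun_prop)) (hii _ (by fun_prop)), intervalIntegral.integral_const_mul,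
      intervalIntegral.integral_const_mul]
    have h1 := H2 b hb0
    have h2 := H3 b hb0
    gcongr
  constructor
  · intro S
    have h1 := sq_sum_norm_invFourier_le hd hper Γ hb1 hUc hWc hU' hW' S
    have hx : 0 ≤ Γ * (b ^ 2)⁻¹ := by positivity
    have h2 : 3 / 2 * b * ((∫ t in (-Real.pi)..Real.pi, U t ^ 2) +
        (b ^ 2)⁻¹ * ∫ t in (-Real.pi)..Real.pi, W t ^ 2) ≤
        3 / 2 * b * (A ^ 2 * e2 ^ 2 * (K1 * (b ^ (2 * p + 3))⁻¹) +
        (b ^ 2)⁻¹ * (2 * A ^ 2 * e2 ^ 2 *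
      ((10 ^ 9 * Γ) ^ 2 * (K2 * (b ^ (2 * p + 5))⁻¹) +
        (r * 1001) ^ 2 * (K3 * (b ^ (2 * p + 1))⁻¹)))) := by gcongr
    -- Counting powers: `b · b^{-(2p+3)}` and `b⁻¹ · b^{-(2p+1)}` both equal `b^{-2(p+1)}`, and the
    -- part with `Γ²` has `b⁻¹ · b^{-(2p+5)}`, that is, an additional `b⁻⁴`.
    have h3 : 3 / 2 * b * (A ^ 2 * e2 ^ 2 * (K1 * (b ^ (2 * p + 3))⁻¹) +
        (b ^ 2)⁻¹ * (2 * A ^ 2 * e2 ^ 2 *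
      ((10 ^ 9 * Γ) ^ 2 * (K2 * (b ^ (2 * p + 5))⁻¹) +
        (r * 1001) ^ 2 * (K3 * (b ^ (2 * p + 1))⁻¹)))) =
        (A * (b ^ (p + 1))⁻¹) ^ 2 * (3 / 2 * e2 ^ 2 * K1 + 3 * e2 ^ 2 * ((10 ^ 9) ^ 2 * K2 *
          (Γ * (b ^ 2)⁻¹) ^ 2 + (r * 1001) ^ 2 * K3)) := by
      have e1 : b ^ (2 * p + 3) = b * (b ^ (p + 1)) ^ 2 := by ring
      have e2' : b ^ (2 * p + 5) = b ^ 3 * (b ^ (p + 1)) ^ 2 := by ring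
      have e3 : b * (b ^ (2 * p + 1)) = (b ^ (p + 1)) ^ 2 := by ring
      have e4 : (b ^ (2 * p + 1))⁻¹ = b * ((b ^ (p + 1)) ^ 2)⁻¹ := by
        rw [← e3]; field_simp
      rw [e1, e2', e4]
      have : b ^ (p + 1) ≠ 0 := by positivity
      field_simp
    set x := Γ * (b ^ 2)⁻¹
    have h4 : 3 / 2 * e2 ^ 2 * K1 + 3 * e2 ^ 2 * ((10 ^ 9) ^ 2 * K2 * x ^ 2 + (r * 1001) ^ 2 * K3) ≤
        ((M + 1 + e2 * K4) * (1 + x)) ^ 2 := by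
      have h := quadratic_le_sq (u := 3 / 2 * e2 ^ 2 * K1) (v := 3 * e2 ^ 2 * ((10 ^ 9) ^ 2 * K2))
        (w := 3 * e2 ^ 2 * ((r * 1001) ^ 2 * K3)) (d := e2 * K4) (by positivity) (by positivity)
        (by positivity) (by positivity) hx
      rw [hM]
      refine le_trans (le_of_eq ?_) (h.trans (le_of_eq ?_)) <;> ring
    have h5 : (∑ k ∈ S, ‖invFourier h k‖) ^ 2 ≤
        (A * (b ^ (p + 1))⁻¹ * ((M + 1 + e2 * K4) * (1 + x))) ^ 2 := by
      rw [mul_pow _ ((M + 1 + e2 * K4) * (1 + x))]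
      refine h1.trans (h2.trans (h3.le.trans ?_))
      gcongr
    have h6 := abs_le_of_sq_le_sq h5 (by positivity)
    refine (le_abs_self _).trans (h6.trans (le_of_eq ?_))
    ring
  · intro k
    refine (norm_invFourier_le hUc hU' k).trans ?_
    have h1 : ∫ t in (-Real.pi)..Real.pi, U t ≤ A * e2 * (K4 * (b ^ (p + 2))⁻¹) := by
      simp only [hUdef]
      rw [intervalIntegral.integral_const_mul]
      exact mul_le_mul_of_nonneg_left (H4 b hb0) (by positivity)
    have h2 : 1 / (2 * Real.pi) ≤ 1 := by
      rw [div_le_one (by positivity)]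
      linarith [Real.pi_gt_three]
    have h0 : 0 ≤ A * e2 * (K4 * (b ^ (p + 2))⁻¹) := by positivity
    calc _ ≤ 1 / (2 * Real.pi) * (A * e2 * (K4 * (b ^ (p + 2))⁻¹)) := by gcongr
      _ ≤ 1 * (A * e2 * (K4 * (b ^ (p + 2))⁻¹)) := by gcongr
      _ = e2 * K4 * A * (b ^ (p + 2))⁻¹ := by ring
      _ ≤ _ := by gcongr; linarith

theorem inv_pow_max_sqrt_le {l : ℝ} (hl : 0 < l) (m : ℕ) :
    (max 1 (Real.sqrt l) ^ m)⁻¹ ≤ min 1 (l ^ (-(m : ℝ) / 2)) := by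
  have h1 : 1 ≤ max 1 (Real.sqrt l) := le_max_left _ _
  refine le_min (inv_le_one_of_one_le₀ (one_le_pow₀ h1)) ?_
  have h2 : l ^ (-(m : ℝ) / 2) = (Real.sqrt l ^ m)⁻¹ := by
    rw [Real.sqrt_eq_rpow, ← Real.rpow_natCast, ← Real.rpow_mul hl.le, ← Real.rpow_neg hl.le]
    congr 1; ring
  rw [h2]
  have h3 : 0 < Real.sqrt l := Real.sqrt_pos.2 hl
  have h4 : Real.sqrt l ≤ max 1 (Real.sqrt l) := le_max_right _ _
  gcongr

theorem tvNorm_le {M : ℤ → ℂ} {B : ℝ} (h : ∀ S : Finset ℤ, ∑ k ∈ S, ‖M k‖ ≤ B) :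
    tvNorm M ≤ ENNReal.ofReal B := by
  rw [tvNorm, ENNReal.tsum_eq_iSup_sum]
  refine iSup_le fun S => ?_
  have e : ∑ k ∈ S, ‖M k‖ₑ = ENNReal.ofReal (∑ k ∈ S, ‖M k‖) := by
    rw [ENNReal.ofReal_sum_of_nonneg fun k _ => norm_nonneg _]
    simp
  rw [e]
  exact ENNReal.ofReal_le_ofReal (h S)

theorem localNorm_le {M : ℤ → ℂ} {B : ℝ} (h : ∀ k, ‖M k‖ ≤ B) :
    localNorm M ≤ ENNReal.ofReal B := by
  refine iSup_le fun k => ?_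
  rw [← ofReal_norm]
  exact ENNReal.ofReal_le_ofReal (h k)

end

section

variable {Ω : Type*} [MeasurableSpace Ω] {P : Measure Ω} [IsProbabilityMeasure P]
  {X : ℕ → Ω → ℕ} {n : ℕ}

/-! ### The errors as inverse Fourier transforms of Bergström remainders -/

theorem invFourier_sub {u v : ℝ → ℂ} (hu : Continuous u) (hv : Continuous v) (k : ℤ) :
    invFourier (fun t => u t - v t) k = invFourier u k - invFourier v k := by
  simp only [invFourier]
  rw [← mul_sub, ← intervalIntegral.integral_sub
    (Continuous.intervalIntegrable (by fun_prop) _ _)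
    (Continuous.intervalIntegrable (by fun_prop) _ _)]
  simp only [mul_sub]

theorem brgSum_congr {l : ℕ} {f f' a : ℕ → ℂ} (h : ∀ j ∈ Finset.Icc 1 n, f j = f' j) :
    brgSum n l f a = brgSum n l f' a := by
  refine Finset.sum_congr rfl fun A hA => ?_
  rw [Finset.mem_powersetCard] at hA
  congr 1
  exact Finset.prod_congr rfl fun j hj => by rw [h j (hA.1 hj)]

theorem continuous_brgSum {l : ℕ} {f a : ℕ → ℝ → ℂ} (hf : ∀ j ∈ Finset.Icc 1 n, Continuous (f j))
    (ha : ∀ j, Continuous (a j)) :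
    Continuous fun t => brgSum n l (fun j => f j t) (fun j => a j t) := by
  refine continuous_finsetSum _ fun A hA => ?_
  rw [Finset.mem_powersetCard] at hA
  exact (continuous_finsetProd _ fun j _ => ha j).mul
    (continuous_finsetProd _ fun j hj => (hf j (hA.1 hj)).sub (ha j))

theorem brgRem_succ (s : ℕ) (f a : ℕ → ℂ) :
    brgRem (s + 1) n f a = brgRem s n f a - brgSum n s f a := by
  rw [brgRem, brgRem, Finset.sum_range_succ]
  ring

theorem continuous_brgRem {s : ℕ} {f a : ℕ → ℝ → ℂ} (hf : ∀ j ∈ Finset.Icc 1 n, Continuous (f j))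
    (ha : ∀ j, Continuous (a j)) :
    Continuous fun t => brgRem s n (fun j => f j t) (fun j => a j t) :=
  (continuous_finsetProd _ fun j hj => hf j hj).sub
    (continuous_finsetSum _ fun _ _ => continuous_brgSum hf ha)

theorem Regular.lawF_eq (H : Regular P X n) (k : ℤ) :
    (lawF P X n k : ℂ) = invFourier (cF P X n) k := by
  have hS : Measurable fun ω => ∑ i ∈ Finset.Icc 1 n, X i ω :=
    Finset.measurable_fun_sum _ fun i hi => H.meas i (Finset.mem_Icc.1 hi).2
  rw [lawF, measureReal_eq_invFourier hS, funext fun t => cF_eq (P := P) (X := X) n t]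

/-- The Bergström sum of order zero is `∏ a_j`, the transform of the approximating measure `Q`; each
further term removes one more order, by linearity of the inversion. -/
theorem Regular.err_eq (H : Regular P X n) {a : ℕ → ℝ → ℂ} (ha : ∀ j, Continuous (a j)) (Q : ℤ → ℝ)
    (hQ : ∀ k, (Q k : ℂ) = invFourier (fun t => ∏ j ∈ Finset.Icc 1 n, a j t) k) (s : ℕ) (k : ℤ) :
    (lawF P X n k : ℂ) - Q k -
      ∑ l ∈ Finset.Icc 1 s, invFourier (fun t => brgSum n l (phi P X t) (fun j => a j t)) k =
    invFourier (fun t => brgRem (s + 1) n (fun j => ratio P X j t) (fun j => a j t)) k := by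
  have hf : ∀ j ∈ Finset.Icc 1 n, Continuous (ratio P X j) := fun j hj =>
    (H.differentiable_ratio (Finset.mem_Icc.1 hj).2).continuous
  induction s with
  | zero =>
    have e : (fun t => brgRem (0 + 1) n (fun j => ratio P X j t) (fun j => a j t)) = fun t =>
        cF P X n t - ∏ j ∈ Finset.Icc 1 n, a j t := by
      funext t
      rw [brgRem_succ, brgRem_zero, brgSum_zero, H.prod_ratio t le_rfl]
    rw [e, invFourier_sub (H.differentiable_cF le_rfl).continuous
      (continuous_finsetProd _ fun j _ => ha j), hQ, H.lawF_eq]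
    simp
  | succ s ih =>
    rw [Finset.sum_Icc_succ_top (by omega), ← sub_sub, ih]
    have e : (fun t => brgSum n (s + 1) (phi P X t) (fun j => a j t)) = fun t =>
        brgSum n (s + 1) (fun j => ratio P X j t) (fun j => a j t) := by
      funext t
      exact brgSum_congr fun j hj =>
        H.phi_eq_ratio t (Finset.mem_Icc.1 hj).1 (Finset.mem_Icc.1 hj).2
    rw [e, ← invFourier_sub (continuous_brgRem hf ha) (continuous_brgSum hf ha)]
    congr 1
    funext t
    rw [brgRem_succ (s + 1)]

theorem pois_eq (k : ℤ) :
    (pois P X n k : ℂ) = invFourier (fun t => ∏ j ∈ Finset.Icc 1 n, psi P X t j) k := by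
  rw [pois, convExp_eq_invFourier]
  congr 1
  funext t
  rw [map_smul, hat_U]
  simp only [psi]
  rw [← Complex.exp_sum, ← Finset.sum_mul, Gamma1, Complex.real_smul]
  push_cast
  rfl

theorem Regular.Gamma2_eq (H : Regular P X n) :
    Gamma2 P X n = ∑ j ∈ Finset.Icc 1 n, qk P X j := by
  have h : ∑ k ∈ Finset.Icc 2 n, wE P [rv X (k - 1), rv X k] =
      ∑ k ∈ Finset.Icc 1 n, wE P [rv X (k - 1), rv X k] := by
    refine Finset.sum_subset (Finset.Icc_subset_Icc_left (by norm_num)) fun k hk hk2 => ?_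
    simp only [Finset.mem_Icc] at hk hk2
    obtain rfl : k = 1 := by omega
    simp [wE_pair, H.rv_zero]
  rw [Gamma2, h]
  simp only [qk]
  rw [Finset.sum_add_distrib, Finset.mul_sum]
  congr 1
  exact Finset.sum_congr rfl fun k _ => by ring

theorem Regular.lawG_eq (H : Regular P X n) (k : ℤ) :
    (lawG P X n k : ℂ) = invFourier (fun t => ∏ j ∈ Finset.Icc 1 n, g P X t j) k := by
  rw [lawG, convExp_eq_invFourier]
  congr 1
  funext t
  rw [map_add, map_smul, map_smul, map_pow, hat_U]
  simp only [g_eq]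
  rw [← Complex.exp_sum, Finset.sum_add_distrib, ← Finset.sum_mul, ← Finset.sum_mul, Gamma1,
    H.Gamma2_eq, Complex.real_smul, Complex.real_smul, zt]
  push_cast
  rfl

/-! ### Periodicity -/

theorem exp_I_mul_neg_pi :
    Complex.exp (Complex.I * ((-Real.pi : ℝ) : ℂ)) = Complex.exp (Complex.I * (Real.pi : ℂ)) := by
  rw [mul_comm, mul_comm Complex.I, Complex.exp_pi_mul_I, Complex.ofReal_neg, neg_mul,
    Complex.exp_neg, Complex.exp_pi_mul_I]
  norm_num

theorem zt_neg_pi : zt (-Real.pi) = zt Real.pi := by rw [zt, zt, exp_I_mul_neg_pi]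

theorem cF_neg_pi (k : ℕ) : cF P X k (-Real.pi) = cF P X k Real.pi := by
  rw [cF_eq, cF_eq]
  congr 1
  funext ω
  rw [exp_I_mul_nat, exp_I_mul_nat, exp_I_mul_neg_pi]

theorem ratio_neg_pi (k : ℕ) : ratio P X k (-Real.pi) = ratio P X k Real.pi := by
  rw [ratio, ratio, cF_neg_pi, cF_neg_pi]

theorem psi_neg_pi (k : ℕ) : psi P X (-Real.pi) k = psi P X Real.pi k := by
  rw [psi_eq, psi_eq, zt_neg_pi]

theorem g_neg_pi (k : ℕ) : g P X (-Real.pi) k = g P X Real.pi k := by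
  rw [g_eq, g_eq, zt_neg_pi]

/-! ### The estimates -/

/-- The remainder of the Bergström expansion satisfies the hypotheses of
`exists_norm_invFourier_bounds`. -/
theorem Regular.invFourier_brgRem_bounds (H : Regular P X n) (hl : 0 < lam P X n) {p m s : ℕ}
    (hp : p + 1 = m * (s + 1)) {C : ℝ}
    (hC : ∀ (A Γ l : ℝ) (h : ℝ → ℂ), 0 ≤ A → 0 ≤ Γ → 0 < l → Differentiable ℝ h →
      h (-Real.pi) = h Real.pi →
      (∀ t ∈ Set.Icc (-Real.pi) Real.pi,
        ‖h t‖ ≤ Real.exp (-(43 / 100) * l * yt t ^ 2) * (A * yt t ^ (p + 1))) →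
      (∀ t ∈ Set.Icc (-Real.pi) Real.pi, t ≠ 0 → ‖deriv h t - Complex.I * Γ * h t‖ ≤
        Real.exp (-(43 / 100) * l * yt t ^ 2) * (A * yt t ^ (p + 1)) *
          (10 ^ 9 * (yt t * Γ) + (s + 1 : ℕ) * (1001 / yt t))) →
      (∀ S : Finset ℤ, ∑ k ∈ S, ‖invFourier h k‖ ≤
        C * A * (1 + Γ * (max 1 (Real.sqrt l) ^ 2)⁻¹) * (max 1 (Real.sqrt l) ^ (p + 1))⁻¹) ∧
      ∀ k, ‖invFourier h k‖ ≤ C * A * (max 1 (Real.sqrt l) ^ (p + 2))⁻¹)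
    {a : ℕ → ℝ → ℂ} {r : ℕ → ℝ} {c : ℝ} (hc : 0 ≤ c) (h0 : r 0 = 0) (hr : ∀ k, 0 ≤ r k)
    (hper : ∀ j, a j (-Real.pi) = a j Real.pi) (had : ∀ j, Differentiable ℝ (a j))
    (ha : ∀ t, ∀ j ∈ Finset.Icc 1 n, ‖a j t‖ ≤ Real.exp (-(43 / 100) * lamk P X j * yt t ^ 2))
    (ha' : ∀ t, ∀ j ∈ Finset.Icc 1 n, ∃ a1 : ℂ,
      HasDerivAt (a j) (Complex.I * (nu P X 1 j : ℝ) * a j t + a1) t ∧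
        ‖a1‖ ≤ 100 * (yt t * (nu P X 1 j + sh (r0 P X) j)))
    (hd : ∀ t, ∀ j ∈ Finset.Icc 1 n,
      jn (fun t => ratio P X j t - a j t) t ≤ c * (yt t ^ m * sh r j)) :
    (∀ S : Finset ℤ, ∑ k ∈ S,
      ‖invFourier (fun t => brgRem (s + 1) n (fun j => ratio P X j t) (fun j => a j t)) k‖ ≤
        C * (6 * c * ∑ k ∈ Finset.Icc 1 n, r k) ^ (s + 1) *
          (1 + Gamma1 P X n * (max 1 (Real.sqrt (lam P X n)) ^ 2)⁻¹) *
          (max 1 (Real.sqrt (lam P X n)) ^ (p + 1))⁻¹) ∧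
      ∀ k, ‖invFourier (fun t => brgRem (s + 1) n (fun j => ratio P X j t) (fun j => a j t)) k‖ ≤
        C * (6 * c * ∑ k ∈ Finset.Icc 1 n, r k) ^ (s + 1) *
          (max 1 (Real.sqrt (lam P X n)) ^ (p + 2))⁻¹ := by
  have hR : 0 ≤ ∑ k ∈ Finset.Icc 1 n, r k := Finset.sum_nonneg fun k _ => hr k
  have hΓ : 0 ≤ Gamma1 P X n := Finset.sum_nonneg fun k _ => nu_nonneg _ _
  have hsum0 : ∀ t, 0 ≤ ∑ j ∈ Finset.Icc 1 n, c * (yt t ^ m * sh r j) := fun t =>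
    Finset.sum_nonneg fun j hj => (jn_nonneg _ _).trans (hd t j hj)
  -- The constant is `6c = 2 · 3 · c`: the factor `K = 2`, and the three shifts in `sh`.
  have hsum : ∀ t, (2 * ∑ j ∈ Finset.Icc 1 n, c * (yt t ^ m * sh r j)) ^ (s + 1) ≤
      (6 * c * ∑ k ∈ Finset.Icc 1 n, r k) ^ (s + 1) * yt t ^ (p + 1) := fun t => by
    have y0 := yt_nonneg t
    rw [hp, pow_mul, ← mul_pow]
    refine pow_le_pow_left₀ (mul_nonneg (by norm_num) (hsum0 t)) ?_ _
    rw [← Finset.mul_sum, ← Finset.mul_sum]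
    have h1 := mul_le_mul_of_nonneg_left (sum_sh_le h0 hr n)
      (by positivity : 0 ≤ 2 * c * yt t ^ m)
    linarith
  have hfd : ∀ j ∈ Finset.Icc 1 n, Differentiable ℝ (ratio P X j) := fun j hj =>
    H.differentiable_ratio (Finset.mem_Icc.1 hj).2
  refine hC _ _ _ _ (by positivity) hΓ hl ?_ ?_ (fun t ht => ?_) (fun t ht ht0 => ?_)
  · refine Differentiable.fun_sub (Differentiable.fun_finsetProd fun j hj => hfd j hj)
      (Differentiable.fun_sum fun l _ => Differentiable.fun_sum fun A hA => ?_)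
    rw [Finset.mem_powersetCard] at hA
    exact (Differentiable.fun_finsetProd fun j _ => had j).fun_mul
      (Differentiable.fun_finsetProd fun j hj => (hfd j (hA.1 hj)).fun_sub (had j))
  · simp only [hper, ratio_neg_pi]
  · refine (H.norm_brgRem_ratio_le (ha t) (fun j hj => (norm_le_jn _ t).trans (hd t j hj))
      (s + 1)).trans ?_
    exact mul_le_mul_of_nonneg_left (hsum t) (Real.exp_pos _).le
  · have hy := yt_pos ht ht0
    choose! a1 h1 h2 using ha' t
    obtain ⟨D, hD, hD'⟩ := H.brgRem_bounds hy (ha t) h1 h2 (hd t) (s + 1)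
    rw [hD.deriv, add_sub_cancel_left]
    refine hD'.trans ?_
    gcongr
    exact hsum t

theorem one_add_mul_inv_le {Γ l : ℝ} (hΓ : 0 ≤ Γ) (hl : 0 < l) :
    1 + Γ * (max 1 (Real.sqrt l) ^ 2)⁻¹ ≤ 1 + Γ * min 1 l⁻¹ := by
  have h := inv_pow_max_sqrt_le hl 2
  rw [show (-((2 : ℕ) : ℝ) / 2) = -1 by norm_num, Real.rpow_neg_one] at h
  gcongr

theorem estimate_tv {C C' c Γ R l x : ℝ} {q s : ℕ} (hC : 0 ≤ C) (hc : 0 ≤ c) (hΓ : 0 ≤ Γ)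
    (hR : 0 ≤ R) (hl : 0 < l) (hx : x = -(q : ℝ) / 2) (hC' : C * c ^ (s + 1) ≤ C') :
    C * (c * R) ^ (s + 1) * (1 + Γ * (max 1 (Real.sqrt l) ^ 2)⁻¹) *
      (max 1 (Real.sqrt l) ^ q)⁻¹ ≤ C' * (1 + Γ * min 1 l⁻¹) * R ^ (s + 1) * min 1 (l ^ x) := by
  have h1 := inv_pow_max_sqrt_le hl q
  have h2 := one_add_mul_inv_le hΓ hl
  have h3 : 0 ≤ 1 + Γ * min 1 l⁻¹ := by positivity
  have h4 : 0 ≤ C * c ^ (s + 1) := by positivity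
  rw [hx, mul_pow]
  calc _ ≤ C * (c ^ (s + 1) * R ^ (s + 1)) * (1 + Γ * min 1 l⁻¹) * min 1 (l ^ (-(q : ℝ) / 2)) := by
        gcongr
    _ = C * c ^ (s + 1) * (1 + Γ * min 1 l⁻¹) * R ^ (s + 1) * min 1 (l ^ (-(q : ℝ) / 2)) := by ring
    _ ≤ _ := by gcongr

/-- The factor containing `Γ` is at least one and is inserted only to match the form of the other
estimate. -/
theorem estimate_local {C C' c Γ R l x : ℝ} {q s : ℕ} (hC : 0 ≤ C) (hc : 0 ≤ c) (hΓ : 0 ≤ Γ)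
    (hR : 0 ≤ R) (hl : 0 < l) (hx : x = -(q : ℝ) / 2) (hC' : C * c ^ (s + 1) ≤ C') :
    C * (c * R) ^ (s + 1) * (max 1 (Real.sqrt l) ^ q)⁻¹ ≤
      C' * (1 + Γ * min 1 l⁻¹) * R ^ (s + 1) * min 1 (l ^ x) := by
  refine le_trans ?_ (estimate_tv hC hc hΓ hR hl hx hC')
  have h : 1 ≤ 1 + Γ * (max 1 (Real.sqrt l) ^ 2)⁻¹ := by
    have : 0 ≤ Γ * (max 1 (Real.sqrt l) ^ 2)⁻¹ := by positivity
    linarith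
  have h2 := le_mul_of_one_le_right (by positivity : 0 ≤ C * (c * R) ^ (s + 1)) h
  gcongr

theorem regular_of_hyps {P : Measure Ω} [IsProbabilityMeasure P]
    (hm : ∀ k ∈ Finset.Icc 1 n, Measurable (X k)) (h0 : ∀ ω, X 0 ω = 0) (hdep : OneDependent P X n)
    (h : ∀ k ∈ Finset.Icc 1 n, nu P X 1 k ≤ 1 / 100 ∧ nu P X 2 k ≤ nu P X 1 k ∧
      Integrable (fac X 4 k) P) : Regular P X n := by
  have hX0 : X 0 = fun _ => 0 := funext h0
  have hf : ∀ j, fac X (j + 1) 0 = fun _ => 0 := fun j => funext fun ω => by simp [fac, h0]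
  have hmem : ∀ k ≤ n, k ≠ 0 → k ∈ Finset.Icc 1 n := fun k hk hk0 =>
    Finset.mem_Icc.2 ⟨Nat.one_le_iff_ne_zero.2 hk0, hk⟩
  refine ⟨fun k hk => ?_, h0, hdep, fun k hk => ?_, fun k hk => ?_, fun k hk => ?_⟩ <;>
    rcases eq_or_ne k 0 with rfl | hk0
  · rw [hX0]; exact measurable_const
  · exact hm k (hmem k hk hk0)
  · rw [hf 3]; exact integrable_const _
  · exact (h k (hmem k hk hk0)).2.2
  · simp [nu, hf 0]
  · exact (h k (hmem k hk hk0)).1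
  · simp [nu, hf 0, hf 1]
  · exact (h k (hmem k hk hk0)).2.1

end

end Bergstrom

end

/-! ### Assembly of the four estimates -/

theorem mainTheorem2 (s : ℕ) :
    ∃ C : ℝ, 0 < C ∧
      ∀ (Ω : Type*) [MeasurableSpace Ω] (P : MeasureTheory.Measure Ω)
        [MeasureTheory.IsProbabilityMeasure P] (n : ℕ) (X : ℕ → Ω → ℕ),
        s ≤ n →
        (∀ k ∈ Finset.Icc 1 n, Measurable (X k)) →
        (∀ ω, X 0 ω = 0) →
        Bergstrom.OneDependent P X n →
        (∀ k ∈ Finset.Icc 1 n,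
          Bergstrom.nu P X 1 k ≤ 1 / 100 ∧
          Bergstrom.nu P X 2 k ≤ Bergstrom.nu P X 1 k ∧
          MeasureTheory.Integrable (Bergstrom.fac X 4 k) P) →
        0 < Bergstrom.lam P X n →
        Bergstrom.tvNorm (Bergstrom.errPois P X n s) ≤
            ENNReal.ofReal (C * (1 + Bergstrom.Gamma1 P X n * min 1 (Bergstrom.lam P X n)⁻¹) *
              Bergstrom.R0 P X n ^ (s + 1) *
              min 1 (Bergstrom.lam P X n ^ (-(s : ℝ) - 1))) ∧
        Bergstrom.localNorm (Bergstrom.errPois P X n s) ≤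
            ENNReal.ofReal (C * (1 + Bergstrom.Gamma1 P X n * min 1 (Bergstrom.lam P X n)⁻¹) *
              Bergstrom.R0 P X n ^ (s + 1) *
              min 1 (Bergstrom.lam P X n ^ (-(s : ℝ) - 3 / 2))) ∧
        Bergstrom.tvNorm (Bergstrom.errG P X n s) ≤
            ENNReal.ofReal (C * (1 + Bergstrom.Gamma1 P X n * min 1 (Bergstrom.lam P X n)⁻¹) *
              Bergstrom.R1 P X n ^ (s + 1) *
              min 1 (Bergstrom.lam P X n ^ (-(3 * (s : ℝ) + 3) / 2))) ∧
        Bergstrom.localNorm (Bergstrom.errG P X n s) ≤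
            ENNReal.ofReal (C * (1 + Bergstrom.Gamma1 P X n * min 1 (Bergstrom.lam P X n)⁻¹) *
              Bergstrom.R1 P X n ^ (s + 1) *
              min 1 (Bergstrom.lam P X n ^ (-(3 * (s : ℝ) + 4) / 2))) := by
  -- The remainder has order `y^{m(s+1)}` with `m = 2` for the Poisson factors and `m = 3` for `g`,
  -- and `p + 1 = m(s+1)`. The resulting powers of `λ` are `-(p+1)/2` in total variation and
  -- `-(p+2)/2` locally.
  obtain ⟨C1, hC1, H1⟩ := Bergstrom.exists_norm_invFourier_bounds (2 * s + 1) (s + 1)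
  obtain ⟨C2, hC2, H2⟩ := Bergstrom.exists_norm_invFourier_bounds (3 * s + 2) (s + 1)
  refine ⟨C1 * (6 * 1000) ^ (s + 1) + C2 * (6 * 30000) ^ (s + 1), by positivity, ?_⟩
  intro Ω _ P _ n X _ hm h0 hdep hmom hl
  have H := Bergstrom.regular_of_hyps hm h0 hdep hmom
  have hΓ : 0 ≤ Bergstrom.Gamma1 P X n := Finset.sum_nonneg fun k _ => Bergstrom.nu_nonneg _ _
  have hR0 : 0 ≤ Bergstrom.R0 P X n := Finset.sum_nonneg fun k _ => Bergstrom.r0_nonneg k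
  have hR1 : 0 ≤ Bergstrom.R1 P X n := Finset.sum_nonneg fun k _ => Bergstrom.r1_nonneg k
  have hK1 : C1 * (6 * 1000) ^ (s + 1) ≤
      C1 * (6 * 1000) ^ (s + 1) + C2 * (6 * 30000) ^ (s + 1) :=
    le_add_of_nonneg_right (by positivity)
  have hK2 : C2 * (6 * 30000) ^ (s + 1) ≤
      C1 * (6 * 1000) ^ (s + 1) + C2 * (6 * 30000) ^ (s + 1) :=
    le_add_of_nonneg_left (by positivity)
  have e1 : Bergstrom.errPois P X n s = Bergstrom.invFourier fun t =>
      Bergstrom.brgRem (s + 1) n (fun j => Bergstrom.ratio P X j t)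
        (fun j => Bergstrom.psi P X t j) :=
    funext fun k => H.err_eq (fun j => (Bergstrom.differentiable_psi j).continuous)
      (Bergstrom.pois P X n) Bergstrom.pois_eq s k
  have e2 : Bergstrom.errG P X n s = Bergstrom.invFourier fun t =>
      Bergstrom.brgRem (s + 1) n (fun j => Bergstrom.ratio P X j t)
        (fun j => Bergstrom.g P X t j) :=
    funext fun k => H.err_eq (fun j => (Bergstrom.differentiable_g j).continuous)
      (Bergstrom.lawG P X n) H.lawG_eq s k
  obtain ⟨b1, b2⟩ := H.invFourier_brgRem_bounds hl (m := 2) (by ring) H1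
    (a := fun j t => Bergstrom.psi P X t j) (c := 1000) (by norm_num) H.r0_zero
    Bergstrom.r0_nonneg Bergstrom.psi_neg_pi Bergstrom.differentiable_psi
    (fun t j _ => Bergstrom.norm_psi_le j t)
    (fun t j _ => by
      obtain ⟨a1, h1, h2⟩ := Bergstrom.psi_deriv (P := P) (X := X) j t
      refine ⟨a1, h1, h2.trans ?_⟩
      have h3 := (abs_nonneg _).trans (Bergstrom.abs_qk_le_sh (P := P) (X := X) j)
      have h4 := mul_nonneg (Bergstrom.yt_nonneg t) (by linarith : 0 ≤ Bergstrom.sh (Bergstrom.r0 P X) j)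
      have h5 := mul_nonneg (Bergstrom.yt_nonneg t) (Bergstrom.nu_nonneg (P := P) (X := X) 1 j)
      linarith)
    (fun t j hj => H.jn_ratio_sub_psi_le (Finset.mem_Icc.1 hj).2 t)
  obtain ⟨b3, b4⟩ := H.invFourier_brgRem_bounds hl (m := 3) (by ring) H2
    (a := fun j t => Bergstrom.g P X t j) (c := 30000) (by norm_num) H.r1_zero
    Bergstrom.r1_nonneg Bergstrom.g_neg_pi Bergstrom.differentiable_g
    (fun t j hj => H.norm_g_le (Finset.mem_Icc.1 hj).2 t)
    (fun t j hj => H.g_deriv (Finset.mem_Icc.1 hj).2 t)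
    (fun t j hj => H.jn_ratio_sub_g_le (Finset.mem_Icc.1 hj).1 (Finset.mem_Icc.1 hj).2 t)
  rw [e1, e2]
  refine ⟨Bergstrom.tvNorm_le fun S => (b1 S).trans ?_,
    Bergstrom.localNorm_le fun k => (b2 k).trans ?_,
    Bergstrom.tvNorm_le fun S => (b3 S).trans ?_,
    Bergstrom.localNorm_le fun k => (b4 k).trans ?_⟩
  · exact Bergstrom.estimate_tv hC1.le (by norm_num) hΓ hR0 hl (by push_cast; ring) hK1
  · exact Bergstrom.estimate_local hC1.le (by norm_num) hΓ hR0 hl (by push_cast; ring) hK1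
  · exact Bergstrom.estimate_tv hC2.le (by norm_num) hΓ hR1 hl (by push_cast; ring) hK2
  · exact Bergstrom.estimate_local hC2.le (by norm_num) hΓ hR1 hl (by push_cast; ring) hK2
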